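/- Let $0\le k<n$ be integers and let $$S^k=\{x\in\mathbb R^n:\ x_1^2+\dots+x_{k+1}^2=1,\ x_{k+2}=\dots=x_n=0\},\qquad f(x)=\operatorname{dist}(x,S^k),\qquad S_t=f^{-1}(t).$$ When $n=3$ and $k=1$, every $S_t$ with $0<t<1$ is a torus (homeomorphic to $S^1\times S^1$). Let $0<\varepsilon<1$, let $h$ be a harmonic function on $f^{-1}([0,1-\varepsilon))$ that is not identically zero there, and let $H(t)=\int_{S_t}h^2\,d\sigma_t$, where $\sigma_t$ is the $(n-1)$-dimensional surface measure. Put $$C=1+k\Big(\frac1\varepsilon-\frac1{2-\varepsilon}\Big),\qquad B=-(n-1)+\frac{2k}{2-\varepsilon}-\frac{k}{\varepsilon^2}+\Big(n-1-\frac k\varepsilon\Big)C .$$ (i) For all $0<t<1-\varepsilon$ the integral $H(t)$ is finite and positive, $H$ is twice differentiable at $t$, and $$\frac{H''(t)H(t)-H'(t)^2+\frac Ct H(t)H'(t)}{H(t)^2}\ \ge\ \frac B{t^2},\qquad\text{that is,}\qquad (\log H)''(t)+\frac Ct(\log H)'(t)\ \ge\ \frac B{t^2}.$$ (ii) If $k\ge1$,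 then $C>1$; whenever $0<t_0\le t_1\le t_2<1-\varepsilon$ and $\alpha\in\mathbb R$ satisfy $(1-\alpha)(t_1/t_2)^{C-1}+\alpha(t_1/t_0)^{C-1}=1$, one has $$H(t_1)\le\Big(\frac{t_0}{t_1}\Big)^{\alpha\frac{-B}{C-1}}\Big(\frac{t_2}{t_1}\Big)^{(1-\alpha)\frac{-B}{C-1}}H(t_0)^{\alpha}H(t_2)^{1-\alpha},$$ and $t\mapsto t^{C-1}\Big(\dfrac{tH'(t)}{H(t)}+\dfrac{-B}{C-1}\Big)$ is nondecreasing on $(0,1-\varepsilon)$. (iii) If $k=0$, then $C=1$; whenever $0<t_0\le t_1\le t_2<1-\varepsilon$ and $\alpha\in\mathbb R$ satisfy $(1-\alpha)\log(t_1/t_2)+\alpha\log(t_1/t_0)=0$, one has $$H(t_1)\le\exp\Big(-\frac{-B}{2}\log\frac{t_0}{t_1}\log\frac{t_2}{t_1}\Big)H(t_0)^{\alpha}H(t_2)^{1-\alpha},$$ and $t\mapsto \dfrac{tH'(t)}{H(t)}-B\log t$ is nondecreasing on $(0,1-\varepsilon)$ (in this case $B=0$). -/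

import Mathlib

open Real Set MeasureTheory InnerProductSpace

noncomputable section

/-- The unit sphere `S^k` of the first `k + 1` coordinates, placed in `ℝⁿ` by setting the
remaining coordinates to zero. -/
def flatSphere (n k : ℕ) : Set (EuclideanSpace ℝ (Fin n)) :=
  {x | ∑ i : Fin n with i.val ≤ k, x i ^ 2 = 1 ∧ ∀ i : Fin n, k < i.val → x i = 0}

/-- The distance function `f(x) = dist(x, S^k)`. -/
def distToSphere (n k : ℕ) (x : EuclideanSpace ℝ (Fin n)) : ℝ :=
  Metric.infDist x (flatSphere n k)

/-- The tube `f⁻¹([0, R))`. -/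
def sphereTube (n k : ℕ) (R : ℝ) : Set (EuclideanSpace ℝ (Fin n)) :=
  distToSphere n k ⁻¹' Ico 0 R

/-- The level surface `S_t = f⁻¹(t)`. -/
def levelSurface (n k : ℕ) (t : ℝ) : Set (EuclideanSpace ℝ (Fin n)) :=
  distToSphere n k ⁻¹' {t}

/-- `H(t) = ∫_{S_t} h² dσ_t`; the surface measure `σ_t` is the `(n-1)`-dimensional Hausdorff
measure, normalised as the Euclidean area. -/
def surfaceEnergy (n k : ℕ) (h : EuclideanSpace ℝ (Fin n) → ℝ) (t : ℝ) : ℝ :=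
  ∫ x in levelSurface n k t, h x ^ 2 ∂μHE[n - 1]

/-- The constant `C = 1 + k (1/ε - 1/(2-ε))`. -/
def dampingConst (k : ℕ) (ε : ℝ) : ℝ :=
  1 + k * (1 / ε - 1 / (2 - ε))

/-- The constant
`B = -(n-1) + 2k/(2-ε) - k/ε² + (n-1-k/ε) C`. -/
def lowerConst (n k : ℕ) (ε : ℝ) : ℝ :=
  -((n : ℝ) - 1) + 2 * k / (2 - ε) - k / ε ^ 2 + ((n : ℝ) - 1 - k / ε) * dampingConst k ε

end

open Real Set MeasureTheory InnerProductSpace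
noncomputable section

namespace SphereTube

/-! ### The distance to the flat sphere -/

/-! Let `ρ` be the norm of the first `k + 1` coordinates and `f` the distance to `S^k`. Then `f² =
|x|² - 2ρ + 1`, and `X = f∇f` is smooth for `f < 1`, where `ρ > 0`. With `n = k + 1 + m`, the points
with `0 < f < 1` correspond bijectively to pairs `(s, σ)` with `σ ∈ S^k × S^m`, and surface measure
on `S_s` has density `s^m (1 + s cos θ)^k`. So `H` is an integral over a fixed compact space. With
`g = fΔf = n - 1 - k/ρ` one gets `H' = ∫ (g/t) h² + 2 ∫ h ∂_ν h`, and by the divergence theorem in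
tubes (`flux_eq_integral_levelDivergence`) the last integral has derivative `∫_{S_t} |∇h|²`.

The point is to bound `|∇h|²` from below by `(∂_ν h)²` on average. This is done by a Rellich field,
`|∇h|² X - 2⟨X, ∇h⟩∇h + ψ h ∇h - ½ h² ∇ψ`, whose divergence contains no second derivative of `h`
because `h` is harmonic (`divergence_rellichField`). Take `ψ` superharmonic with `ψ = C - g` on
`S_t`. Since `½ Hess f² ≤ 1` and `C ≥ 1`, the divergence is nonnegative inside `S_t`, hence so is
the flux. Inserting this in the formula for `H''` gives, for every real `l`, that `t²H'' + CtH' - BH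
- 2ltH' + l²H` is at least the integral of `(2t ∂_ν h + gh - lh)²` and a nonnegative multiple of
`h²` (`energy_inequality`). The choice `l = tH'/H` is the differential inequality.

The natural weight contains `k/ρ`, which is superharmonic unless `k = 1`. For circles the term
`-2/(1 - f²)` repairs this, and `B` has enough slack to absorb its boundary contribution.

If `A(C - 1) = -B`, the inequality says that `t^C (log H + A log t)'` is nondecreasing, so `log H +
A log t` is convex as a function of `φ` when `φ' = t^(-C)`. This yields the monotone quantities and
the three-surface inequalities. It also gives positivity: a convex function lies above its tangents,
so `H` cannot fall to zero going inwards from a positive value, while a zero of `H` forces `h = 0`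
inside by the divergence theorem. -/

/-- The orthogonal projection of `ℝⁿ` onto the span of the first `k + 1` coordinates. -/
def corePart (n k : ℕ) : EuclideanSpace ℝ (Fin n) →L[ℝ] EuclideanSpace ℝ (Fin n) :=
  LinearMap.toContinuousLinearMap
    { toFun := fun x => WithLp.toLp 2 fun i => if i.val ≤ k then x i else 0
      map_add' := fun x y => by ext i; by_cases h : i.val ≤ k <;> simp [h]
      map_smul' := fun c x => by ext i; by_cases h : i.val ≤ k <;> simp [h] }

variable {n k : ℕ}

lemma corePart_apply (x : EuclideanSpace ℝ (Fin n)) (i : Fin n) :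
    corePart n k x i = if i.val ≤ k then x i else 0 := rfl

lemma corePart_corePart (x : EuclideanSpace ℝ (Fin n)) :
    corePart n k (corePart n k x) = corePart n k x := by
  ext i; by_cases h : i.val ≤ k <;> simp [corePart_apply, h]

lemma inner_corePart_left (x y : EuclideanSpace ℝ (Fin n)) :
    ⟪corePart n k x, y⟫_ℝ = ⟪x, corePart n k y⟫_ℝ := by
  simp only [PiLp.inner_apply, corePart_apply]
  refine Finset.sum_congr rfl fun i _ => ?_
  by_cases h : i.val ≤ k <;> simp [h]

lemma inner_corePart_corePart (x y : EuclideanSpace ℝ (Fin n)) :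
    ⟪corePart n k x, corePart n k y⟫_ℝ = ⟪corePart n k x, y⟫_ℝ := by
  rw [← inner_corePart_left, corePart_corePart]

lemma inner_corePart_self (x : EuclideanSpace ℝ (Fin n)) :
    ⟪corePart n k x, x⟫_ℝ = ‖corePart n k x‖ ^ 2 := by
  rw [← inner_corePart_corePart, real_inner_self_eq_norm_sq]

/-- The distance to the axis, the norm of the first `k + 1` coordinates. -/
def axisDist (n k : ℕ) (x : EuclideanSpace ℝ (Fin n)) : ℝ := ‖corePart n k x‖

/-- The square of the distance to the flat sphere. -/
def sqDist (n k : ℕ) (x : EuclideanSpace ℝ (Fin n)) : ℝ := ‖x‖ ^ 2 - 2 * axisDist n k x + 1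

lemma axisDist_nonneg (x : EuclideanSpace ℝ (Fin n)) : 0 ≤ axisDist n k x := norm_nonneg _

lemma continuous_axisDist : Continuous (axisDist n k) := by unfold axisDist; fun_prop

lemma continuous_sqDist : Continuous (sqDist n k) := by
  unfold sqDist; have := continuous_axisDist (n := n) (k := k); fun_prop

lemma mem_flatSphere (x : EuclideanSpace ℝ (Fin n)) :
    x ∈ flatSphere n k ↔ corePart n k x = x ∧ ‖x‖ = 1 := by
  have key : ∑ i : Fin n with i.val ≤ k, x i ^ 2 = ‖corePart n k x‖ ^ 2 := by
    rw [EuclideanSpace.norm_sq_eq, Finset.sum_filter]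
    refine Finset.sum_congr rfl fun i _ => ?_
    by_cases h : i.val ≤ k <;> simp [corePart_apply, h]
  have h2 : (∀ i : Fin n, k < i.val → x i = 0) ↔ corePart n k x = x := by
    constructor
    · intro h
      ext i
      by_cases hi : i.val ≤ k
      · simp [corePart_apply, hi]
      · simp [corePart_apply, hi, h i (not_le.1 hi)]
    · intro h i hi
      rw [← h, corePart_apply, if_neg (not_le.2 hi)]
  rw [flatSphere, mem_ofPred_eq, key, h2]
  constructor
  · rintro ⟨h, h'⟩
    rw [h'] at h
    exact ⟨h', by nlinarith [norm_nonneg x]⟩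
  · rintro ⟨h, h'⟩
    rw [h, h']
    simp

lemma norm_sq_ge_axisDist_sq (x : EuclideanSpace ℝ (Fin n)) : axisDist n k x ^ 2 ≤ ‖x‖ ^ 2 := by
  have h := real_inner_le_norm (corePart n k x) x
  rw [inner_corePart_self] at h
  have : axisDist n k x ≤ ‖x‖ := by
    by_contra hc
    push Not at hc
    unfold axisDist at *
    nlinarith [norm_nonneg x, norm_nonneg (corePart n k x)]
  exact pow_le_pow_left₀ (axisDist_nonneg x) this 2

/-- Geometrically, moving by less than one from `S^k` cannot reach the axis `ρ = 0`, where the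
distance function and its square are singular. The same bound drives the estimate of the weight for
circles. -/
lemma sub_one_sq_le_sqDist (x : EuclideanSpace ℝ (Fin n)) :
    (axisDist n k x - 1) ^ 2 ≤ sqDist n k x := by
  have := norm_sq_ge_axisDist_sq (k := k) x
  unfold sqDist; nlinarith

lemma sqDist_nonneg (x : EuclideanSpace ℝ (Fin n)) : 0 ≤ sqDist n k x :=
  (sq_nonneg _).trans (sub_one_sq_le_sqDist x)

/-- The squared distance is affine in `s` on `S^k`, so finding the nearest point is the equality
case of Cauchy–Schwarz. -/
lemma dist_sq_flatSphere {x s : EuclideanSpace ℝ (Fin n)} (hs : s ∈ flatSphere n k) :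
    dist x s ^ 2 = ‖x‖ ^ 2 - 2 * ⟪corePart n k x, s⟫_ℝ + 1 := by
  obtain ⟨h1, h2⟩ := (mem_flatSphere s).1 hs
  rw [dist_eq_norm, norm_sub_sq_real, h2, inner_corePart_left, h1]
  norm_num

lemma exists_nearest (hkn : k < n) (x : EuclideanSpace ℝ (Fin n)) :
    ∃ s ∈ flatSphere n k, ⟪corePart n k x, s⟫_ℝ = axisDist n k x := by
  by_cases h : corePart n k x = 0
  -- On the axis all points of `S^k` are equally near, so any one will do.
  · have h0 : 0 < n := by omega
    refine ⟨EuclideanSpace.single ⟨0, h0⟩ 1, (mem_flatSphere _).2 ⟨?_, by simp⟩, by simp [h, axisDist]⟩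
    ext i
    rw [corePart_apply]
    split_ifs with hi
    · rfl
    · have : i ≠ ⟨0, h0⟩ := by rintro rfl; simp at hi
      simp [this]
  · have hn : ‖corePart n k x‖ ≠ 0 := norm_ne_zero_iff.2 h
    refine ⟨‖corePart n k x‖⁻¹ • corePart n k x, (mem_flatSphere _).2 ⟨?_, ?_⟩, ?_⟩
    · rw [map_smul, corePart_corePart]
    · rw [norm_smul, norm_inv, norm_norm, inv_mul_cancel₀ hn]
    · rw [inner_smul_right, real_inner_self_eq_norm_sq, axisDist]
      field_simp

theorem distToSphere_eq (hkn : k < n) (x : EuclideanSpace ℝ (Fin n)) :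
    distToSphere n k x = √(sqDist n k x) := by
  obtain ⟨s, hs, hxs⟩ := exists_nearest hkn x
  refine le_antisymm ?_ ?_
  · refine (Metric.infDist_le_dist_of_mem hs).trans (Real.le_sqrt_of_sq_le ?_)
    rw [dist_sq_flatSphere hs, hxs, sqDist]
  · refine (Metric.le_infDist ⟨s, hs⟩).2 fun {y} hy => ?_
    rw [Real.sqrt_le_left dist_nonneg, dist_sq_flatSphere hy, sqDist]
    have := real_inner_le_norm (corePart n k x) y
    rw [((mem_flatSphere y).1 hy).2, mul_one] at this
    unfold axisDist
    linarith

lemma mem_sphereTube (hkn : k < n) {R : ℝ} (hR : 0 < R) (x : EuclideanSpace ℝ (Fin n)) :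
    x ∈ sphereTube n k R ↔ sqDist n k x < R ^ 2 := by
  simp only [sphereTube, mem_preimage, distToSphere_eq hkn, mem_Ico, Real.sqrt_nonneg, true_and]
  exact Real.sqrt_lt' hR

lemma mem_levelSurface (hkn : k < n) {t : ℝ} (ht : 0 < t) (x : EuclideanSpace ℝ (Fin n)) :
    x ∈ levelSurface n k t ↔ sqDist n k x = t ^ 2 := by
  simp only [levelSurface, mem_preimage, distToSphere_eq hkn, mem_singleton_iff]
  rw [Real.sqrt_eq_iff_mul_self_eq (sqDist_nonneg x) ht.le, sq, eq_comm]

lemma axisDist_pos {x : EuclideanSpace ℝ (Fin n)} (hx : sqDist n k x < 1) : 0 < axisDist n k x := by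
  have := sub_one_sq_le_sqDist (k := k) x
  nlinarith [axisDist_nonneg (k := k) x]

/-- The field `f ∇f = ½ ∇f²`. -/
def radialField (n k : ℕ) (x : EuclideanSpace ℝ (Fin n)) : EuclideanSpace ℝ (Fin n) :=
  x - (axisDist n k x)⁻¹ • corePart n k x

/-! ### Tube coordinates -/

variable {m : ℕ}

/-- The parameter space `S^k × S^m` of a level surface. -/
abbrev Params (k m : ℕ) : Type :=
  Metric.sphere (0 : EuclideanSpace ℝ (Fin (k + 1))) 1 ×
    Metric.sphere (0 : EuclideanSpace ℝ (Fin (m + 1))) 1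

/-- The vector with first coordinates `y` and last coordinates `z`. -/
def append (y : EuclideanSpace ℝ (Fin (k + 1))) (z : Fin m → ℝ) :
    EuclideanSpace ℝ (Fin (k + 1 + m)) := WithLp.toLp 2 (Fin.append y z)

lemma continuous_append : Continuous fun p : EuclideanSpace ℝ (Fin (k + 1)) × (Fin m → ℝ) =>
    append p.1 p.2 := by
  refine (PiLp.continuous_toLp 2 _).comp (continuous_pi fun i => ?_)
  refine Fin.addCases (fun i => ?_) (fun i => ?_) i
  · simp only [Fin.append_left]; fun_prop
  · simp only [Fin.append_right]; fun_prop

lemma inner_append (y y' : EuclideanSpace ℝ (Fin (k + 1))) (z z' : Fin m → ℝ) :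
    ⟪append y z, append y' z'⟫_ℝ = ⟪y, y'⟫_ℝ + ∑ i, z i * z' i := by
  simp [append, PiLp.inner_apply, Fin.sum_univ_add, mul_comm]

lemma append_add (y y' : EuclideanSpace ℝ (Fin (k + 1))) (z z' : Fin m → ℝ) :
    append y z + append y' z' = append (y + y') (z + z') := by
  ext i
  refine Fin.addCases (fun i => ?_) (fun i => ?_) i <;> simp [append]

lemma smul_append (c : ℝ) (y : EuclideanSpace ℝ (Fin (k + 1))) (z : Fin m → ℝ) :
    c • append y z = append (c • y) (c • z) := by
  ext i
  refine Fin.addCases (fun i => ?_) (fun i => ?_) i <;> simp [append]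

lemma corePart_append (y : EuclideanSpace ℝ (Fin (k + 1))) (z : Fin m → ℝ) :
    corePart (k + 1 + m) k (append y z) = append y 0 := by
  ext i
  refine Fin.addCases (fun i => ?_) (fun i => ?_) i
  · simp [corePart_apply, append, Nat.lt_succ_iff.1 i.2]
  · simp [corePart_apply, append]; omega

lemma exists_append (x : EuclideanSpace ℝ (Fin (k + 1 + m))) : ∃ y z, x = append y z := by
  refine ⟨WithLp.toLp 2 fun i => x (Fin.castAdd m i), fun i => x (Fin.natAdd (k + 1) i), ?_⟩
  ext i
  refine Fin.addCases (fun i => ?_) (fun i => ?_) i <;> simp [append]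

lemma append_inj {y y' : EuclideanSpace ℝ (Fin (k + 1))} {z z' : Fin m → ℝ}
    (h : append y z = append y' z') : y = y' ∧ z = z' := by
  constructor
  · ext i; simpa [append] using congrArg (fun x => x (Fin.castAdd m i)) h
  · ext i; simpa [append] using congrArg (fun x => x (Fin.natAdd (k + 1) i)) h

lemma norm_append_sq (y : EuclideanSpace ℝ (Fin (k + 1))) (z : Fin m → ℝ) :
    ‖append y z‖ ^ 2 = ‖y‖ ^ 2 + ∑ i, z i ^ 2 := by
  rw [← real_inner_self_eq_norm_sq, inner_append, real_inner_self_eq_norm_sq]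
  simp [sq]

lemma axisDist_append (y : EuclideanSpace ℝ (Fin (k + 1))) (z : Fin m → ℝ) :
    axisDist (k + 1 + m) k (append y z) = ‖y‖ := by
  rw [axisDist, corePart_append, ← sq_eq_sq₀ (norm_nonneg _) (norm_nonneg _), norm_append_sq]
  simp

lemma sqDist_append (y : EuclideanSpace ℝ (Fin (k + 1))) (z : Fin m → ℝ) :
    sqDist (k + 1 + m) k (append y z) = (‖y‖ - 1) ^ 2 + ∑ i, z i ^ 2 := by
  rw [sqDist, norm_append_sq, axisDist_append]; ring

/-- The first coordinate of the second sphere, the cosine of the polar angle. -/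
def cosAngle (σ : Params k m) : ℝ := σ.2.1 0

/-- The point of `S^k` nearest to the point with parameter `σ`. -/
def foot (σ : Params k m) : EuclideanSpace ℝ (Fin (k + 1 + m)) := append σ.1.1 0

/-- The unit normal `∇f` at parameter `σ`. -/
def unitNormal (σ : Params k m) : EuclideanSpace ℝ (Fin (k + 1 + m)) :=
  append (cosAngle σ • σ.1.1) fun i => σ.2.1 i.succ

/-- Tube coordinates: the point at distance `s` from `S^k` in direction `σ`. -/
def tubePoint (s : ℝ) (σ : Params k m) : EuclideanSpace ℝ (Fin (k + 1 + m)) :=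
  foot σ + s • unitNormal σ

lemma continuous_cosAngle : Continuous (cosAngle (k := k) (m := m)) := by
  unfold cosAngle; fun_prop

lemma continuous_foot : Continuous (foot (k := k) (m := m)) :=
  continuous_append.comp (f := fun σ : Params k m => (σ.1.1, (0 : Fin m → ℝ))) (by fun_prop)

lemma continuous_unitNormal : Continuous (unitNormal (k := k) (m := m)) := by
  have h := continuous_cosAngle (k := k) (m := m)
  exact continuous_append.comp
    (f := fun σ : Params k m => (cosAngle σ • σ.1.1, fun i : Fin m => σ.2.1 i.succ)) (by fun_prop)

lemma continuous_tubePoint : Continuous fun p : ℝ × Params k m => tubePoint p.1 p.2 := by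
  have h1 := continuous_foot (k := k) (m := m)
  have h2 := continuous_unitNormal (k := k) (m := m)
  unfold tubePoint; fun_prop

lemma norm_fst (σ : Params k m) : ‖σ.1.1‖ = 1 := by simp

lemma cosAngle_sq_add (σ : Params k m) : cosAngle σ ^ 2 + ∑ i : Fin m, σ.2.1 i.succ ^ 2 = 1 := by
  have h : ‖σ.2.1‖ = 1 := by simp
  have h2 : ‖σ.2.1‖ ^ 2 = 1 := by rw [h]; norm_num
  rw [EuclideanSpace.norm_sq_eq, Fin.sum_univ_succ] at h2
  simpa [cosAngle] using h2

lemma abs_cosAngle_le (σ : Params k m) : |cosAngle σ| ≤ 1 := by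
  rw [← sq_le_one_iff_abs_le_one, ← cosAngle_sq_add σ]
  exact le_add_of_nonneg_right (Finset.sum_nonneg fun i _ => sq_nonneg _)

lemma tubePoint_eq (s : ℝ) (σ : Params k m) :
    tubePoint s σ = append ((1 + s * cosAngle σ) • σ.1.1) (s • fun i : Fin m => σ.2.1 i.succ) := by
  rw [tubePoint, foot, unitNormal, smul_append, append_add, smul_smul, add_smul, one_smul, zero_add]

lemma norm_unitNormal (σ : Params k m) : ‖unitNormal σ‖ = 1 := by
  have : ‖unitNormal σ‖ ^ 2 = 1 := by
    rw [unitNormal, norm_append_sq, norm_smul, norm_fst, mul_one, Real.norm_eq_abs, sq_abs,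
      cosAngle_sq_add]
  nlinarith [norm_nonneg (unitNormal σ)]

lemma one_add_mul_cosAngle_mem {s : ℝ} (hs : 0 ≤ s) (σ : Params k m) :
    1 + s * cosAngle σ ∈ Icc (1 - s) (1 + s) := by
  have := abs_le.1 (abs_cosAngle_le σ)
  constructor <;> nlinarith

lemma one_add_mul_cosAngle_pos {s : ℝ} (hs : |s| < 1) (σ : Params k m) :
    0 < 1 + s * cosAngle σ := by
  have h1 : |s * cosAngle σ| < 1 := by
    rw [abs_mul]
    nlinarith [abs_cosAngle_le σ, abs_nonneg s, abs_nonneg (cosAngle σ)]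
  linarith [(abs_lt.1 h1).1]

lemma axisDist_tubePoint {s : ℝ} (hs : |s| < 1) (σ : Params k m) :
    axisDist (k + 1 + m) k (tubePoint s σ) = 1 + s * cosAngle σ := by
  rw [tubePoint_eq, axisDist_append, norm_smul, norm_fst, mul_one, Real.norm_eq_abs,
    abs_of_pos (one_add_mul_cosAngle_pos hs σ)]

lemma sqDist_tubePoint {s : ℝ} (hs : |s| < 1) (σ : Params k m) :
    sqDist (k + 1 + m) k (tubePoint s σ) = s ^ 2 := by
  rw [tubePoint_eq, sqDist_append, norm_smul, norm_fst, mul_one, Real.norm_eq_abs,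
    abs_of_pos (one_add_mul_cosAngle_pos hs σ)]
  have := cosAngle_sq_add σ
  simp only [Pi.smul_apply, smul_eq_mul, mul_pow, ← Finset.mul_sum]
  linear_combination s ^ 2 * this

lemma radialField_tubePoint {s : ℝ} (hs : |s| < 1) (σ : Params k m) :
    radialField (k + 1 + m) k (tubePoint s σ) = s • unitNormal σ := by
  have h := one_add_mul_cosAngle_pos hs σ
  have : corePart (k + 1 + m) k (tubePoint s σ) = (1 + s * cosAngle σ) • foot σ := by
    rw [tubePoint_eq, corePart_append, foot, smul_append, smul_zero]
  rw [radialField, axisDist_tubePoint hs, this, smul_smul, inv_mul_cancel₀ h.ne', one_smul, tubePoint,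
    add_sub_cancel_left]

/-- The radius is recovered from `sqDist`, the polar angle from `axisDist`, and then both sphere
coordinates by cancelling positive scalars. -/
lemma tubePoint_injOn :
    InjOn (fun p : ℝ × Params k m => tubePoint p.1 p.2) (Ioo 0 1 ×ˢ univ) := by
  rintro ⟨s, σ⟩ ⟨⟨hs0, hs1⟩, -⟩ ⟨s', σ'⟩ ⟨⟨hs0', hs1'⟩, -⟩ (h : tubePoint s σ = tubePoint s' σ')
  have a : |s| < 1 := by rw [abs_of_pos hs0]; exact hs1
  have a' : |s'| < 1 := by rw [abs_of_pos hs0']; exact hs1'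
  have e1 : s = s' := by
    have := sqDist_tubePoint a σ
    rw [h, sqDist_tubePoint a'] at this
    exact ((sq_eq_sq₀ hs0'.le hs0.le).1 this).symm
  subst e1
  have e2 : cosAngle σ = cosAngle σ' := by
    have := axisDist_tubePoint a σ
    rw [h, axisDist_tubePoint a] at this
    have h2 : s * cosAngle σ' = s * cosAngle σ := by linarith
    exact (mul_left_cancel₀ hs0.ne' h2).symm
  rw [tubePoint_eq, tubePoint_eq, e2] at h
  obtain ⟨h1, h2⟩ := append_inj h
  have h1' := smul_right_injective _ (one_add_mul_cosAngle_pos a σ').ne' h1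
  have h2' := smul_right_injective _ hs0.ne' h2
  refine Prod.ext rfl (Prod.ext (Subtype.ext h1') (Subtype.ext ?_))
  ext i
  refine Fin.cases e2 (fun i => congrFun h2' i) i

lemma exists_tubePoint {s : ℝ} (hs0 : 0 < s) (hs1 : s < 1)
    {x : EuclideanSpace ℝ (Fin (k + 1 + m))} (hx : sqDist (k + 1 + m) k x = s ^ 2) :
    ∃ σ : Params k m, tubePoint s σ = x := by
  have hp : 0 < axisDist (k + 1 + m) k x := axisDist_pos (by rw [hx]; nlinarith)
  obtain ⟨y, z, rfl⟩ := exists_append x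
  rw [sqDist_append] at hx
  rw [axisDist_append] at hp
  -- The first factor is the direction of `y`; the second is the unit vector along `(ρ - 1, z)`, a
  -- vector of length `s`.
  refine ⟨(⟨‖y‖⁻¹ • y, ?_⟩, ⟨WithLp.toLp 2 (Fin.cons ((‖y‖ - 1) / s) fun i => z i / s), ?_⟩), ?_⟩
  · rw [mem_sphere_zero_iff_norm, norm_smul, norm_inv, norm_norm, inv_mul_cancel₀ hp.ne']
  · rw [mem_sphere_zero_iff_norm, ← sq_eq_sq₀ (norm_nonneg _) zero_le_one, EuclideanSpace.norm_sq_eq,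
      Fin.sum_univ_succ]
    simp only [Fin.cons_zero, Fin.cons_succ, Real.norm_eq_abs, sq_abs, div_pow, ← Finset.sum_div,
      ← add_div, hx]
    rw [div_self (by positivity)]; norm_num
  · rw [tubePoint_eq]
    congr 1
    · have : s * ((‖y‖ - 1) / s) = ‖y‖ - 1 := by field_simp
      simp [cosAngle, this, smul_smul, hp.ne']
    · ext i
      simp only [Fin.cons_succ, Pi.smul_apply, smul_eq_mul]
      field_simp

lemma range_tubePoint {t : ℝ} (ht0 : 0 < t) (ht1 : t < 1) :
    range (tubePoint (k := k) (m := m) t) = levelSurface (k + 1 + m) k t := by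
  ext x
  rw [mem_levelSurface (by omega) ht0]
  constructor
  · rintro ⟨σ, rfl⟩
    exact sqDist_tubePoint (by rwa [abs_of_pos ht0]) σ
  · exact exists_tubePoint ht0 ht1

lemma tubePoint_injective {t : ℝ} (ht0 : 0 < t) (ht1 : t < 1) :
    Function.Injective (tubePoint (k := k) (m := m) t) := fun σ σ' h =>
  (Prod.ext_iff.1 (tubePoint_injOn (x₁ := (t, σ)) (x₂ := (t, σ')) ⟨⟨ht0, ht1⟩, trivial⟩
    ⟨⟨ht0, ht1⟩, trivial⟩ h)).2

lemma continuous_tubePoint_right (t : ℝ) : Continuous (tubePoint (k := k) (m := m) t) :=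
  continuous_tubePoint.comp (f := fun σ => (t, σ)) (by fun_prop)

/-- The parametrisation of a level surface, as a homeomorphism. -/
def levelHomeo {t : ℝ} (ht0 : 0 < t) (ht1 : t < 1) :
    Params k m ≃ₜ levelSurface (k + 1 + m) k t :=
  Continuous.homeoOfEquivCompactToT2
    (f := (Equiv.ofInjective _ (tubePoint_injective ht0 ht1)).trans
      (Equiv.setCongr (range_tubePoint ht0 ht1)))
    ((continuous_tubePoint_right t).subtype_mk _)

/-- The unit circle of the Euclidean plane. -/
def circleHomeo : Metric.sphere (0 : EuclideanSpace ℝ (Fin (1 + 1))) 1 ≃ₜ Circle :=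
  (Complex.orthonormalBasisOneI.repr.toHomeomorph.subtype (fun z => by
    change z ∈ Metric.sphere (0 : ℂ) 1 ↔ _
    simp)).symm

theorem nonempty_homeomorph_torus {t : ℝ} (ht : t ∈ Ioo (0 : ℝ) 1) :
    Nonempty (levelSurface (1 + 1 + 1) 1 t ≃ₜ Circle × Circle) :=
  ⟨(levelHomeo ht.1 ht.2).symm.trans (circleHomeo.prodCongr circleHomeo)⟩

end SphereTube
end

open Real Set MeasureTheory InnerProductSpace
noncomputable section

namespace SphereTube

/-! ### Lebesgue measure in tube coordinates -/

/-- Polar coordinates, in the form used twice below: in `ℝ^(k+1)` around the axis and in `ℝ^(m+1)`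
around `S^k`. -/
theorem lintegral_eq_lintegral_toSphere {E : Type*} [NormedAddCommGroup E] [NormedSpace ℝ E]
    [MeasurableSpace E] [BorelSpace E] [FiniteDimensional ℝ E] [Nontrivial E] (μ : Measure E)
    [μ.IsAddHaarMeasure] {F : E → ENNReal} (hF : Measurable F) :
    ∫⁻ x, F x ∂μ = ∫⁻ ω, ∫⁻ r in Ioi (0 : ℝ),
      ENNReal.ofReal (r ^ (Module.finrank ℝ E - 1)) * F (r • ω.1) ∂volume ∂μ.toSphere := by
  have h1 : ∫⁻ x, F x ∂μ = ∫⁻ x : ({(0 : E)}ᶜ : Set E), F x ∂(μ.comap (↑)) := by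
    rw [lintegral_subtype_comap (measurableSet_singleton _).compl, restrict_compl_singleton]
  have h2 := (μ.measurePreserving_homeomorphUnitSphereProd).symm
    (homeomorphUnitSphereProd E).toMeasurableEquiv
  rw [h1, ← h2.lintegral_comp_emb (MeasurableEquiv.measurableEmbedding _),
    lintegral_prod _ (by
      refine (hF.comp measurable_subtype_coe |>.comp (MeasurableEquiv.measurable _)).aemeasurable)]
  refine lintegral_congr fun ω => ?_
  rw [Measure.volumeIoiPow, lintegral_withDensity_eq_lintegral_mul _ (by fun_prop) (by
    refine hF.comp measurable_subtype_coe |>.comp (MeasurableEquiv.measurable _) |>.comp ?_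
    exact measurable_prodMk_left)]
  exact lintegral_subtype_comap measurableSet_Ioi
    (fun r : ℝ => ENNReal.ofReal (r ^ (Module.finrank ℝ E - 1)) * F (r • ω.1))

variable {k m : ℕ}

lemma measurePreserving_append :
    MeasurePreserving (fun p : EuclideanSpace ℝ (Fin (k + 1)) × (Fin m → ℝ) => append p.1 p.2) := by
  have h1 : MeasurePreserving (Prod.map (@WithLp.ofLp 2 (Fin (k + 1) → ℝ)) (id : (Fin m → ℝ) → _)) :=
    (PiLp.volume_preserving_ofLp (Fin (k + 1))).prod (MeasurePreserving.id _)
  have h2 := volume_measurePreserving_sumPiEquivProdPi_symm (fun _ : Fin (k + 1) ⊕ Fin m => ℝ)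
  have h3 := volume_measurePreserving_piCongrLeft (fun _ : Fin (k + 1 + m) => ℝ) finSumFinEquiv
  have h4 := PiLp.volume_preserving_toLp (Fin (k + 1 + m))
  convert h4.comp (h3.comp (h2.comp h1)) using 1
  funext p
  refine congrArg (WithLp.toLp 2) ?_
  funext i
  obtain ⟨j, rfl⟩ := finSumFinEquiv.surjective i
  simp only [Function.comp_apply, MeasurableEquiv.coe_piCongrLeft, Equiv.piCongrLeft_apply_apply]
  rcases j with j | j
  · simp [MeasurableEquiv.sumPiEquivProdPi, Equiv.sumPiEquivProdPi]
  · simp [MeasurableEquiv.sumPiEquivProdPi, Equiv.sumPiEquivProdPi]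

lemma measurePreserving_cons :
    MeasurePreserving (fun p : ℝ × (Fin m → ℝ) =>
      (WithLp.toLp 2 (Fin.cons p.1 p.2) : EuclideanSpace ℝ (Fin (m + 1)))) := by
  have h1 := (volume_preserving_piFinSuccAbove (fun _ : Fin (m + 1) => ℝ) 0).symm
  have h4 := PiLp.volume_preserving_toLp (Fin (m + 1))
  convert h4.comp h1 using 1
  funext p
  refine congrArg (WithLp.toLp 2) ?_
  simp [MeasurableEquiv.piFinSuccAbove]
  rfl

/-- The reference measure on the parameter space `S^k × S^m`. -/
def paramMeasure (k m : ℕ) : Measure (Params k m) :=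
  (volume : Measure (EuclideanSpace ℝ (Fin (k + 1)))).toSphere.prod
    (volume : Measure (EuclideanSpace ℝ (Fin (m + 1)))).toSphere

instance : IsFiniteMeasure (paramMeasure k m) := by unfold paramMeasure; infer_instance

instance : (paramMeasure k m).IsOpenPosMeasure := by unfold paramMeasure; infer_instance

/-- The density of surface measure on the level `s` in tube coordinates. -/
def jac (s : ℝ) (σ : Params k m) : ℝ := s ^ m * (1 + s * cosAngle σ) ^ k

lemma continuous_jac : Continuous fun p : ℝ × Params k m => jac p.1 p.2 := by
  have := continuous_cosAngle (k := k) (m := m)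
  unfold jac; fun_prop

lemma jac_pos {s : ℝ} (hs0 : 0 < s) (hs1 : s < 1) (σ : Params k m) : 0 < jac s σ :=
  mul_pos (pow_pos hs0 _) (pow_pos (one_add_mul_cosAngle_pos (by rwa [abs_of_pos hs0]) σ) _)

/-- The tube of radius one. -/
def unitTube (k m : ℕ) : Set (EuclideanSpace ℝ (Fin (k + 1 + m))) :=
  sqDist (k + 1 + m) k ⁻¹' Iio 1

lemma measurableSet_unitTube : MeasurableSet (unitTube k m) :=
  continuous_sqDist.measurable measurableSet_Iio

/-- Polar coordinates `y = ρω` in the first factor give the density `ρ^k`. The translation `ρ = 1 +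
r` moves the centre to `S^k`, and polar coordinates for `(r, z) ∈ ℝ^(m+1)` give `s^m` with `ρ = 1 +
s cos θ`. -/
theorem lintegral_unitTube {F : EuclideanSpace ℝ (Fin (k + 1 + m)) → ENNReal}
    (hF : Measurable F) :
    ∫⁻ x in unitTube k m, F x = ∫⁻ s in Ioo (0 : ℝ) 1, ∫⁻ σ,
      ENNReal.ofReal (jac s σ) * F (tubePoint s σ) ∂paramMeasure k m := by
  set F' := (unitTube k m).indicator F with hF'
  have mF' : Measurable F' := hF.indicator measurableSet_unitTube
  have mA : Measurable fun p : EuclideanSpace ℝ (Fin (k + 1)) × (Fin m → ℝ) => append p.1 p.2 :=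
    continuous_append.measurable
  have mFA : Measurable fun p : EuclideanSpace ℝ (Fin (k + 1)) × (Fin m → ℝ) =>
    F' (append p.1 p.2) := mF'.comp mA
  -- The first real variable is `ρ - 1`; the indicator keeps `ρ > 0` after the translation.
  let G : Metric.sphere (0 : EuclideanSpace ℝ (Fin (k + 1))) 1 → ℝ × (Fin m → ℝ) → ENNReal :=
    fun ω p => (Ioi (0 : ℝ)).indicator (fun ρ => ENNReal.ofReal (ρ ^ k) *
      F' (append (ρ • ω.1) p.2)) (1 + p.1)
  have mG : Measurable fun p : (Metric.sphere (0 : EuclideanSpace ℝ (Fin (k + 1))) 1) ×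
      (ℝ × (Fin m → ℝ)) => G p.1 p.2 := by
    have : (fun p : (Metric.sphere (0 : EuclideanSpace ℝ (Fin (k + 1))) 1) × (ℝ × (Fin m → ℝ)) =>
        G p.1 p.2) = {p | 0 < 1 + p.2.1}.indicator (fun p => ENNReal.ofReal ((1 + p.2.1) ^ k) *
          F' (append ((1 + p.2.1) • p.1.1) p.2.2)) := by
      funext p
      simp only [G, indicator, mem_Ioi, mem_ofPred_eq]
    rw [this]
    refine Measurable.indicator ?_ (measurableSet_lt (by fun_prop) (by fun_prop))
    refine Measurable.mul (by fun_prop) ?_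
    exact mFA.comp (f := fun p : (Metric.sphere (0 : EuclideanSpace ℝ (Fin (k + 1))) 1) ×
      (ℝ × (Fin m → ℝ)) => ((1 + p.2.1) • p.1.1, p.2.2)) (by fun_prop)
  have mG1 : ∀ ω, Measurable (G ω) := fun ω =>
    mG.comp (f := fun p => (ω, p)) measurable_prodMk_left
  have step1 : ∫⁻ x in unitTube k m, F x =
      ∫⁻ ω, ∫⁻ p, G ω p ∂volume ∂(volume : Measure (EuclideanSpace ℝ (Fin (k + 1)))).toSphere := by
    rw [← lintegral_indicator measurableSet_unitTube, ← hF',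
      ← measurePreserving_append.lintegral_comp mF', Measure.volume_eq_prod,
      lintegral_prod_symm _ mFA.aemeasurable]
    have : ∀ z : Fin m → ℝ, ∫⁻ y : EuclideanSpace ℝ (Fin (k + 1)), F' (append y z) =
        ∫⁻ ω, ∫⁻ r : ℝ, G ω (r, z) ∂volume
          ∂(volume : Measure (EuclideanSpace ℝ (Fin (k + 1)))).toSphere := by
      intro z
      have mz : Measurable fun y : EuclideanSpace ℝ (Fin (k + 1)) => F' (append y z) :=
        mFA.comp (f := fun y : EuclideanSpace ℝ (Fin (k + 1)) => (y, z)) (by fun_prop)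
      rw [lintegral_eq_lintegral_toSphere volume mz]
      refine lintegral_congr fun ω => ?_
      rw [← lintegral_indicator measurableSet_Ioi, finrank_euclideanSpace, Fintype.card_fin,
        Nat.add_sub_cancel]
      exact (lintegral_add_left_eq_self (fun r : ℝ => (Ioi (0 : ℝ)).indicator
        (fun ρ => ENNReal.ofReal (ρ ^ k) * F' (append (ρ • ω.1) z)) r) 1).symm
    simp_rw [this]
    rw [lintegral_lintegral_swap]
    · refine lintegral_congr fun ω => ?_
      rw [Measure.volume_eq_prod, lintegral_prod_symm _ (mG1 ω).aemeasurable]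
    · refine Measurable.aemeasurable ?_
      refine Measurable.lintegral_prod_right' (f := fun p : ((Fin m → ℝ) ×
        (Metric.sphere (0 : EuclideanSpace ℝ (Fin (k + 1))) 1)) × ℝ => G p.1.2 (p.2, p.1.1)) ?_
      exact mG.comp (f := fun p : ((Fin m → ℝ) ×
        (Metric.sphere (0 : EuclideanSpace ℝ (Fin (k + 1))) 1)) × ℝ => (p.1.2, (p.2, p.1.1)))
        (by fun_prop)
  have step2 : ∀ ω, ∫⁻ p, G ω p = ∫⁻ ξ, ∫⁻ s in Ioo (0 : ℝ) 1, ENNReal.ofReal (jac s (ω, ξ)) *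
      F (tubePoint s (ω, ξ)) ∂volume
        ∂(volume : Measure (EuclideanSpace ℝ (Fin (m + 1)))).toSphere := by
    intro ω
    let G' : EuclideanSpace ℝ (Fin (m + 1)) → ENNReal := fun w => G ω (w 0, fun i => w i.succ)
    have mG' : Measurable G' := (mG1 ω).comp
      (f := fun w : EuclideanSpace ℝ (Fin (m + 1)) => (w 0, fun i : Fin m => w i.succ)) (by fun_prop)
    have : ∫⁻ p, G ω p = ∫⁻ w, G' w := by
      rw [← measurePreserving_cons.lintegral_comp mG']
      simp [G']
    rw [this, lintegral_eq_lintegral_toSphere volume mG']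
    refine lintegral_congr fun ξ => ?_
    rw [← lintegral_indicator measurableSet_Ioi, ← lintegral_indicator measurableSet_Ioo]
    refine lintegral_congr fun s => ?_
    by_cases hs : s ∈ Ioo (0 : ℝ) 1
    · have hs1 : |s| < 1 := by rw [abs_of_pos hs.1]; exact hs.2
      have hp := one_add_mul_cosAngle_pos hs1 ((ω, ξ) : Params k m)
      have hp' : 0 < 1 + s * ξ.1 0 := hp
      rw [indicator_of_mem (show s ∈ Ioi (0 : ℝ) from hs.1), indicator_of_mem hs]
      have hmem : tubePoint s ((ω, ξ) : Params k m) ∈ unitTube k m := by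
        rw [unitTube, mem_preimage, sqDist_tubePoint hs1]
        exact (sq_lt_one_iff_abs_lt_one s).2 hs1
      have e1 : G' (s • ξ.1) = ENNReal.ofReal ((1 + s * ξ.1 0) ^ k) *
          F (tubePoint s (ω, ξ)) := by
        simp only [G', G, PiLp.smul_apply, smul_eq_mul]
        rw [indicator_of_mem (by exact hp'), ← indicator_of_mem hmem F, tubePoint_eq]
        rfl
      rw [e1, ← mul_assoc, ← ENNReal.ofReal_mul (pow_nonneg hs.1.le _)]
      simp [jac, cosAngle, finrank_euclideanSpace]
    · rw [indicator_of_notMem hs]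
      by_cases h0 : s ∈ Ioi (0 : ℝ)
      · rw [indicator_of_mem h0]
        have h1 : 1 ≤ s := by
          by_contra hc
          exact hs ⟨h0, not_le.1 hc⟩
        -- For `s ≥ 1` either `ρ ≤ 0` and the indicator vanishes, or the point has squared distance
        -- `s² ≥ 1` and lies outside the tube.
        have : G' (s • ξ.1) = 0 := by
          simp only [G', G, PiLp.smul_apply, smul_eq_mul]
          by_cases hp : 0 < 1 + s * ξ.1 0
          · rw [indicator_of_mem (by exact hp), hF', indicator_of_notMem, mul_zero]
            intro hc
            have hq : sqDist (k + 1 + m) k (append ((1 + s * ξ.1 0) • ω.1)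
                fun i : Fin m => s * ξ.1 i.succ) = s ^ 2 := by
              rw [sqDist_append, norm_smul, norm_fst ((ω, ξ) : Params k m), mul_one,
                Real.norm_eq_abs, abs_of_pos hp]
              have := cosAngle_sq_add ((ω, ξ) : Params k m)
              simp only [cosAngle] at this
              simp only [mul_pow, ← Finset.mul_sum]
              linear_combination s ^ 2 * this
            rw [unitTube, mem_preimage, hq] at hc
            nlinarith [show s ^ 2 < 1 from hc]
          · rw [indicator_of_notMem (by exact hp)]
        rw [this, mul_zero]
      · rw [indicator_of_notMem h0]
  rw [step1]
  simp_rw [step2]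
  have mI : Measurable fun p : ℝ × Params k m =>
      ENNReal.ofReal (jac p.1 p.2) * F (tubePoint p.1 p.2) :=
    (continuous_jac.measurable.ennreal_ofReal).mul (hF.comp continuous_tubePoint.measurable)
  have : ∀ s : ℝ, ∫⁻ σ, ENNReal.ofReal (jac s σ) * F (tubePoint s σ) ∂paramMeasure k m =
      ∫⁻ ω, ∫⁻ ξ, ENNReal.ofReal (jac s (ω, ξ)) * F (tubePoint s (ω, ξ))
        ∂(volume : Measure (EuclideanSpace ℝ (Fin (m + 1)))).toSphere
        ∂(volume : Measure (EuclideanSpace ℝ (Fin (k + 1)))).toSphere := fun s => by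
    have ms : Measurable fun σ : Params k m =>
        ENNReal.ofReal (jac s σ) * F (tubePoint s σ) := 
      mI.comp (f := fun σ : Params k m => (s, σ)) (by fun_prop)
    rw [paramMeasure, lintegral_prod _ ms.aemeasurable]
  simp_rw [this]
  have swap : ∀ ω, ∫⁻ ξ, ∫⁻ s in Ioo (0 : ℝ) 1, ENNReal.ofReal (jac s (ω, ξ)) *
      F (tubePoint s (ω, ξ)) ∂volume
        ∂(volume : Measure (EuclideanSpace ℝ (Fin (m + 1)))).toSphere =
      ∫⁻ s in Ioo (0 : ℝ) 1, ∫⁻ ξ, ENNReal.ofReal (jac s (ω, ξ)) *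
      F (tubePoint s (ω, ξ)) ∂(volume : Measure (EuclideanSpace ℝ (Fin (m + 1)))).toSphere := by
    intro ω
    refine lintegral_lintegral_swap (Measurable.aemeasurable ?_)
    exact mI.comp (f := fun p : (Metric.sphere (0 : EuclideanSpace ℝ (Fin (m + 1))) 1) × ℝ =>
      (p.2, ((ω, p.1) : Params k m))) (by fun_prop)
  simp_rw [swap]
  refine lintegral_lintegral_swap (Measurable.aemeasurable ?_)
  refine Measurable.lintegral_prod_right' (f := fun p :
    ((Metric.sphere (0 : EuclideanSpace ℝ (Fin (k + 1))) 1) × ℝ) ×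
    (Metric.sphere (0 : EuclideanSpace ℝ (Fin (m + 1))) 1) =>
    ENNReal.ofReal (jac p.1.2 ((p.1.1, p.2) : Params k m)) * F (tubePoint p.1.2 (p.1.1, p.2))) ?_
  exact mI.comp (f := fun p : ((Metric.sphere (0 : EuclideanSpace ℝ (Fin (k + 1))) 1) × ℝ) ×
    (Metric.sphere (0 : EuclideanSpace ℝ (Fin (m + 1))) 1) =>
    (p.1.2, ((p.1.1, p.2) : Params k m))) (by fun_prop)

end SphereTube
end

open Real Set MeasureTheory InnerProductSpace
noncomputable section

namespace SphereTube
open scoped NNReal ENNReal Topology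
open Filter

/-! ### Derivatives of the coordinate functions -/

section Derivatives

variable {n k : ℕ} {x : EuclideanSpace ℝ (Fin n)}

lemma hasStrictFDerivAt_axisDist (hx : 0 < axisDist n k x) :
    HasStrictFDerivAt (axisDist n k) ((axisDist n k x)⁻¹ • innerSL ℝ (corePart n k x)) x := by
  have hx' : ‖corePart n k x‖ ≠ 0 := hx.ne'
  have h1 := (hasStrictFDerivAt_norm_sq (corePart n k x)).comp x
    ((corePart n k).hasStrictFDerivAt (x := x))
  have h2 := h1.sqrt (pow_ne_zero 2 hx')
  simp only [Real.sqrt_sq (norm_nonneg _)] at h2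
  refine h2.congr_fderiv ?_
  ext1 v
  simp only [_root_.smul_apply, ContinuousLinearMap.comp_apply, innerSL_apply_apply,
    smul_eq_mul, inner_corePart_corePart, axisDist, nsmul_eq_mul]
  field_simp
  push_cast
  ring

lemma contDiffAt_axisDist {N : WithTop ℕ∞} (hx : 0 < axisDist n k x) :
    ContDiffAt ℝ N (axisDist n k) x :=
  (corePart n k).contDiff.contDiffAt.norm ℝ (norm_ne_zero_iff.1 hx.ne')

lemma contDiffAt_sqDist {N : WithTop ℕ∞} (hx : 0 < axisDist n k x) :
    ContDiffAt ℝ N (sqDist n k) x := by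
  have := contDiffAt_axisDist (N := N) hx
  have h2 : ContDiff ℝ N fun x : EuclideanSpace ℝ (Fin n) => ‖x‖ ^ 2 := contDiff_norm_sq ℝ
  have h3 := h2.contDiffAt (x := x)
  unfold sqDist
  exact (h3.sub (contDiffAt_const.mul this)).add contDiffAt_const

lemma contDiffAt_radialField {N : WithTop ℕ∞} (hx : 0 < axisDist n k x) :
    ContDiffAt ℝ N (radialField n k) x := by
  have := (contDiffAt_axisDist (N := N) hx).inv hx.ne'
  exact contDiffAt_id.sub (this.smul (corePart n k).contDiff.contDiffAt)

lemma hasStrictFDerivAt_sqDist (hx : 0 < axisDist n k x) :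
    HasStrictFDerivAt (sqDist n k) ((2 : ℝ) • innerSL ℝ (radialField n k x)) x := by
  have h1 := (hasStrictFDerivAt_axisDist hx).const_mul 2
  have h2 := hasStrictFDerivAt_norm_sq x
  refine ((h2.sub h1).add_const 1).congr_fderiv ?_
  ext v
  simp [radialField]
  ring

lemma hasStrictFDerivAt_radialField (hx : 0 < axisDist n k x) :
    HasStrictFDerivAt (radialField n k) (ContinuousLinearMap.id ℝ _ -
      ((axisDist n k x)⁻¹ • corePart n k -
        ((axisDist n k x ^ 3)⁻¹ • innerSL ℝ (corePart n k x)).smulRight (corePart n k x))) x := by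
  have h1 := (hasStrictDerivAt_inv hx.ne').comp_hasStrictFDerivAt x (hasStrictFDerivAt_axisDist hx)
  have h2 := h1.smul ((corePart n k).hasStrictFDerivAt (x := x))
  refine ((hasStrictFDerivAt_id x).sub h2).congr_fderiv ?_
  ext1 v
  simp only [_root_.sub_apply, _root_.smul_apply,
    _root_.add_apply, ContinuousLinearMap.smulRight_apply, innerSL_apply_apply]
  congr 1
  rw [sub_eq_add_neg, ← neg_smul]
  congr 2
  simp only [smul_eq_mul]
  field_simp

end Derivatives

/-! ### Hausdorff measure under maps close to isometries -/

lemma euclideanHausdorffMeasure_image_le {X Y : Type*} [EMetricSpace X] [MeasurableSpace X]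
    [BorelSpace X] [EMetricSpace Y] [MeasurableSpace Y] [BorelSpace Y] {f : X → Y} {s : Set X}
    {K : ℝ≥0} (hf : LipschitzOnWith K f s) (d : ℕ) :
    (μHE[d] : Measure Y) (f '' s) ≤ (K : ℝ≥0∞) ^ d * (μHE[d] : Measure X) s := by
  simp only [Measure.euclideanHausdorffMeasure_def, Measure.smul_apply, ENNReal.smul_def,
    smul_eq_mul]
  have := hf.hausdorffMeasure_image_le (d := d) (by positivity)
  rw [ENNReal.rpow_natCast] at this
  calc _ ≤ _ := mul_le_mul_right this _
    _ = _ := by ring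

/-- `G` changes distances on `W` at most by the factor `K`. -/
def NearIsometryOn {X : Type*} [PseudoMetricSpace X] (K : ℝ≥0) (G : X → X) (W : Set X) : Prop :=
  ∀ x ∈ W, ∀ y ∈ W, dist (G x) (G y) ≤ K * dist x y ∧ dist x y ≤ K * dist (G x) (G y)

lemma NearIsometryOn.image_le {X : Type*} [MetricSpace X] [MeasurableSpace X] [BorelSpace X]
    {K : ℝ≥0} {G : X → X} {W A : Set X} (h : NearIsometryOn K G W) (hA : A ⊆ W) (d : ℕ) :
    (μHE[d] : Measure X) (G '' A) ≤ (K : ℝ≥0∞) ^ d * (μHE[d] : Measure X) A :=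
  euclideanHausdorffMeasure_image_le
    (LipschitzOnWith.of_dist_le_mul fun x hx y hy => (h x (hA hx) y (hA hy)).1) d

lemma NearIsometryOn.injOn {X : Type*} [MetricSpace X] {K : ℝ≥0} {G : X → X} {W : Set X}
    (h : NearIsometryOn K G W) : InjOn G W := fun x hx y hy hxy => by
  have := (h x hx y hy).2
  rw [hxy, dist_self, mul_zero] at this
  exact dist_le_zero.1 this

lemma NearIsometryOn.le_image {X : Type*} [MetricSpace X] [MeasurableSpace X] [BorelSpace X]
    {K : ℝ≥0} {G : X → X} {W A : Set X} (h : NearIsometryOn K G W) (hA : A ⊆ W) (d : ℕ) :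
    (μHE[d] : Measure X) A ≤ (K : ℝ≥0∞) ^ d * (μHE[d] : Measure X) (G '' A) := by
  rcases A.eq_empty_or_nonempty with rfl | ⟨a, -⟩
  · simp
  have : Nonempty X := ⟨a⟩
  have hinj := h.injOn.mono hA
  have e : Function.invFunOn G A '' (G '' A) = A := hinj.invFunOn_image subset_rfl
  conv_lhs => rw [← e]
  refine euclideanHausdorffMeasure_image_le (LipschitzOnWith.of_dist_le_mul ?_) d
  rintro _ ⟨x, hx, rfl⟩ _ ⟨y, hy, rfl⟩
  rw [hinj.leftInvOn_invFunOn hx, hinj.leftInvOn_invFunOn hy]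
  exact (h x (hA hx) y (hA hy)).2

lemma exists_nearIsometryOn {E : Type*} [NormedAddCommGroup E] [NormedSpace ℝ E] {G : E → E} {p : E}
    (hG : HasStrictFDerivAt G (ContinuousLinearMap.id ℝ E) p) {K : ℝ≥0} (hK : 1 < K) :
    ∃ W, IsOpen W ∧ p ∈ W ∧ NearIsometryOn K G W := by
  have hK' : (1 : ℝ) < K := hK
  have hK0 : (0 : ℝ) < K := by linarith
  -- With `c = (K - 1)/K` both required bounds hold: `1 + c ≤ K` and `1/(1 - c) = K`.
  have hc : (0 : ℝ) < (K - 1) / K := div_pos (by linarith) hK0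
  have h1 := hG.isLittleO.def hc
  rw [nhds_prod_eq] at h1
  obtain ⟨W, ⟨hpW, hWo⟩, hW⟩ := (nhds_basis_opens p).prod_self.eventually_iff.1 h1
  refine ⟨W, hWo, hpW, fun x hx y hy => ?_⟩
  have h2 := hW (x := (x, y)) ⟨hx, hy⟩
  simp only [ContinuousLinearMap.id_apply] at h2
  simp only [dist_eq_norm]
  have t1 : ‖G x - G y‖ ≤ ‖G x - G y - (x - y)‖ + ‖x - y‖ := norm_le_norm_sub_add _ _
  have t2 : ‖x - y‖ ≤ ‖G x - G y - (x - y)‖ + ‖G x - G y‖ := by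
    rw [norm_sub_rev (G x - G y)]; exact norm_le_norm_sub_add _ _
  have e : (K - 1) / (K : ℝ) * ‖x - y‖ * K = (K - 1) * ‖x - y‖ := by field_simp
  have hn := norm_nonneg (x - y)
  have hc1 : (K - 1) / (K : ℝ) ≤ K - 1 := div_le_self (by linarith) hK'.le
  constructor
  · nlinarith
  · nlinarith

/-! ### A local comparison principle for measures -/

/-- Compactness reduces to finitely many open sets, and a measurable set is split into disjoint
pieces inside them. -/
lemma measure_le_of_locally_le {X : Type*} [TopologicalSpace X] [CompactSpace X]
    [MeasurableSpace X] [OpensMeasurableSpace X] {ν₁ ν₂ : Measure X}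
    (h : ∀ x, ∃ U, IsOpen U ∧ x ∈ U ∧ ∀ A ⊆ U, MeasurableSet A → ν₁ A ≤ ν₂ A) : ν₁ ≤ ν₂ := by
  have key : ∃ S' : Set X, (univ : Set X) ⊆ S' ∧ MeasurableSet S' ∧
      ∀ A ⊆ S', MeasurableSet A → ν₁ A ≤ ν₂ A := by
    refine isCompact_univ.induction_on (p := fun S => ∃ S' : Set X, S ⊆ S' ∧ MeasurableSet S' ∧
      ∀ A ⊆ S', MeasurableSet A → ν₁ A ≤ ν₂ A) ⟨∅, subset_rfl, .empty, ?_⟩ ?_ ?_ ?_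
    · intro A hA _
      rw [subset_empty_iff.1 hA]; simp
    · rintro s t hst ⟨S', h1, h2⟩
      exact ⟨S', hst.trans h1, h2⟩
    · rintro s t ⟨S, hsS, hS, h1⟩ ⟨T, htT, hT, h2⟩
      refine ⟨S ∪ T, union_subset_union hsS htT, hS.union hT, fun A hA mA => ?_⟩
      rw [← measure_inter_add_sdiff A hS (μ := ν₁), ← measure_inter_add_sdiff A hS (μ := ν₂)]
      refine add_le_add (h1 _ inter_subset_right (mA.inter hS)) (h2 _ ?_ (mA.diff hS))
      rintro x ⟨hx, hxS⟩
      exact (hA hx).resolve_left hxS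
    · intro x _
      obtain ⟨U, hU, hxU, h1⟩ := h x
      exact ⟨U, mem_nhdsWithin_of_mem_nhds (hU.mem_nhds hxU), U, subset_rfl, hU.measurableSet, h1⟩
  obtain ⟨S', h1, -, h2⟩ := key
  exact Measure.le_iff.2 fun A mA => h2 A ((subset_univ A).trans h1) mA

/-- Local comparison up to a factor close to one suffices: globalise for fixed `K`, then let `K`
decrease to `1`. -/
lemma measure_le_of_locally_le_mul {X : Type*} [TopologicalSpace X] [CompactSpace X]
    [MeasurableSpace X] [OpensMeasurableSpace X] {ν₁ ν₂ : Measure X} (N : ℕ)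
    (h : ∀ K : ℝ≥0, 1 < K → ∀ x, ∃ U, IsOpen U ∧ x ∈ U ∧
      ∀ A ⊆ U, MeasurableSet A → ν₁ A ≤ (K : ℝ≥0∞) ^ N * ν₂ A) : ν₁ ≤ ν₂ := by
  have h1 : ∀ K : ℝ≥0, 1 < K → ∀ A, ν₁ A ≤ (K : ℝ≥0∞) ^ N * ν₂ A := by
    intro K hK A
    have : ν₁ ≤ ((K : ℝ≥0∞) ^ N) • ν₂ := measure_le_of_locally_le (by simpa using h K hK)
    simpa using this A
  refine Measure.le_iff.2 fun A _ => ?_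
  have h2 : Tendsto (fun K : ℝ≥0 => (K : ℝ≥0∞) ^ N * ν₂ A) (𝓝[>] 1) (𝓝 (1 * ν₂ A)) := by
    refine ENNReal.Tendsto.mul_const ?_ (Or.inl one_ne_zero)
    have : Continuous fun K : ℝ≥0 => (K : ℝ≥0∞) ^ N :=
      (ENNReal.continuous_pow N).comp ENNReal.continuous_coe
    have := this.tendsto 1
    simp only [ENNReal.coe_one, one_pow] at this
    exact this.mono_left nhdsWithin_le_nhds
  rw [one_mul] at h2
  exact ge_of_tendsto h2 (by filter_upwards [self_mem_nhdsWithin] with K hK using h1 K hK A)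

end SphereTube
end

open Real Set MeasureTheory InnerProductSpace
noncomputable section

namespace SphereTube
open scoped NNReal ENNReal Topology
open Filter

/-! ### Surface measure of the level surfaces -/

/-- The volume of a prism with base `B` in the hyperplane orthogonal to `v`. -/
lemma volume_prism {V : Type*} [NormedAddCommGroup V] [InnerProductSpace ℝ V]
    [MeasurableSpace V] [BorelSpace V] [FiniteDimensional ℝ V] {v : V} (hv : ‖v‖ = 1)
    {B : Set V} (hB : ∀ b ∈ B, ⟪v, b⟫_ℝ = 0) {I : Set ℝ} (hI : MeasurableSet I)
    {T : Set V} (hT : T = {x | ∃ b ∈ B, ∃ s ∈ I, x = b + s • v}) (mT : MeasurableSet T) :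
    (volume : Measure V) T = volume I * (μHE[Module.finrank ℝ V - 1] : Measure V) B := by
  have hv0 : v ≠ 0 := by rintro rfl; simp at hv
  -- Cavalieri along `v`: the slice at height `y` is a translate of `B` if `y ∈ I` and empty
  -- otherwise.
  rw [← InnerProductSpace.euclideanHausdorffMeasure_eq_volume,
    EuclideanGeometry.euclideanHausdorffMeasure_eq_lintegral (0 : V) hv0 mT]
  have hvv : ⟪v, v⟫_ℝ = 1 := by rw [real_inner_self_eq_norm_sq, hv]; norm_num
  have hslice : ∀ y : ℝ, (μHE[Module.finrank ℝ V - 1] : Measure V)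
      (T ∩ AffineSubspace.mk' (y • v +ᵥ (0 : V)) (ℝ ∙ v)ᗮ) =
      I.indicator (fun _ => (μHE[Module.finrank ℝ V - 1] : Measure V) B) y := by
    intro y
    have hmem : ∀ b ∈ B, ∀ s : ℝ, (b + s • v ∈ (AffineSubspace.mk' (y • v +ᵥ (0 : V)) (ℝ ∙ v)ᗮ :
        Set V) ↔ s = y) := by
      intro b hb s
      rw [SetLike.mem_coe, AffineSubspace.mem_mk', Submodule.mem_orthogonal_singleton_iff_inner_right]
      simp only [vsub_eq_sub, vadd_eq_add, add_zero, inner_sub_right, inner_add_right,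
        inner_smul_right, hB b hb, hvv]
      constructor <;> intro h <;> linarith
    by_cases hy : y ∈ I
    · rw [indicator_of_mem hy,
        ← (IsometryEquiv.addRight (y • v)).isometry.euclideanHausdorffMeasure_image B]
      refine congrArg _ (Set.ext fun x => ?_)
      rw [hT]
      constructor
      · rintro ⟨⟨b, hb, s, hs, rfl⟩, hx⟩
        rw [hmem b hb] at hx
        subst hx
        exact ⟨b, hb, rfl⟩
      · rintro ⟨b, hb, rfl⟩
        exact ⟨⟨b, hb, y, hy, rfl⟩, (hmem b hb y).2 rfl⟩
    · rw [indicator_of_notMem hy]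
      convert measure_empty (μ := (μHE[Module.finrank ℝ V - 1] : Measure V))
      rw [eq_empty_iff_forall_notMem, hT]
      rintro x ⟨⟨b, hb, s, hs, rfl⟩, hx⟩
      rw [hmem b hb] at hx
      exact hy (hx ▸ hs)
  simp_rw [hslice]
  rw [lintegral_indicator hI, setLIntegral_const, mul_comm (volume I)]
  have : ‖v‖ₑ = 1 := by rw [← ofReal_norm, hv, ENNReal.ofReal_one]
  rw [this, one_mul]

variable {k m : ℕ}

lemma volume_image_tubePoint {t η : ℝ} (ht0 : 0 < t) (hη : t + η < 1) {A : Set (Params k m)}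
    (hA : MeasurableSet A) :
    MeasurableSet ((fun p : ℝ × Params k m => tubePoint p.1 p.2) '' (Ioo t (t + η) ×ˢ A)) ∧
    volume ((fun p : ℝ × Params k m => tubePoint p.1 p.2) '' (Ioo t (t + η) ×ˢ A)) =
      ∫⁻ s in Ioo t (t + η), ∫⁻ σ in A, ENNReal.ofReal (jac s σ) ∂paramMeasure k m := by
  have hI : Ioo t (t + η) ⊆ Ioo 0 1 := Ioo_subset_Ioo ht0.le hη.le
  have hinj := tubePoint_injOn (k := k) (m := m)
  set T := (fun p : ℝ × Params k m => tubePoint p.1 p.2) '' (Ioo t (t + η) ×ˢ A) with hT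
  have mT : MeasurableSet T := (measurableSet_Ioo.prod hA).image_of_continuousOn_injOn
    continuous_tubePoint.continuousOn (hinj.mono (prod_mono hI (subset_univ A)))
  refine ⟨mT, ?_⟩
  have hTsub : T ⊆ unitTube k m := by
    rintro _ ⟨⟨s, σ⟩, ⟨hs, -⟩, rfl⟩
    obtain ⟨h0, h1⟩ := hI hs
    rw [unitTube, mem_preimage, sqDist_tubePoint (by rwa [abs_of_pos h0])]
    exact (by nlinarith : s ^ 2 < 1)
  have e1 : volume T = ∫⁻ x in unitTube k m, T.indicator 1 x := by
    rw [lintegral_indicator_one mT, Measure.restrict_apply mT, inter_eq_left.2 hTsub]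
  rw [e1, lintegral_unitTube (measurable_one.indicator mT),
    ← lintegral_indicator measurableSet_Ioo, ← lintegral_indicator measurableSet_Ioo]
  refine lintegral_congr fun s => ?_
  by_cases hs : s ∈ Ioo (0 : ℝ) 1
  · rw [indicator_of_mem hs]
    have hiff : ∀ σ, tubePoint s σ ∈ T ↔ s ∈ Ioo t (t + η) ∧ σ ∈ A := fun σ => by
      constructor
      · rintro ⟨p, hp, hpe⟩
        have : p = (s, σ) := hinj ⟨hI hp.1, trivial⟩ ⟨hs, trivial⟩ hpe
        rw [this] at hp
        exact hp
      · intro h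
        exact ⟨(s, σ), h, rfl⟩
    by_cases hs' : s ∈ Ioo t (t + η)
    · rw [indicator_of_mem hs', ← lintegral_indicator hA]
      refine lintegral_congr fun σ => ?_
      by_cases hσ : σ ∈ A
      · rw [indicator_of_mem hσ, indicator_of_mem ((hiff σ).2 ⟨hs', hσ⟩)]; simp
      · rw [indicator_of_notMem hσ, indicator_of_notMem (fun h => hσ ((hiff σ).1 h).2)]; simp
    · rw [indicator_of_notMem hs']
      refine (lintegral_congr fun σ => ?_).trans lintegral_zero
      rw [indicator_of_notMem (fun h => hs' ((hiff σ).1 h).1), mul_zero]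
  · rw [indicator_of_notMem hs, indicator_of_notMem (fun h => hs (hI h))]

/-- The projection along normals to the level `t`. -/
def levelProj (n k : ℕ) (t : ℝ) (x : EuclideanSpace ℝ (Fin n)) : EuclideanSpace ℝ (Fin n) :=
  x - (1 - t / √(sqDist n k x)) • radialField n k x

/-- A map that takes level surfaces near a point with normal `v` to hyperplanes. -/
def straighten (n k : ℕ) (t : ℝ) (v x : EuclideanSpace ℝ (Fin n)) : EuclideanSpace ℝ (Fin n) :=
  (levelProj n k t x - ⟪v, levelProj n k t x⟫_ℝ • v) + √(sqDist n k x) • v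

lemma levelProj_tubePoint {s t : ℝ} (hs0 : 0 < s) (hs1 : s < 1) (σ : Params k m) :
    levelProj (k + 1 + m) k t (tubePoint s σ) = tubePoint t σ := by
  have hs : |s| < 1 := by rwa [abs_of_pos hs0]
  rw [levelProj, sqDist_tubePoint hs, radialField_tubePoint hs, Real.sqrt_sq hs0.le, smul_smul,
    tubePoint, tubePoint, sub_mul, div_mul_cancel₀ _ hs0.ne', one_mul, sub_smul]
  abel

lemma straighten_tubePoint {s t : ℝ} (hs0 : 0 < s) (hs1 : s < 1) (σ : Params k m)
    (v : EuclideanSpace ℝ (Fin (k + 1 + m))) :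
    straighten (k + 1 + m) k t v (tubePoint s σ) =
      (tubePoint t σ - ⟪v, tubePoint t σ⟫_ℝ • v) + s • v := by
  rw [straighten, levelProj_tubePoint hs0 hs1, sqDist_tubePoint (by rwa [abs_of_pos hs0]),
    Real.sqrt_sq hs0.le]

/-- The factor `1 - t/f` vanishes on the level `t`, so only its differential counts, and `levelProj`
has as derivative there the orthogonal projection onto the tangent space. Removing the `ν` component
changes nothing to first order, and adding `f ν` restores the normal direction since `∇f = ν` at the
base point. -/
lemma hasStrictFDerivAt_straighten {t : ℝ} (ht0 : 0 < t) (ht1 : t < 1) (σ : Params k m) :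
    HasStrictFDerivAt (straighten (k + 1 + m) k t (unitNormal σ))
      (ContinuousLinearMap.id ℝ _) (tubePoint t σ) := by
  have ht : |t| < 1 := by rwa [abs_of_pos ht0]
  set p := tubePoint t σ with hp
  have hq : sqDist (k + 1 + m) k p = t ^ 2 := sqDist_tubePoint ht σ
  have hρ : 0 < axisDist (k + 1 + m) k p := axisDist_pos (by rw [hq]; nlinarith)
  have hX : radialField (k + 1 + m) k p = t • unitNormal σ := radialField_tubePoint ht σ
  have hr : √(sqDist (k + 1 + m) k p) = t := by rw [hq, Real.sqrt_sq ht0.le]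
  have h1 := (hasStrictFDerivAt_sqDist hρ).sqrt (by rw [hq]; positivity)
  rw [hr, hX] at h1
  have hd : HasStrictDerivAt (fun r : ℝ => 1 - t / r) (t / t ^ 2) t := by
    have := ((hasStrictDerivAt_inv ht0.ne').const_mul t).const_sub 1
    simpa [div_eq_mul_inv] using this
  rw [← hr] at hd
  have h2 := hd.comp_hasStrictFDerivAt p h1
  rw [hr] at h2
  have h3 := (contDiffAt_radialField (N := 1) hρ).hasStrictFDerivAt one_ne_zero
  have h4 := (hasStrictFDerivAt_id p).sub (h2.smul h3)
  have h5 := ((innerSL ℝ (unitNormal σ)).hasStrictFDerivAt.comp p h4).smul_const (unitNormal σ)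
  refine ((h4.sub h5).add (h1.smul_const (unitNormal σ))).congr_fderiv ?_
  have hvv : ⟪unitNormal σ, unitNormal σ⟫_ℝ = 1 := by
    rw [real_inner_self_eq_norm_sq, norm_unitNormal]; norm_num
  ext1 v
  simp only [_root_.sub_apply, _root_.add_apply, _root_.smul_apply, ContinuousLinearMap.comp_apply,
    ContinuousLinearMap.id_apply, ContinuousLinearMap.smulRight_apply, innerSL_apply_apply,
    Function.comp_apply, hr, hX, div_self ht0.ne', sub_self, zero_smul, zero_add, smul_smul,
    inner_smul_left, inner_sub_right, inner_smul_right, hvv, smul_eq_mul]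
  have e : t / t ^ 2 * (1 / (2 * t) * 2) * ((starRingEnd ℝ) t * ⟪unitNormal σ, v⟫_ℝ) * t =
      ⟪unitNormal σ, v⟫_ℝ := by
    simp only [conj_trivial]
    field_simp
  have e2 : 1 / (2 * t) * 2 * ((starRingEnd ℝ) t * ⟪unitNormal σ, v⟫_ℝ) =
      ⟪unitNormal σ, v⟫_ℝ := by
    simp only [conj_trivial]
    field_simp
  rw [e, e2]
  simp


/-- The surface measure of the level `t` in tube coordinates. -/
def levelMeasure (k m : ℕ) (t : ℝ) : Measure (Params k m) :=
  (paramMeasure k m).withDensity fun σ => ENNReal.ofReal (jac t σ)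

lemma levelMeasure_apply (t : ℝ) {A : Set (Params k m)} (hA : MeasurableSet A) :
    levelMeasure k m t A = ∫⁻ σ in A, ENNReal.ofReal (jac t σ) ∂paramMeasure k m :=
  withDensity_apply _ hA

lemma exists_jac_comparison {t : ℝ} (ht0 : 0 < t) (ht1 : t < 1) (σ₀ : Params k m) {K : ℝ≥0}
    (hK : 1 < K) : ∀ᶠ p : ℝ × Params k m in 𝓝 (t, σ₀),
      jac p.1 p.2 ≤ K * jac t p.2 ∧ jac t p.2 ≤ K * jac p.1 p.2 := by
  have hK' : (1 : ℝ) < K := hK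
  have h0 := jac_pos ht0 ht1 σ₀
  have c1 : Continuous fun p : ℝ × Params k m => K * jac t p.2 :=
    continuous_const.mul (continuous_jac.comp (f := fun p : ℝ × Params k m => (t, p.2)) (by fun_prop))
  have c2 : Continuous fun p : ℝ × Params k m => jac t p.2 :=
    continuous_jac.comp (f := fun p : ℝ × Params k m => (t, p.2)) (by fun_prop)
  have c3 : Continuous fun p : ℝ × Params k m => K * jac p.1 p.2 :=
    continuous_const.mul continuous_jac
  have h1 : ∀ᶠ p : ℝ × Params k m in 𝓝 (t, σ₀), jac p.1 p.2 < K * jac t p.2 :=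
    (continuous_jac.tendsto _).eventually_lt (c1.tendsto _) (by simp only; nlinarith)
  have h2 : ∀ᶠ p : ℝ × Params k m in 𝓝 (t, σ₀), jac t p.2 < K * jac p.1 p.2 :=
    (c2.tendsto _).eventually_lt (c3.tendsto _) (by simp only; nlinarith)
  filter_upwards [h1, h2] with p hp1 hp2 using ⟨hp1.le, hp2.le⟩

/-- The volume of a thin slab over `A` links the two measures. In tube coordinates it is about the
thickness times `levelMeasure`; after `straighten` it is a prism whose base is a translate of the
image of the surface piece. The exponent adds `k + m` for the surface, `k + m + 1` for the volume
and `1` for the variation of `jac`. -/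
lemma levelMeasure_locally_comparable {t : ℝ} (ht0 : 0 < t) (ht1 : t < 1) {K : ℝ≥0} (hK : 1 < K)
    (σ₀ : Params k m) : ∃ U, IsOpen U ∧ σ₀ ∈ U ∧ ∀ A ⊆ U, MeasurableSet A →
      μHE[k + m] (tubePoint t '' A) ≤ (K : ℝ≥0∞) ^ (2 * (k + m + 1)) * levelMeasure k m t A ∧
      levelMeasure k m t A ≤ (K : ℝ≥0∞) ^ (2 * (k + m + 1)) * μHE[k + m] (tubePoint t '' A) := by
  obtain ⟨W, hWo, hpW, hG⟩ := exists_nearIsometryOn (hasStrictFDerivAt_straighten ht0 ht1 σ₀) hK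
  set v := unitNormal σ₀ with hv
  set G := straighten (k + 1 + m) k t v with hGdef
  have hev : ∀ᶠ p : ℝ × Params k m in 𝓝 (t, σ₀), (tubePoint p.1 p.2 ∈ W ∧
      (jac p.1 p.2 ≤ K * jac t p.2 ∧ jac t p.2 ≤ K * jac p.1 p.2)) ∧ p.1 < 1 :=
    ((continuous_tubePoint.tendsto (t, σ₀)).eventually (hWo.mem_nhds hpW)).and
      (exists_jac_comparison ht0 ht1 σ₀ hK) |>.and
      ((continuous_fst.tendsto (t, σ₀)).eventually (Iio_mem_nhds ht1))
  rw [nhds_prod_eq] at hev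
  obtain ⟨pa, ha, pb, hb, hab⟩ := eventually_prod_iff.1 hev
  obtain ⟨δ, hδ, hδa⟩ := Metric.eventually_nhds_iff.1 ha
  obtain ⟨U, hUb, hUo, hσU⟩ := mem_nhds_iff.1 hb
  set η := δ / 2 with hη
  have hη0 : 0 < η := by positivity
  have hs : ∀ s ∈ Icc t (t + η), pa s := fun s hs => hδa (by
    rw [Real.dist_eq, abs_of_nonneg (by linarith [hs.1])]; linarith [hs.2])
  have hη1 : t + η < 1 := (hab (hs _ ⟨by linarith, le_rfl⟩) (hUb hσU)).2
  refine ⟨U, hUo, hσU, fun A hA mA => ?_⟩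
  obtain ⟨mT, hT⟩ := volume_image_tubePoint ht0 hη1 mA
  set T := (fun p : ℝ × Params k m => tubePoint p.1 p.2) '' (Ioo t (t + η) ×ˢ A) with hTdef
  have hTW : T ⊆ W := by
    rintro _ ⟨⟨s, σ⟩, ⟨h1, h2⟩, rfl⟩
    exact (hab (hs s (Ioo_subset_Icc_self h1)) (hUb (hA h2))).1.1
  have hSW : tubePoint t '' A ⊆ W := by
    rintro _ ⟨σ, h2, rfl⟩
    exact (hab (hs t ⟨le_rfl, by linarith⟩) (hUb (hA h2))).1.1
  have hvn : ‖v‖ = 1 := norm_unitNormal σ₀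
  have hvv : ⟪v, v⟫_ℝ = 1 := by rw [real_inner_self_eq_norm_sq, hvn]; norm_num
  set B : Set (EuclideanSpace ℝ (Fin (k + 1 + m))) :=
    (fun σ => tubePoint t σ - ⟪v, tubePoint t σ⟫_ℝ • v) '' A with hBdef
  have hBv : ∀ b ∈ B, ⟪v, b⟫_ℝ = 0 := by
    rintro _ ⟨σ, -, rfl⟩
    simp only [inner_sub_right, inner_smul_right, hvv]; ring
  have hGT : G '' T = {x | ∃ b ∈ B, ∃ s ∈ Ioo t (t + η), x = b + s • v} := by
    ext x
    constructor
    · rintro ⟨_, ⟨⟨s, σ⟩, ⟨h1, h2⟩, rfl⟩, rfl⟩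
      exact ⟨_, ⟨σ, h2, rfl⟩, s, h1,
        straighten_tubePoint (ht0.trans h1.1) (h1.2.trans hη1) σ v⟩
    · rintro ⟨_, ⟨σ, h2, rfl⟩, s, h1, rfl⟩
      exact ⟨_, ⟨(s, σ), ⟨h1, h2⟩, rfl⟩,
        straighten_tubePoint (ht0.trans h1.1) (h1.2.trans hη1) σ v⟩
  have mGT : MeasurableSet (G '' T) := by
    refine mT.image_of_continuousOn_injOn ?_ (hG.injOn.mono hTW)
    exact (LipschitzOnWith.of_dist_le_mul fun x hx y hy => (hG x (hTW hx) y (hTW hy)).1).continuousOn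
  have hfin : Module.finrank ℝ (EuclideanSpace ℝ (Fin (k + 1 + m))) = k + m + 1 := by
    rw [finrank_euclideanSpace, Fintype.card_fin]; omega
  have hprism := volume_prism hvn hBv measurableSet_Ioo hGT mGT
  rw [hfin, Nat.add_sub_cancel, Real.volume_Ioo, add_sub_cancel_left] at hprism
  have hGS : μHE[k + m] (G '' (tubePoint t '' A)) = μHE[k + m] B := by
    rw [← (IsometryEquiv.addRight (t • v)).isometry.euclideanHausdorffMeasure_image B,
      hBdef, image_image, image_image]
    refine congrArg _ (image_congr fun σ _ => ?_)
    exact straighten_tubePoint ht0 ht1 σ v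
  have hvol : (volume : Measure (EuclideanSpace ℝ (Fin (k + 1 + m)))) = μHE[k + m + 1] := by
    rw [← hfin, InnerProductSpace.euclideanHausdorffMeasure_eq_volume]
  have v1 := hG.image_le hTW (k + m + 1)
  have v2 := hG.le_image hTW (k + m + 1)
  have s1 := hG.image_le hSW (k + m)
  have s2 := hG.le_image hSW (k + m)
  rw [← hvol, hprism] at v1 v2
  rw [hGS] at s1 s2
  have j : ∀ s ∈ Ioo t (t + η), (∫⁻ σ in A, ENNReal.ofReal (jac s σ) ∂paramMeasure k m ≤
        K * levelMeasure k m t A) ∧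
      (levelMeasure k m t A ≤ K * ∫⁻ σ in A, ENNReal.ofReal (jac s σ) ∂paramMeasure k m) := by
    intro s hsI
    rw [levelMeasure_apply t mA, ← lintegral_const_mul' _ _ ENNReal.coe_ne_top,
      ← lintegral_const_mul' _ _ ENNReal.coe_ne_top]
    constructor <;> refine setLIntegral_mono' mA fun σ hσ => ?_
    · have := (hab (hs s (Ioo_subset_Icc_self hsI)) (hUb (hA hσ))).1.2.1
      rw [← ENNReal.ofReal_coe_nnreal, ← ENNReal.ofReal_mul K.coe_nonneg]
      exact ENNReal.ofReal_le_ofReal this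
    · have := (hab (hs s (Ioo_subset_Icc_self hsI)) (hUb (hA hσ))).1.2.2
      rw [← ENNReal.ofReal_coe_nnreal, ← ENNReal.ofReal_mul K.coe_nonneg]
      exact ENNReal.ofReal_le_ofReal this
  have hvI : volume (Ioo t (t + η)) = ENNReal.ofReal η := by
    rw [Real.volume_Ioo, add_sub_cancel_left]
  have j1 : volume T ≤ ENNReal.ofReal η * (K * levelMeasure k m t A) := by
    rw [hT]
    refine (setLIntegral_mono' measurableSet_Ioo fun s hs => (j s hs).1).trans ?_
    rw [setLIntegral_const, hvI, mul_comm]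
  have j2 : ENNReal.ofReal η * levelMeasure k m t A ≤ K * volume T := by
    rw [hT, ← lintegral_const_mul' _ _ ENNReal.coe_ne_top]
    refine le_trans ?_ (setLIntegral_mono' measurableSet_Ioo fun s hs => (j s hs).2)
    rw [setLIntegral_const, hvI, mul_comm]
  have hη' : ENNReal.ofReal η ≠ 0 := by simpa using hη0
  have hη'' : ENNReal.ofReal η ≠ ∞ := ENNReal.ofReal_ne_top
  constructor
  · refine (ENNReal.mul_le_mul_iff_right hη' hη'').1 ?_
    calc ENNReal.ofReal η * μHE[k + m] (tubePoint t '' A)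
        ≤ ENNReal.ofReal η * ((K : ℝ≥0∞) ^ (k + m) * μHE[k + m] B) := by gcongr
      _ = (K : ℝ≥0∞) ^ (k + m) * (ENNReal.ofReal η * μHE[k + m] B) := by ring
      _ ≤ (K : ℝ≥0∞) ^ (k + m) * ((K : ℝ≥0∞) ^ (k + m + 1) *
          (ENNReal.ofReal η * (K * levelMeasure k m t A))) :=
            mul_le_mul_right (v1.trans (mul_le_mul_right j1 _)) _
      _ = _ := by ring
  · refine (ENNReal.mul_le_mul_iff_right hη' hη'').1 ?_
    calc ENNReal.ofReal η * levelMeasure k m t A ≤ K * volume T := j2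
      _ ≤ K * ((K : ℝ≥0∞) ^ (k + m + 1) * (ENNReal.ofReal η *
          ((K : ℝ≥0∞) ^ (k + m) * μHE[k + m] (tubePoint t '' A)))) :=
            mul_le_mul_right (v2.trans (mul_le_mul_right (mul_le_mul_right s1 _) _)) _
      _ = _ := by ring

lemma measurableEmbedding_tubePoint {t : ℝ} (ht0 : 0 < t) (ht1 : t < 1) :
    MeasurableEmbedding (tubePoint (k := k) (m := m) t) :=
  ((continuous_tubePoint_right t).isClosedEmbedding (tubePoint_injective ht0 ht1)).measurableEmbedding

theorem comap_tubePoint_eq {t : ℝ} (ht0 : 0 < t) (ht1 : t < 1) :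
    (μHE[k + m] : Measure (EuclideanSpace ℝ (Fin (k + 1 + m)))).comap (tubePoint t) =
      levelMeasure k m t := by
  have he := measurableEmbedding_tubePoint (k := k) (m := m) ht0 ht1
  refine le_antisymm ?_ ?_
  · refine measure_le_of_locally_le_mul (2 * (k + m + 1)) fun K hK σ₀ => ?_
    obtain ⟨U, hU, hσ, h⟩ := levelMeasure_locally_comparable ht0 ht1 hK σ₀
    exact ⟨U, hU, hσ, fun A hA mA => by rw [he.comap_apply]; exact (h A hA mA).1⟩
  · refine measure_le_of_locally_le_mul (2 * (k + m + 1)) fun K hK σ₀ => ?_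
    obtain ⟨U, hU, hσ, h⟩ := levelMeasure_locally_comparable ht0 ht1 hK σ₀
    exact ⟨U, hU, hσ, fun A hA mA => by rw [he.comap_apply]; exact (h A hA mA).2⟩

theorem map_tubePoint_eq {t : ℝ} (ht0 : 0 < t) (ht1 : t < 1) :
    (levelMeasure k m t).map (tubePoint t) =
      (μHE[k + m] : Measure (EuclideanSpace ℝ (Fin (k + 1 + m)))).restrict
        (levelSurface (k + 1 + m) k t) := by
  rw [← comap_tubePoint_eq ht0 ht1, (measurableEmbedding_tubePoint ht0 ht1).map_comap,
    range_tubePoint ht0 ht1]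

lemma continuous_jac_right (t : ℝ) : Continuous fun σ : Params k m => jac t σ :=
  continuous_jac.comp (f := fun σ : Params k m => (t, σ)) (by fun_prop)

theorem setIntegral_levelSurface {t : ℝ} (ht0 : 0 < t) (ht1 : t < 1)
    (F : EuclideanSpace ℝ (Fin (k + 1 + m)) → ℝ) :
    ∫ x in levelSurface (k + 1 + m) k t, F x ∂μHE[k + m] =
      ∫ σ, jac t σ * F (tubePoint t σ) ∂paramMeasure k m := by
  rw [← map_tubePoint_eq ht0 ht1, (measurableEmbedding_tubePoint ht0 ht1).integral_map, levelMeasure,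
    integral_withDensity_eq_integral_toReal_smul
      (continuous_jac_right t).measurable.ennreal_ofReal
      (by simp)]
  refine integral_congr_ae (Eventually.of_forall fun σ => ?_)
  simp [ENNReal.toReal_ofReal (jac_pos ht0 ht1 σ).le]

instance (t : ℝ) : IsFiniteMeasure (levelMeasure k m t) := by
  refine isFiniteMeasure_withDensity_ofReal (Integrable.hasFiniteIntegral ?_)
  exact (continuous_jac_right t).integrable_of_hasCompactSupport (HasCompactSupport.of_compactSpace _)

theorem integrableOn_levelSurface {t : ℝ} (ht0 : 0 < t) (ht1 : t < 1)
    {F : EuclideanSpace ℝ (Fin (k + 1 + m)) → ℝ}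
    (hF : Continuous fun σ : Params k m => F (tubePoint t σ)) :
    IntegrableOn F (levelSurface (k + 1 + m) k t) μHE[k + m] := by
  rw [IntegrableOn, ← map_tubePoint_eq ht0 ht1,
    (measurableEmbedding_tubePoint ht0 ht1).integrable_map_iff]
  exact hF.integrable_of_hasCompactSupport (HasCompactSupport.of_compactSpace _)

end SphereTube
end

open Real Set MeasureTheory InnerProductSpace
noncomputable section

namespace SphereTube
open scoped NNReal ENNReal Topology ContDiff
open Filter

/-! ### The divergence theorem in tubes -/

/-- The divergence of a vector field. -/
def divergence {V : Type*} [NormedAddCommGroup V] [NormedSpace ℝ V] (Y : V → V) (x : V) : ℝ :=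
  LinearMap.trace ℝ V (fderiv ℝ Y x : V →ₗ[ℝ] V)

lemma divergence_eq_sum {ι : Type*} [Fintype ι] (Y : EuclideanSpace ℝ ι → EuclideanSpace ℝ ι)
    (x : EuclideanSpace ℝ ι) :
    divergence Y x = ∑ i, fderiv ℝ Y x (EuclideanSpace.basisFun ι ℝ i) i := by
  classical
  rw [divergence, LinearMap.trace_eq_sum_inner _ (EuclideanSpace.basisFun ι ℝ)]
  refine Finset.sum_congr rfl fun i _ => ?_
  rw [EuclideanSpace.basisFun_apply, EuclideanSpace.inner_single_left]
  simp

lemma continuousOn_divergence {V : Type*} [NormedAddCommGroup V] [NormedSpace ℝ V]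
    [FiniteDimensional ℝ V] {Y : V → V} {U : Set V} (hU : IsOpen U) (hY : ContDiffOn ℝ 1 Y U) :
    ContinuousOn (divergence Y) U := by
  have h1 := hY.continuousOn_fderiv_of_isOpen hU le_rfl
  have h2 : Continuous fun L : V →L[ℝ] V => LinearMap.trace ℝ V (L : V →ₗ[ℝ] V) :=
    ((LinearMap.trace ℝ V).comp (ContinuousLinearMap.coeLM ℝ)).continuous_of_finiteDimensional
  exact h2.comp_continuousOn h1

/-- Each partial derivative is integrated by parts against the constant function `1`. -/
lemma integral_divergence_eq_zero {ι : Type*} [Fintype ι]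
    {Y : EuclideanSpace ℝ ι → EuclideanSpace ℝ ι} (hY : ContDiff ℝ 1 Y) (hc : HasCompactSupport Y) :
    ∫ x, divergence Y x = 0 := by
  simp_rw [divergence_eq_sum]
  have hcf : HasCompactSupport (fderiv ℝ Y) := hc.fderiv ℝ
  have hcont : Continuous (fderiv ℝ Y) := hY.continuous_fderiv one_ne_zero
  have key : ∀ i, Integrable (fun x => fderiv ℝ Y x (EuclideanSpace.basisFun ι ℝ i) i) ∧
      ∫ x, fderiv ℝ Y x (EuclideanSpace.basisFun ι ℝ i) i = 0 := by
    intro i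
    set f : EuclideanSpace ℝ ι → ℝ := fun x => Y x i with hf
    have hfd : ContDiff ℝ 1 f := (EuclideanSpace.proj (𝕜 := ℝ) i).contDiff.comp hY
    have hfc : HasCompactSupport f := hc.comp_left (g := fun v : EuclideanSpace ℝ ι => v i) rfl
    have e : ∀ x, fderiv ℝ f x (EuclideanSpace.basisFun ι ℝ i) =
        fderiv ℝ Y x (EuclideanSpace.basisFun ι ℝ i) i := fun x => by
      have h1 : HasFDerivAt f ((EuclideanSpace.proj (𝕜 := ℝ) i).comp (fderiv ℝ Y x)) x :=
        (EuclideanSpace.proj (𝕜 := ℝ) i).hasFDerivAt.comp x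
          ((hY.differentiable one_ne_zero) x).hasFDerivAt
      rw [h1.fderiv]; rfl
    have hint : Integrable (fun x => fderiv ℝ f x (EuclideanSpace.basisFun ι ℝ i)) :=
      ((hfd.continuous_fderiv one_ne_zero).clm_apply continuous_const).integrable_of_hasCompactSupport
        ((hfc.fderiv ℝ).comp_left (g := fun L : EuclideanSpace ℝ ι →L[ℝ] ℝ =>
          L (EuclideanSpace.basisFun ι ℝ i)) rfl)
    have h0 := integral_mul_fderiv_eq_neg_fderiv_mul_of_integrable (μ := volume)
      (f := fun _ : EuclideanSpace ℝ ι => (1 : ℝ)) (g := f)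
      (v := EuclideanSpace.basisFun ι ℝ i) (by simp) (by simpa using hint)
      (by simpa using hfd.continuous.integrable_of_hasCompactSupport hfc)
      (fun x _ => differentiableAt_const _) (fun x _ => hfd.differentiable one_ne_zero x)
    simp only [e] at hint h0
    exact ⟨hint, by simpa using h0⟩
  rw [integral_finsetSum _ fun i _ => (key i).1]
  exact Finset.sum_eq_zero fun i _ => (key i).2

variable {k m : ℕ}

/-! ### Volume integrals and continuity in tube coordinates -/

lemma map_tubePoint_volume : (((volume.restrict (Ioo (0 : ℝ) 1)).prod (paramMeasure k m)).withDensity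
      fun p => ENNReal.ofReal (jac p.1 p.2)).map (fun p => tubePoint p.1 p.2) =
    volume.restrict (unitTube k m) := by
  refine Measure.ext fun A hA => ?_
  have mI : Measurable fun x : EuclideanSpace ℝ (Fin (k + 1 + m)) => A.indicator
      (1 : EuclideanSpace ℝ (Fin (k + 1 + m)) → ℝ≥0∞) x :=
    measurable_one.indicator hA
  have mΘ : Measurable fun p : ℝ × Params k m => tubePoint p.1 p.2 := continuous_tubePoint.measurable
  rw [Measure.map_apply mΘ hA, withDensity_apply _ (mΘ hA), ← lintegral_indicator_one hA,
    lintegral_unitTube mI, ← lintegral_indicator (mΘ hA), lintegral_prod _ ?_]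
  · refine lintegral_congr fun s => lintegral_congr fun σ => ?_
    by_cases h : tubePoint s σ ∈ A
    · rw [indicator_of_mem (by exact h), indicator_of_mem h]; simp
    · rw [indicator_of_notMem (by exact h), indicator_of_notMem h]; simp
  · exact ((continuous_jac.measurable.ennreal_ofReal).indicator (mΘ hA)).aemeasurable

theorem integral_eq_integral_tubePoint {F : EuclideanSpace ℝ (Fin (k + 1 + m)) → ℝ}
    (hF : Integrable F) (h0 : ∀ x, x ∉ unitTube k m → F x = 0) :
    ∫ x, F x = ∫ s in Ioo (0 : ℝ) 1, ∫ σ, jac s σ * F (tubePoint s σ) ∂paramMeasure k m := by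
  have mΘ : Measurable fun p : ℝ × Params k m => tubePoint p.1 p.2 := continuous_tubePoint.measurable
  have e1 : ∫ x, F x = ∫ x in unitTube k m, F x :=
    (setIntegral_eq_integral_of_forall_compl_eq_zero h0).symm
  have hF' : Integrable F (volume.restrict (unitTube k m)) := hF.restrict
  have mj : Measurable fun p : ℝ × Params k m => ENNReal.ofReal (jac p.1 p.2) :=
    continuous_jac.measurable.ennreal_ofReal
  rw [← map_tubePoint_volume] at hF'
  have hi := hF'.comp_measurable mΘ
  rw [integrable_withDensity_iff_integrable_smul₀' mj.aemeasurable (by simp)] at hi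
  rw [e1, ← map_tubePoint_volume, integral_map mΘ.aemeasurable hF'.1,
    integral_withDensity_eq_integral_toReal_smul mj (by simp), integral_prod (fun p : ℝ × Params k m => (ENNReal.ofReal (jac p.1 p.2)).toReal •
      F (tubePoint p.1 p.2)) hi]
  refine setIntegral_congr_fun measurableSet_Ioo fun s hs => ?_
  refine integral_congr_ae (Eventually.of_forall fun σ => ?_)
  simp [ENNReal.toReal_ofReal (jac_pos hs.1 hs.2 σ).le]

/-- Provides compact supports for fields cut off by a function of `f²`. -/
lemma isCompact_sqDist_le (n k : ℕ) (B : ℝ) :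
    IsCompact {x : EuclideanSpace ℝ (Fin n) | sqDist n k x ≤ B} := by
  refine Metric.isCompact_of_isClosed_isBounded (isClosed_le continuous_sqDist continuous_const) ?_
  refine (Metric.isBounded_closedBall (x := (0 : EuclideanSpace ℝ (Fin n))) (r := B + 4)).subset ?_
  intro x (hx : sqDist n k x ≤ B)
  rw [mem_closedBall_zero_iff]
  have h1 := sub_one_sq_le_sqDist (k := k) x
  have h2 : ‖x‖ ^ 2 = sqDist n k x + 2 * axisDist n k x - 1 := by unfold sqDist; ring
  have h3 := axisDist_nonneg (k := k) x
  by_contra hc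
  push Not at hc
  nlinarith [sq_nonneg (axisDist n k x - 2), sqDist_nonneg (k := k) x]

/-- The tube `f < R`, in terms of the squared distance. -/
def openTube (n k : ℕ) (R : ℝ) : Set (EuclideanSpace ℝ (Fin n)) := {x | sqDist n k x < R ^ 2}

lemma isOpen_openTube (n k : ℕ) (R : ℝ) : IsOpen (openTube n k R) :=
  isOpen_lt continuous_sqDist continuous_const

lemma tubePoint_mem_openTube {R s : ℝ} (hR : R ≤ 1) (hs : s ∈ Ioo (-R) R) (σ : Params k m) :
    tubePoint s σ ∈ openTube (k + 1 + m) k R := by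
  have h1 : |s| < R := abs_lt.2 hs
  rw [openTube, mem_ofPred_eq, sqDist_tubePoint (h1.trans_le hR)]
  exact sq_lt_sq' (by linarith [hs.1]) hs.2

lemma axisDist_pos_of_mem_openTube {n k : ℕ} {R : ℝ} (hR0 : 0 < R) (hR : R ≤ 1)
    {x : EuclideanSpace ℝ (Fin n)}
    (hx : x ∈ openTube n k R) : 0 < axisDist n k x :=
  axisDist_pos (lt_of_lt_of_le (show sqDist n k x < R ^ 2 from hx) (by nlinarith))

lemma continuousOn_tube_integrand {R : ℝ} (hR : R ≤ 1) {f : EuclideanSpace ℝ (Fin (k + 1 + m)) → ℝ}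
    (hf : ContinuousOn f (openTube (k + 1 + m) k R)) :
    ContinuousOn (fun p : ℝ × Params k m => f (tubePoint p.1 p.2)) (Ioo (-R) R ×ˢ univ) :=
  hf.comp continuous_tubePoint.continuousOn fun p hp => tubePoint_mem_openTube hR hp.1 p.2

lemma continuousOn_param_integral {w : ℝ → Params k m → ℝ} {I : Set ℝ}
    (hw : ContinuousOn (fun p : ℝ × Params k m => w p.1 p.2) (I ×ˢ univ)) :
    ContinuousOn (fun s => ∫ σ, w s σ ∂paramMeasure k m) I :=
  continuousOn_integral_of_compact_support isCompact_univ hw (by simp)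

lemma integrable_param {w : ℝ → Params k m → ℝ} {I : Set ℝ}
    (hw : ContinuousOn (fun p : ℝ × Params k m => w p.1 p.2) (I ×ˢ univ)) {s : ℝ} (hs : s ∈ I) :
    Integrable (w s) (paramMeasure k m) := by
  have : Continuous (w s) := by
    rw [← continuousOn_univ]
    exact hw.comp (f := fun σ => (s, σ)) (by fun_prop) fun σ _ => ⟨hs, trivial⟩
  exact this.integrable_of_hasCompactSupport (HasCompactSupport.of_compactSpace _)

/-- The flux of `Y` through the level surface `s`. -/
def flux (Y : EuclideanSpace ℝ (Fin (k + 1 + m)) → EuclideanSpace ℝ (Fin (k + 1 + m))) (s : ℝ) : ℝ :=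
  ∫ σ : Params k m, jac s σ * ⟪Y (tubePoint s σ), unitNormal σ⟫_ℝ ∂paramMeasure k m

/-- The integral of the divergence of `Y` over the level surface `s`. -/
def levelDivergence (Y : EuclideanSpace ℝ (Fin (k + 1 + m)) → EuclideanSpace ℝ (Fin (k + 1 + m)))
    (s : ℝ) : ℝ :=
  ∫ σ : Params k m, jac s σ * divergence Y (tubePoint s σ) ∂paramMeasure k m

section

variable {Y : EuclideanSpace ℝ (Fin (k + 1 + m)) → EuclideanSpace ℝ (Fin (k + 1 + m))} {R : ℝ}

lemma continuousOn_flux_integrand (hR : R ≤ 1) (hY : ContinuousOn Y (openTube (k + 1 + m) k R)) :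
    ContinuousOn (fun p : ℝ × Params k m => jac p.1 p.2 *
      ⟪Y (tubePoint p.1 p.2), unitNormal p.2⟫_ℝ) (Ioo (-R) R ×ˢ univ) := by
  refine continuous_jac.continuousOn.mul (ContinuousOn.inner ?_
    (continuous_unitNormal.comp continuous_snd).continuousOn)
  exact hY.comp continuous_tubePoint.continuousOn fun p hp => tubePoint_mem_openTube hR hp.1 p.2

lemma continuousOn_flux (hR : R ≤ 1) (hY : ContinuousOn Y (openTube (k + 1 + m) k R)) :
    ContinuousOn (flux Y) (Ioo (-R) R) :=
  continuousOn_param_integral (continuousOn_flux_integrand hR hY)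

lemma continuousOn_levelDivergence_integrand (hR : R ≤ 1)
    (hY : ContDiffOn ℝ 1 Y (openTube (k + 1 + m) k R)) :
    ContinuousOn (fun p : ℝ × Params k m => jac p.1 p.2 * divergence Y (tubePoint p.1 p.2))
      (Ioo (-R) R ×ˢ univ) :=
  continuous_jac.continuousOn.mul
    (continuousOn_tube_integrand hR (continuousOn_divergence (isOpen_openTube _ _ _) hY))

lemma continuousOn_levelDivergence (hR : R ≤ 1)
    (hY : ContDiffOn ℝ 1 Y (openTube (k + 1 + m) k R)) :
    ContinuousOn (levelDivergence Y) (Ioo (-R) R) :=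
  continuousOn_param_integral (continuousOn_levelDivergence_integrand hR hY)

/-- This is `∫ div (χ(f²) Y) = 0` in tube coordinates, where `∇f² = 2X` and `X = sν` on the level
`s`. The cutoff depends on `f²` because `f` is not smooth on `S^k`. The cut-off field vanishes where
`f > b`, so it is `C¹` on the whole space although `Y` is only controlled in the tube. -/
lemma integral_cutoff (hR : R ≤ 1) (hY : ContDiffOn ℝ 1 Y (openTube (k + 1 + m) k R))
    {χ θ : ℝ → ℝ} (hχ : ∀ u, HasDerivAt χ (θ u) u) (hθ : Continuous θ) {b : ℝ} (hb0 : 0 < b)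
    (hbR : b < R) (hb : ∀ u, b ^ 2 ≤ u → χ u = 0) :
    ∫ s in (0 : ℝ)..b, (χ (s ^ 2) * levelDivergence Y s + 2 * s * θ (s ^ 2) * flux Y s) = 0 := by
  have hR0 : 0 < R := hb0.trans hbR
  set U := openTube (k + 1 + m) k R with hU
  have hUo : IsOpen U := isOpen_openTube _ _ _
  set q := sqDist (k + 1 + m) k with hq
  set Z : EuclideanSpace ℝ (Fin (k + 1 + m)) → EuclideanSpace ℝ (Fin (k + 1 + m)) :=
    fun x => χ (q x) • Y x with hZ
  have hχc : ContDiff ℝ 1 χ := by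
    rw [contDiff_one_iff_deriv]
    refine ⟨fun u => (hχ u).differentiableAt, ?_⟩
    rwa [show deriv χ = θ from funext fun u => (hχ u).deriv]
  have hout : ∀ x, b ^ 2 < q x → Z =ᶠ[𝓝 x] 0 := by
    intro x hx
    filter_upwards [(isOpen_lt continuous_const continuous_sqDist).mem_nhds hx] with y hy
    change χ (q y) • Y y = 0
    rw [hb _ (le_of_lt hy), zero_smul]
  have hbR2 : b ^ 2 < R ^ 2 := by nlinarith
  have hZc : ContDiff ℝ 1 Z := by
    rw [contDiff_iff_contDiffAt]
    intro x
    by_cases hx : x ∈ U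
    · have hρ := axisDist_pos_of_mem_openTube hR0 hR hx
      exact (hχc.contDiffAt.comp x (contDiffAt_sqDist hρ)).smul (hY.contDiffAt (hUo.mem_nhds hx))
    · have : b ^ 2 < q x := hbR2.trans_le (not_lt.1 hx)
      exact (contDiffAt_const (c := 0)).congr_of_eventuallyEq (hout x this)
  have hZs : HasCompactSupport Z := by
    refine HasCompactSupport.intro (isCompact_sqDist_le _ k (b ^ 2)) fun x hx => ?_
    simp only [hZ]
    rw [hb _ (le_of_lt (not_le.1 hx)), zero_smul]
  have hdivout : ∀ x, b ^ 2 < q x → divergence Z x = 0 := by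
    intro x hx
    rw [divergence, (hout x hx).fderiv_eq]
    simp
  have hdivin : ∀ x ∈ U, divergence Z x =
      χ (q x) * divergence Y x + 2 * θ (q x) * ⟪radialField (k + 1 + m) k x, Y x⟫_ℝ := by
    intro x hx
    have hρ := axisDist_pos_of_mem_openTube hR0 hR hx
    have h1 := (hχ (q x)).comp_hasFDerivAt x (hasStrictFDerivAt_sqDist hρ).hasFDerivAt
    have h2 := ((hY.contDiffAt (hUo.mem_nhds hx)).differentiableAt one_ne_zero).hasFDerivAt
    have h3 := h1.smul h2
    have h4 : fderiv ℝ Z x = _ := h3.fderiv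
    rw [divergence, h4]
    simp only [ContinuousLinearMap.toLinearMap_add, ContinuousLinearMap.toLinearMap_smul, map_add,
      map_smul, smul_eq_mul, Function.comp_apply, ContinuousLinearMap.coe_smulRight,
      LinearMap.trace_smulRight]
    simp only [divergence, ContinuousLinearMap.coe_coe, smul_eq_mul,
      innerSL_apply_apply, LinearMap.smul_apply]
    ring
  have hint : Integrable (divergence Z) := by
    refine Continuous.integrable_of_hasCompactSupport ?_ ?_
    · rw [← continuousOn_univ]
      exact continuousOn_divergence isOpen_univ hZc.contDiffOn
    · refine HasCompactSupport.intro (isCompact_sqDist_le _ k (b ^ 2)) fun x hx => ?_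
      exact hdivout x (not_le.1 hx)
  have h0 := integral_divergence_eq_zero hZc hZs
  rw [integral_eq_integral_tubePoint hint] at h0
  swap
  · intro x hx
    refine hdivout x ?_
    have : (1 : ℝ) ≤ q x := not_lt.1 hx
    nlinarith
  refine Eq.trans ?_ h0
  rw [intervalIntegral.integral_of_le hb0.le]
  have hsub : Ioc 0 b ⊆ Ioo (0 : ℝ) 1 := fun s hs => ⟨hs.1, hs.2.trans_lt (hbR.trans_le hR)⟩
  rw [setIntegral_eq_of_subset_of_forall_sdiff_eq_zero (f := fun s => ∫ σ : Params k m,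
    jac s σ * divergence Z (tubePoint s σ) ∂paramMeasure k m) measurableSet_Ioo hsub]
  · refine setIntegral_congr_fun measurableSet_Ioc fun s hs => ?_
    have hs' : s ∈ Ioo (-R) R := ⟨by linarith [hs.1], by linarith [hs.2]⟩
    have hs1 : |s| < 1 := abs_lt.2 ⟨by linarith [hs.1], by linarith [hs'.2]⟩
    have i1 := integrable_param (w := fun s (σ : Params k m) => jac s σ * divergence Y (tubePoint s σ))
      (continuousOn_levelDivergence_integrand hR hY) hs'
    have i2 := integrable_param (w := fun s (σ : Params k m) =>
      jac s σ * ⟪Y (tubePoint s σ), unitNormal σ⟫_ℝ) (continuousOn_flux_integrand hR hY.continuousOn) hs'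
    simp only [levelDivergence, flux]
    rw [← integral_const_mul, ← integral_const_mul, ← integral_add (i1.const_mul _) (i2.const_mul _)]
    refine integral_congr_ae (Eventually.of_forall fun σ => ?_)
    simp only
    rw [hdivin _ (tubePoint_mem_openTube hR hs' σ), hq, sqDist_tubePoint hs1,
      radialField_tubePoint hs1, inner_smul_left, real_inner_comm]
    simp only [conj_trivial]
    ring
  · rintro s ⟨hs, hsb⟩
    refine integral_eq_zero_of_ae (Eventually.of_forall fun σ => ?_)
    have hsb' : b < s := by
      by_contra hc
      exact hsb ⟨hs.1, not_lt.1 hc⟩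
    have : b ^ 2 < q (tubePoint s σ) := by
      rw [hq, sqDist_tubePoint (by rw [abs_of_pos hs.1]; exact hs.2)]; nlinarith
    simp [hdivout _ this]


/-- The cutoffs need not vanish near `S^k`, so no boundary term at `s = 0` has to be estimated. Let
`P` be the difference of the two sides as a function of the level. Integration by parts turns
`integral_cutoff` into `∫ 2sθ(s²)P(s) = 0`, and a bump `θ` near `T²` forces `P T = 0`. -/
theorem flux_eq_integral_levelDivergence (hR : R ≤ 1)
    (hY : ContDiffOn ℝ 1 Y (openTube (k + 1 + m) k R)) {T : ℝ} (hT0 : 0 < T) (hTR : T < R) :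
    flux Y T = ∫ s in (0 : ℝ)..T, levelDivergence Y s := by
  set d := levelDivergence Y with hd
  have dc : ContinuousOn d (Ioo (-R) R) := continuousOn_levelDivergence hR hY
  have fc := continuousOn_flux hR hY.continuousOn
  have hsub : ∀ {a b : ℝ}, a ∈ Ioo (-R) R → b ∈ Ioo (-R) R → uIcc a b ⊆ Ioo (-R) R :=
    fun ha hb => ordConnected_Ioo.uIcc_subset ha hb
  have h0 : (0 : ℝ) ∈ Ioo (-R) R := ⟨by linarith, by linarith⟩
  set G : ℝ → ℝ := fun s => ∫ r in (0 : ℝ)..s, d r with hG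
  have Gd : ∀ s ∈ Ioo (-R) R, HasDerivAt G (d s) s := fun s hs =>
    intervalIntegral.integral_hasDerivAt_right (dc.mono (hsub h0 hs)).intervalIntegrable
      (dc.stronglyMeasurableAtFilter isOpen_Ioo s hs) (dc.continuousAt (isOpen_Ioo.mem_nhds hs))
  have Gc : ContinuousOn G (Ioo (-R) R) := fun s hs => (Gd s hs).continuousAt.continuousWithinAt
  set P : ℝ → ℝ := fun s => flux Y s - G s with hP
  have Pc : ContinuousOn P (Ioo (-R) R) := fc.sub Gc
  have test : ∀ {χ θ : ℝ → ℝ}, (∀ u, HasDerivAt χ (θ u) u) → Continuous θ → ∀ {b : ℝ}, 0 < b →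
      b < R → (∀ u, b ^ 2 ≤ u → χ u = 0) → ∫ s in (0 : ℝ)..b, 2 * s * θ (s ^ 2) * P s = 0 := by
    intro χ θ hχ hθ b hb0 hbR hb
    have hI : uIcc 0 b ⊆ Ioo (-R) R := hsub h0 ⟨by linarith, hbR⟩
    have h1 := integral_cutoff hR hY hχ hθ hb0 hbR hb
    have hχ2 : ∀ s, HasDerivAt (fun s => χ (s ^ 2)) (2 * s * θ (s ^ 2)) s := fun s => by
      have h2 : HasDerivAt (fun s : ℝ => s ^ 2) (2 * s) s := by simpa using hasDerivAt_pow 2 s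
      exact ((hχ (s ^ 2)).comp s h2).congr_deriv (by ring)
    have cθ : Continuous fun s : ℝ => 2 * s * θ (s ^ 2) := by fun_prop
    have cχ : Continuous fun s : ℝ => χ (s ^ 2) :=
      continuous_iff_continuousAt.2 fun s => (hχ2 s).continuousAt
    have parts := intervalIntegral.integral_mul_deriv_eq_deriv_mul (fun s _ => hχ2 s)
      (fun s hs => Gd s (hI hs)) (cθ.intervalIntegrable 0 b) (dc.mono hI).intervalIntegrable
    have hG0 : G 0 = 0 := intervalIntegral.integral_same
    -- Both boundary terms vanish: at `b` because of the cutoff, at `0` because the primitive starts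
    -- there.
    rw [hb _ le_rfl, hG0] at parts
    have i1 : IntervalIntegrable (fun s => χ (s ^ 2) * d s) volume 0 b :=
      (cχ.continuousOn.mul (dc.mono hI)).intervalIntegrable
    have i2 : IntervalIntegrable (fun s => 2 * s * θ (s ^ 2) * flux Y s) volume 0 b :=
      (cθ.continuousOn.mul (fc.mono hI)).intervalIntegrable
    have i3 : IntervalIntegrable (fun s => 2 * s * θ (s ^ 2) * G s) volume 0 b :=
      (cθ.continuousOn.mul (Gc.mono hI)).intervalIntegrable
    rw [intervalIntegral.integral_add i1 i2] at h1
    simp only [hP, mul_sub]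
    rw [intervalIntegral.integral_sub i2 i3]
    linarith
  have hTm : T ∈ Ioo (-R) R := ⟨by linarith, hTR⟩
  suffices P T = 0 by simp only [hP, hG] at this; linarith
  by_contra hne
  have hpos : 0 < P T * P T := mul_self_pos.2 hne
  have hev : ∀ᶠ s in 𝓝 T, 0 < P T * P s ∧ s < R :=
    ((continuousAt_const.mul (Pc.continuousAt (isOpen_Ioo.mem_nhds hTm))).eventually
      (lt_mem_nhds hpos)).and (Iio_mem_nhds hTR)
  obtain ⟨δ, hδ, hδP⟩ := Metric.eventually_nhds_iff.1 hev
  have hr : 0 < T * δ / 2 := by positivity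
  -- Since `|s² - T²| ≥ T|s - T|` for `s ≥ 0`, the outer radius `Tδ/2` confines `s` to `|s - T| <
  -- δ/2`, where `P` keeps the sign of `P T`.
  let θ : ContDiffBump (T ^ 2 : ℝ) := ⟨T * δ / 4, T * δ / 2, by positivity, by linarith⟩
  have hθ0 : ∀ s : ℝ, 0 ≤ s → θ (s ^ 2) ≠ 0 → |s - T| < δ / 2 := by
    intro s hs h
    have h1 : s ^ 2 ∈ Metric.ball (T ^ 2) (T * δ / 2) := by
      have := (Function.mem_support (f := θ)).2 h
      rwa [θ.support_eq] at this
    rw [Metric.mem_ball, Real.dist_eq, show s ^ 2 - T ^ 2 = (s - T) * (s + T) by ring, abs_mul,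
      abs_of_nonneg (by linarith : 0 ≤ s + T)] at h1
    by_contra hc
    push Not at hc
    nlinarith [abs_nonneg (s - T)]
  set b := T + δ / 2 with hb
  have hbR : b < R := (hδP (y := b) (by
    rw [hb, Real.dist_eq, add_sub_cancel_left, abs_of_pos (by positivity)]; linarith)).2
  have hb0 : 0 < b := by positivity
  have hθout : ∀ u, b ^ 2 ≤ u → θ u = 0 := by
    intro u hu
    have hu0 : 0 ≤ u := (sq_nonneg b).trans hu
    by_contra hc
    have := hθ0 (√u) (Real.sqrt_nonneg u) (by rwa [Real.sq_sqrt hu0])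
    have h2 : b ≤ √u := Real.le_sqrt_of_sq_le hu
    have h3 := (abs_lt.1 this).2
    linarith
  -- The primitive is based at `b²`, so it vanishes to the right of `b²`; to the left of the bump it
  -- is a constant, not zero.
  have hχ : ∀ u, HasDerivAt (fun u => ∫ r in (b ^ 2)..u, θ r) (θ u) u := fun u =>
    intervalIntegral.integral_hasDerivAt_right (θ.continuous.intervalIntegrable _ _)
      (θ.continuous.stronglyMeasurableAtFilter _ _) θ.continuous.continuousAt
  have h1 := test hχ θ.continuous hb0 hbR fun u hu => by
    refine (intervalIntegral.integral_congr (g := fun _ => 0) fun r hr => ?_).trans (by simp)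
    rw [uIcc_of_le hu] at hr
    exact hθout r hr.1
  have h2 : 0 < ∫ s in (0 : ℝ)..b, P T * (2 * s * θ (s ^ 2) * P s) := by
    have hI : Icc 0 b ⊆ Ioo (-R) R := fun s hs => ⟨by linarith [hs.1], hs.2.trans_lt hbR⟩
    refine intervalIntegral.integral_pos hb0 ?_ (fun s hs => ?_) ⟨T, ⟨hT0.le, by linarith⟩, ?_⟩
    · have cθ : Continuous fun s : ℝ => 2 * s * θ (s ^ 2) := by
        have := θ.continuous; fun_prop
      exact continuousOn_const.mul (cθ.continuousOn.mul (Pc.mono hI))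
    · by_cases h : θ (s ^ 2) = 0
      · simp [h]
      · have h3 : 0 < P T * P s := (hδP (y := s) (by
          rw [Real.dist_eq]; linarith [hθ0 s hs.1.le h])).1
        have h4 : 0 ≤ 2 * s * θ (s ^ 2) := mul_nonneg (by linarith [hs.1]) θ.nonneg
        nlinarith
    · have h3 : θ (T ^ 2) = 1 := θ.one_of_mem_closedBall (Metric.mem_closedBall_self θ.rIn_pos.le)
      rw [h3]
      nlinarith
  rw [intervalIntegral.integral_const_mul, h1, mul_zero] at h2
  exact lt_irrefl _ h2

end

end SphereTube
end

open Real Set MeasureTheory InnerProductSpace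
noncomputable section

namespace SphereTube
open scoped NNReal ENNReal Topology ContDiff
open Filter

/-! ### Divergence identities -/

section Divergence

variable {E : Type*} [NormedAddCommGroup E] [InnerProductSpace ℝ E]

lemma _root_.HasFDerivAt.divergence {Y : E → E} {Y' : E →L[ℝ] E} {x : E} (h : HasFDerivAt Y Y' x) :
    divergence Y x = LinearMap.trace ℝ E (Y' : E →ₗ[ℝ] E) := by
  rw [SphereTube.divergence, h.fderiv]

lemma divergence_add {Y Z : E → E} {x : E} (hY : DifferentiableAt ℝ Y x)
    (hZ : DifferentiableAt ℝ Z x) :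
    divergence (fun y => Y y + Z y) x = divergence Y x + divergence Z x := by
  have h : HasFDerivAt (fun y => Y y + Z y) _ x := hY.hasFDerivAt.add hZ.hasFDerivAt
  rw [h.divergence, ContinuousLinearMap.toLinearMap_add, map_add, divergence, divergence]

lemma divergence_sub {Y Z : E → E} {x : E} (hY : DifferentiableAt ℝ Y x)
    (hZ : DifferentiableAt ℝ Z x) :
    divergence (fun y => Y y - Z y) x = divergence Y x - divergence Z x := by
  have h : HasFDerivAt (fun y => Y y - Z y) _ x := hY.hasFDerivAt.sub hZ.hasFDerivAt
  rw [h.divergence, ContinuousLinearMap.toLinearMap_sub, map_sub, divergence, divergence]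

variable [FiniteDimensional ℝ E]

lemma divergence_smul {a : E → ℝ} {Y : E → E} {a' : E →L[ℝ] ℝ} {x : E} (ha : HasFDerivAt a a' x)
    (hY : DifferentiableAt ℝ Y x) :
    divergence (fun y => a y • Y y) x = a x * divergence Y x + a' (Y x) := by
  have h : HasFDerivAt (fun y => a y • Y y) _ x := ha.smul hY.hasFDerivAt
  rw [h.divergence]
  simp only [ContinuousLinearMap.toLinearMap_add, ContinuousLinearMap.toLinearMap_smul, map_add,
    map_smul, smul_eq_mul, ContinuousLinearMap.coe_smulRight, LinearMap.trace_smulRight,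
    ContinuousLinearMap.coe_coe, divergence]

/-- The field `|V|² X - 2 ⟨X, V⟩ V + ψ h V - ½ h² W`, where `V = ∇h` and `W = ∇ψ`. -/
def rellichField (X V W : E → E) (h ψ : E → ℝ) (x : E) : E :=
  ‖V x‖ ^ 2 • X x - (2 * ⟪X x, V x⟫_ℝ) • V x + (ψ x * h x) • V x - (h x ^ 2 / 2) • W x

/-- The terms `2⟨V'X, V⟩` from the first summand and `-2⟨X, V'V⟩` from the second cancel by symmetry
of the Hessian. The mixed terms `h⟨W, V⟩` of the last two summands cancel as well, and `div V = 0`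
removes what remains of `V'`. -/
theorem divergence_rellichField {X V W : E → E} {h ψ : E → ℝ} {x : E} {X' V' : E →L[ℝ] E}
    (hX : HasFDerivAt X X' x) (hV : HasFDerivAt V V' x)
    (hh : HasFDerivAt h (innerSL ℝ (V x)) x) (hψ : HasFDerivAt ψ (innerSL ℝ (W x)) x)
    (hW : DifferentiableAt ℝ W x) (symm : ∀ v w, ⟪V' v, w⟫_ℝ = ⟪v, V' w⟫_ℝ)
    (trace : divergence V x = 0) :
    divergence (rellichField X V W h ψ) x = ‖V x‖ ^ 2 * divergence X x - 2 * ⟪X' (V x), V x⟫_ℝ +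
      ψ x * ‖V x‖ ^ 2 - h x ^ 2 / 2 * divergence W x := by
  have a1 : HasFDerivAt (fun y => ‖V y‖ ^ 2) _ x := hV.norm_sq
  have a2 : HasFDerivAt (fun y => 2 * ⟪X y, V y⟫_ℝ) _ x := (hX.inner ℝ hV).const_mul 2
  have a3 : HasFDerivAt (fun y => ψ y * h y) _ x := hψ.mul hh
  have a4 : HasFDerivAt (fun y => h y ^ 2 / 2) (h x • innerSL ℝ (V x)) x := by
    have := ((hh.pow 2).const_mul (1 / 2)).congr_fderiv (g' := h x • innerSL ℝ (V x)) (by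
      ext v
      simp
      ring)
    refine this.congr_of_eventuallyEq (Eventually.of_forall fun y => ?_)
    ring
  have dX := hX.differentiableAt
  have dV := hV.differentiableAt
  have d1 := a1.differentiableAt.smul dX
  have d2 := a2.differentiableAt.smul dV
  have d3 := a3.differentiableAt.smul dV
  have d4 := a4.differentiableAt.smul hW
  have e : divergence (rellichField X V W h ψ) x = _ :=
    divergence_sub (Y := fun y => ‖V y‖ ^ 2 • X y - (2 * ⟪X y, V y⟫_ℝ) • V y + (ψ y * h y) • V y)
      (Z := fun y => (h y ^ 2 / 2) • W y) ((d1.sub d2).add d3) d4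
  rw [e, divergence_add (Y := fun y => ‖V y‖ ^ 2 • X y - (2 * ⟪X y, V y⟫_ℝ) • V y)
      (Z := fun y => (ψ y * h y) • V y) (d1.sub d2) d3,
    divergence_sub (Y := fun y => ‖V y‖ ^ 2 • X y) (Z := fun y => (2 * ⟪X y, V y⟫_ℝ) • V y) d1 d2,
    divergence_smul a1 dX, divergence_smul a2 dV, divergence_smul a3 dV, divergence_smul a4 hW, trace]
  simp only [_root_.smul_apply, _root_.add_apply, ContinuousLinearMap.comp_apply,
    innerSL_apply_apply, smul_eq_mul, ContinuousLinearMap.prod_apply, fderivInnerCLM_apply,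
    real_inner_self_eq_norm_sq]
  have s := symm (V x) (X x)
  have s' := symm (X x) (V x)
  rw [real_inner_comm] at s
  have s2 : ⟪V x, V' (X x)⟫_ℝ = ⟪X x, V' (V x)⟫_ℝ := by rw [← s', real_inner_comm]
  rw [s2, real_inner_comm (V x) (W x)]
  simp only [nsmul_eq_mul]
  push_cast
  ring

end Divergence

section Gradient

variable {E : Type*} [NormedAddCommGroup E] [InnerProductSpace ℝ E] [FiniteDimensional ℝ E]
  {h : E → ℝ} {x : E}

/-! ### Gradient fields of harmonic functions -/

lemma innerSL_gradient (h : E → ℝ) (x : E) : innerSL ℝ (gradient h x) = fderiv ℝ h x := by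
  ext v
  rw [innerSL_apply_apply, gradient, toDual_symm_apply]

lemma hasFDerivAt_of_contDiffAt_two (hh : ContDiffAt ℝ 2 h x) :
    HasFDerivAt h (innerSL ℝ (gradient h x)) x := by
  rw [innerSL_gradient]
  exact (hh.differentiableAt two_ne_zero).hasFDerivAt

lemma contDiffAt_gradient (hh : ContDiffAt ℝ 2 h x) : ContDiffAt ℝ 1 (gradient h) x := by
  have h1 : ContDiffAt ℝ 1 (fderiv ℝ h) x := hh.fderiv_right (by norm_num)
  exact ((toDual ℝ E).symm.toContinuousLinearEquiv.contDiff.contDiffAt).comp x h1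

lemma inner_fderiv_gradient (hh : ContDiffAt ℝ 2 h x) (v w : E) :
    ⟪fderiv ℝ (gradient h) x v, w⟫_ℝ = fderiv ℝ (fderiv ℝ h) x v w := by
  have h1 : ContDiffAt ℝ 1 (fderiv ℝ h) x := hh.fderiv_right (by norm_num)
  have h2 : HasFDerivAt (gradient h) _ x :=
    ((toDual ℝ E).symm.toContinuousLinearEquiv.hasFDerivAt).comp x
      (h1.differentiableAt one_ne_zero).hasFDerivAt
  rw [h2.fderiv]
  exact toDual_symm_apply

lemma inner_fderiv_gradient_symm (hh : ContDiffAt ℝ 2 h x) (v w : E) :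
    ⟪fderiv ℝ (gradient h) x v, w⟫_ℝ = ⟪v, fderiv ℝ (gradient h) x w⟫_ℝ := by
  rw [real_inner_comm (fderiv ℝ (gradient h) x w), inner_fderiv_gradient hh,
    inner_fderiv_gradient hh]
  exact (hh.isSymmSndFDerivAt (by simp)).eq v w

lemma divergence_gradient (hh : HarmonicAt h x) : divergence (gradient h) x = 0 := by
  have h0 := hh.2.self_of_nhds
  rw [laplacian_eq_iteratedFDeriv_stdOrthonormalBasis] at h0
  rw [divergence, LinearMap.trace_eq_sum_inner _ (stdOrthonormalBasis ℝ E)]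
  refine Eq.trans ?_ h0
  refine Finset.sum_congr rfl fun i _ => ?_
  rw [real_inner_comm, iteratedFDeriv_two_apply]
  exact inner_fderiv_gradient hh.1 _ _

end Gradient

/-! ### The weight function -/

section Weight

variable {n k : ℕ} {x : EuclideanSpace ℝ (Fin n)}

lemma norm_radialField_sq (hx : 0 < axisDist n k x) : ‖radialField n k x‖ ^ 2 = sqDist n k x := by
  rw [radialField, norm_sub_sq_real, norm_smul, inner_smul_right, real_inner_comm,
    inner_corePart_self, norm_inv, Real.norm_eq_abs, abs_of_pos hx, sqDist]
  change _ - 2 * (_ * axisDist n k x ^ 2) + (_ * axisDist n k x) ^ 2 = _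
  field_simp

/-- The operator is the identity minus `1/ρ` times the projection onto the core directions
orthogonal to `corePart n k x`. That projection is nonnegative by Cauchy–Schwarz. -/
lemma inner_fderiv_radialField_le (hx : 0 < axisDist n k x) (v : EuclideanSpace ℝ (Fin n)) :
    ⟪(ContinuousLinearMap.id ℝ _ - ((axisDist n k x)⁻¹ • corePart n k -
        ((axisDist n k x ^ 3)⁻¹ • innerSL ℝ (corePart n k x)).smulRight (corePart n k x)) :
          EuclideanSpace ℝ (Fin n) →L[ℝ] _) v, v⟫_ℝ ≤ ‖v‖ ^ 2 := by
  simp only [_root_.sub_apply, ContinuousLinearMap.id_apply, _root_.smul_apply,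
    ContinuousLinearMap.smulRight_apply, innerSL_apply_apply, inner_sub_left, inner_smul_left,
    real_inner_self_eq_norm_sq, inner_corePart_self, conj_trivial, smul_eq_mul]
  have h := abs_real_inner_le_norm (corePart n k x) (corePart n k v)
  rw [inner_corePart_corePart] at h
  have h2 : ⟪corePart n k x, v⟫_ℝ ^ 2 ≤ (axisDist n k x * ‖corePart n k v‖) ^ 2 :=
    sq_le_sq' (by have := (abs_le.1 h).1; exact this) (abs_le.1 h).2
  have h3 : (axisDist n k x ^ 3)⁻¹ * ⟪corePart n k x, v⟫_ℝ * ⟪corePart n k x, v⟫_ℝ ≤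
      (axisDist n k x)⁻¹ * ‖corePart n k v‖ ^ 2 := by
    rw [mul_assoc, ← sq]
    calc _ ≤ (axisDist n k x ^ 3)⁻¹ * (axisDist n k x * ‖corePart n k v‖) ^ 2 := by gcongr
      _ = _ := by field_simp
  linarith

lemma trace_corePart (hkn : k < n) :
    LinearMap.trace ℝ _ (corePart n k : EuclideanSpace ℝ (Fin n) →ₗ[ℝ] _) = k + 1 := by
  classical
  rw [LinearMap.trace_eq_sum_inner _ (EuclideanSpace.basisFun (Fin n) ℝ)]
  have : ∀ i : Fin n, ⟪EuclideanSpace.basisFun (Fin n) ℝ i,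
      (corePart n k : EuclideanSpace ℝ (Fin n) →ₗ[ℝ] _) (EuclideanSpace.basisFun (Fin n) ℝ i)⟫_ℝ =
      if i.val < k + 1 then 1 else 0 := by
    intro i
    rw [EuclideanSpace.basisFun_apply, EuclideanSpace.inner_single_left, ContinuousLinearMap.coe_coe,
      corePart_apply]
    simp
  simp_rw [this]
  rw [Fin.sum_univ_eq_sum_range (fun i => if i < k + 1 then (1 : ℝ) else 0) n, Finset.sum_ite,
    Finset.sum_const_zero, add_zero, Finset.sum_const, nsmul_eq_mul, mul_one]
  have : Finset.filter (fun i => i < k + 1) (Finset.range n) = Finset.range (k + 1) := by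
    ext i; simp; omega
  rw [this]; simp

lemma divergence_corePart (hkn : k < n) : divergence (corePart n k) x = k + 1 := by
  rw [(corePart n k).hasFDerivAt.divergence, trace_corePart hkn]

/-- The projection subtracted from the identity has rank `k + 1 - 1 = k`, whence the trace `n -
k/ρ`. -/
lemma divergence_radialField (hkn : k < n) (hx : 0 < axisDist n k x) :
    divergence (radialField n k) x = n - k / axisDist n k x := by
  have hn : ‖corePart n k x‖ = axisDist n k x := rfl
  rw [(hasStrictFDerivAt_radialField hx).hasFDerivAt.divergence]
  simp only [ContinuousLinearMap.toLinearMap_sub, ContinuousLinearMap.toLinearMap_smul, map_sub,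
    map_smul, trace_corePart hkn, smul_eq_mul, ContinuousLinearMap.coe_smulRight,
    LinearMap.trace_smulRight, ContinuousLinearMap.coe_id, LinearMap.trace_id, finrank_euclideanSpace,
    Fintype.card_fin, ContinuousLinearMap.coe_coe, innerSL_apply_apply,
    real_inner_self_eq_norm_sq, LinearMap.smul_apply, hn]
  field_simp
  ring

/-- The weight `c + k / ρ - 2 κ / (1 - f²)`. -/
def weight (n k : ℕ) (c κ : ℝ) (x : EuclideanSpace ℝ (Fin n)) : ℝ :=
  c + k * (axisDist n k x)⁻¹ - 2 * κ * (1 - sqDist n k x)⁻¹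

/-- The gradient of the weight. -/
def weightGrad (n k : ℕ) (κ : ℝ) (x : EuclideanSpace ℝ (Fin n)) : EuclideanSpace ℝ (Fin n) :=
  (-(k * (axisDist n k x ^ 3)⁻¹)) • corePart n k x -
    (4 * κ * ((1 - sqDist n k x) ^ 2)⁻¹) • radialField n k x

variable {c κ : ℝ}

lemma hasFDerivAt_weight (hx : 0 < axisDist n k x) (hq : sqDist n k x < 1) :
    HasFDerivAt (weight n k c κ) (innerSL ℝ (weightGrad n k κ x)) x := by
  have hq' : 1 - sqDist n k x ≠ 0 := by linarith
  have h1 := (hasDerivAt_inv hx.ne').comp_hasFDerivAt x (hasStrictFDerivAt_axisDist hx).hasFDerivAt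
  have h2 := (hasDerivAt_inv hq').comp_hasFDerivAt x
    ((hasStrictFDerivAt_sqDist hx).hasFDerivAt.const_sub 1)
  have h3 : HasFDerivAt (weight n k c κ) _ x :=
    ((h1.const_mul (k : ℝ)).const_add c).sub (h2.const_mul (2 * κ))
  refine h3.congr_fderiv ?_
  ext v
  simp only [_root_.sub_apply, _root_.smul_apply, _root_.neg_apply, innerSL_apply_apply, smul_eq_mul,
    weightGrad, inner_sub_left, inner_smul_left, conj_trivial]
  field_simp
  ring

lemma contDiffAt_weight {N : WithTop ℕ∞} (hx : 0 < axisDist n k x) (hq : sqDist n k x < 1) :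
    ContDiffAt ℝ N (weight n k c κ) x := by
  have hq' : 1 - sqDist n k x ≠ 0 := by linarith
  have h1 := (contDiffAt_axisDist (N := N) hx).inv hx.ne'
  have h2 := (contDiffAt_const.sub (contDiffAt_sqDist (N := N) hx)).inv hq'
  exact (contDiffAt_const.add (contDiffAt_const.mul h1)).sub (contDiffAt_const.mul h2)

lemma contDiffAt_weightGrad {N : WithTop ℕ∞} (hx : 0 < axisDist n k x) (hq : sqDist n k x < 1) :
    ContDiffAt ℝ N (weightGrad n k κ) x := by
  have hq' : (1 - sqDist n k x) ^ 2 ≠ 0 := pow_ne_zero 2 (by linarith)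
  have h1 := ((contDiffAt_axisDist (N := N) hx).pow 3).inv (pow_ne_zero 3 hx.ne')
  have h2 := ((contDiffAt_const.sub (contDiffAt_sqDist (N := N) hx)).pow 2).inv hq'
  exact ((contDiffAt_const.mul h1).neg.smul (corePart n k).contDiff.contDiffAt).sub
    ((contDiffAt_const.mul h2).smul (contDiffAt_radialField hx))

/-- This is the Laplacian of the weight: `1/ρ` is a radial function on `ℝ^(k+1)` with Laplacian `-(k
- 2)/ρ³`, and the rest is the chain rule for a function of `f²` with `|X|² = f²`. -/
lemma divergence_weightGrad (hkn : k < n) (hx : 0 < axisDist n k x) (hq : sqDist n k x < 1) :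
    divergence (weightGrad n k κ) x = -(k * (k - 2) / axisDist n k x ^ 3) -
      κ * (4 * (n - k / axisDist n k x) / (1 - sqDist n k x) ^ 2 +
        16 * sqDist n k x / (1 - sqDist n k x) ^ 3) := by
  have hq' : 1 - sqDist n k x ≠ 0 := by linarith
  have i3 : HasDerivAt (fun r : ℝ => -(k * (r ^ 3)⁻¹)) (3 * k / (axisDist n k x) ^ 4)
      (axisDist n k x) := by
    have := (((hasDerivAt_pow 3 (axisDist n k x)).inv (pow_ne_zero 3 hx.ne')).const_mul (k : ℝ)).neg
    refine this.congr_deriv ?_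
    field_simp
    norm_num
    ring
  have i2 : HasDerivAt (fun r : ℝ => 4 * κ * ((1 - r) ^ 2)⁻¹) (8 * κ / (1 - sqDist n k x) ^ 3)
      (sqDist n k x) := by
    have := ((((hasDerivAt_id (sqDist n k x)).const_sub 1).pow 2).inv
      (pow_ne_zero 2 hq')).const_mul (4 * κ)
    refine this.congr_deriv ?_
    simp only [id]
    field_simp
    norm_num
    ring
  have a1 := i3.comp_hasFDerivAt x (hasStrictFDerivAt_axisDist hx).hasFDerivAt
  have a2 := i2.comp_hasFDerivAt x (hasStrictFDerivAt_sqDist hx).hasFDerivAt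
  have dP : DifferentiableAt ℝ (corePart n k) x := (corePart n k).differentiableAt
  have dX : DifferentiableAt ℝ (radialField n k) x :=
    (contDiffAt_radialField (N := 1) hx).differentiableAt one_ne_zero
  have e : divergence (weightGrad n k κ) x = _ := divergence_sub
    (a1.differentiableAt.smul dP) (a2.differentiableAt.smul dX)
  have b1 := divergence_smul a1 dP
  have b2 := divergence_smul a2 dX
  have hn : ‖corePart n k x‖ = axisDist n k x := rfl
  simp only [Function.comp_apply] at e b1 b2
  rw [e, b1, b2, divergence_corePart hkn, divergence_radialField hkn hx]
  simp only [_root_.smul_apply, innerSL_apply_apply, real_inner_self_eq_norm_sq, smul_eq_mul, hn,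
    norm_radialField_sq hx]
  field_simp
  ring

end Weight

end SphereTube
end

open Real Set MeasureTheory InnerProductSpace
noncomputable section

namespace SphereTube
open scoped NNReal ENNReal Topology ContDiff
open Filter

/-! ### Positivity of the divergence -/

/-- The coefficient of the correction term, which is needed for circles only. -/
def corrCoeff (k : ℕ) : ℝ := if k = 1 then 1 else 0

lemma corrCoeff_nonneg (k : ℕ) : 0 ≤ corrCoeff k := by
  unfold corrCoeff; split_ifs <;> norm_num

/-- Here `u` stands for `1 - f²`, and the last hypothesis is `f² ≥ (ρ - 1)²`. The worst case is `u =
ρ(2 - ρ)`, where right minus left equals `2ρ⁵ + ρ⁶`. -/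
lemma weight_polynomial_nonneg {ρ u : ℝ} (hρ : 0 < ρ) (hu : 0 < u) (h : u ≤ 2 * ρ - ρ ^ 2) :
    u ^ 3 ≤ 16 * ρ ^ 3 - 8 * u * ρ ^ 3 - 4 * u * ρ ^ 2 := by
  have hρ2 : 0 < 2 - ρ := by nlinarith
  have h1 : u ^ 3 ≤ (ρ * (2 - ρ)) ^ 3 := pow_le_pow_left₀ hu.le (by linarith) 3
  have h2 : u * (8 * ρ ^ 3 + 4 * ρ ^ 2) ≤ (2 * ρ - ρ ^ 2) * (8 * ρ ^ 3 + 4 * ρ ^ 2) :=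
    mul_le_mul_of_nonneg_right h (by positivity)
  have h3 : 0 < ρ ^ 5 := by positivity
  have h4 : 0 < ρ ^ 6 := by positivity
  nlinarith

/-- Superharmonicity of the weight. The sign of `-k(k - 2)` is right except for `k = 1`, the only
case in which the correction is switched on. -/
lemma divergence_weightGrad_nonpos {n k : ℕ} (hkn : k < n) {x : EuclideanSpace ℝ (Fin n)}
    (hq : sqDist n k x < 1) : divergence (weightGrad n k (corrCoeff k)) x ≤ 0 := by
  have hρ := axisDist_pos hq
  rw [divergence_weightGrad hkn hρ hq]
  by_cases hk : k = 1
  · subst hk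
    have hn : (2 : ℝ) ≤ n := by exact_mod_cast hkn
    have hs := sub_one_sq_le_sqDist (k := 1) x
    set ρ := axisDist n 1 x
    set q := sqDist n 1 x
    have hu : 0 < 1 - q := by linarith
    have hp := weight_polynomial_nonneg hρ hu (by nlinarith)
    -- The dimension enters only here, and `k < n` makes `n = 2` the worst case.
    have e1 : 4 * (2 - 1 / ρ) / (1 - q) ^ 2 ≤ 4 * (n - 1 / ρ) / (1 - q) ^ 2 := by gcongr
    have e2 : 1 / ρ ^ 3 ≤ 4 * (2 - 1 / ρ) / (1 - q) ^ 2 + 16 * q / (1 - q) ^ 3 := by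
      rw [show 4 * (2 - 1 / ρ) / (1 - q) ^ 2 + 16 * q / (1 - q) ^ 3 =
        (16 * ρ ^ 3 - 8 * (1 - q) * ρ ^ 3 - 4 * (1 - q) * ρ ^ 2) / (ρ ^ 3 * (1 - q) ^ 3) by
          field_simp; ring, div_le_div_iff₀ (by positivity) (by positivity)]
      nlinarith [pow_pos hρ 3]
    simp only [corrCoeff, if_true, Nat.cast_one]
    have e3 : (1 : ℝ) * (1 - 2) / ρ ^ 3 = -(1 / ρ ^ 3) := by ring
    rw [e3]
    linarith
  · simp only [corrCoeff, if_neg hk, zero_mul, sub_zero]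
    rw [neg_nonpos]
    refine div_nonneg ?_ (by positivity)
    rcases Nat.lt_or_ge k 2 with h | h
    · have : k = 0 := by omega
      simp [this]
    · have : (2 : ℝ) ≤ k := by exact_mod_cast h
      nlinarith

variable {k m : ℕ} {h : EuclideanSpace ℝ (Fin (k + 1 + m)) → ℝ} {R : ℝ}

/-- The Rellich field of `h` for the level `T`. -/
def energyField (k m : ℕ) (h : EuclideanSpace ℝ (Fin (k + 1 + m)) → ℝ) (C T : ℝ) :
    EuclideanSpace ℝ (Fin (k + 1 + m)) → EuclideanSpace ℝ (Fin (k + 1 + m)) :=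
  rellichField (radialField (k + 1 + m) k) (gradient h) (weightGrad (k + 1 + m) k (corrCoeff k)) h
    (weight (k + 1 + m) k (C - (k + m) + 2 * corrCoeff k * (1 - T ^ 2)⁻¹) (corrCoeff k))

lemma sqDist_lt_one_of_mem_openTube {n k : ℕ} {R : ℝ} (hR0 : 0 < R) (hR : R ≤ 1)
    {x : EuclideanSpace ℝ (Fin n)} (hx : x ∈ openTube n k R) : sqDist n k x < 1 :=
  lt_of_lt_of_le (show sqDist n k x < R ^ 2 from hx) (by nlinarith)

lemma contDiffOn_energyField (hR0 : 0 < R) (hR : R ≤ 1)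
    (hh : HarmonicOnNhd h (openTube (k + 1 + m) k R)) (C T : ℝ) :
    ContDiffOn ℝ 1 (energyField k m h C T) (openTube (k + 1 + m) k R) := by
  intro x hx
  have hρ := axisDist_pos_of_mem_openTube hR0 hR hx
  have hq := sqDist_lt_one_of_mem_openTube hR0 hR hx
  have h1 : ContDiffAt ℝ 1 h x := (hh x hx).1.of_le one_le_two
  have hV := contDiffAt_gradient (hh x hx).1
  have hX := contDiffAt_radialField (N := 1) hρ
  have hψ := contDiffAt_weight (N := 1) (c := C - (k + m) + 2 * corrCoeff k * (1 - T ^ 2)⁻¹)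
    (κ := corrCoeff k) hρ hq
  have hW := contDiffAt_weightGrad (N := 1) (κ := corrCoeff k) hρ hq
  refine ContDiffAt.contDiffWithinAt ?_
  refine ((((hV.norm_sq ℝ).smul hX).sub ((contDiffAt_const.mul (hX.inner ℝ hV)).smul hV)).add
    ((hψ.mul h1).smul hV)).sub (((h1.pow 2).div_const 2).smul hW)

/-- The terms `∓ k/ρ` of `div X` and of the weight cancel, so with `⟨X'V, V⟩ ≤ |V|²` the coefficient
of `|∇h|²` is at least `C - 1` plus the correction. The correction is normalised to vanish on the
level `T` and is nonnegative inside it. The `h²` term has the right sign by superharmonicity. -/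
lemma divergence_energyField_nonneg (hR0 : 0 < R) (hR : R ≤ 1)
    (hh : HarmonicOnNhd h (openTube (k + 1 + m) k R)) {C T : ℝ} (hC : 1 ≤ C) (hT0 : 0 < T)
    (hTR : T < R) {x : EuclideanSpace ℝ (Fin (k + 1 + m))}
    (hx : sqDist (k + 1 + m) k x ≤ T ^ 2) : 0 ≤ divergence (energyField k m h C T) x := by
  have hxU : x ∈ openTube (k + 1 + m) k R :=
    lt_of_le_of_lt hx (by nlinarith : T ^ 2 < R ^ 2)
  have hρ := axisDist_pos_of_mem_openTube hR0 hR hxU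
  have hq := sqDist_lt_one_of_mem_openTube hR0 hR hxU
  have hkn : k < k + 1 + m := by omega
  have hhx := hh x hxU
  rw [energyField, divergence_rellichField (hasStrictFDerivAt_radialField hρ).hasFDerivAt
    ((contDiffAt_gradient hhx.1).differentiableAt one_ne_zero).hasFDerivAt
    (hasFDerivAt_of_contDiffAt_two hhx.1) (hasFDerivAt_weight hρ hq)
    ((contDiffAt_weightGrad (N := 1) hρ hq).differentiableAt one_ne_zero)
    (inner_fderiv_gradient_symm hhx.1) (divergence_gradient hhx), divergence_radialField hkn hρ,
    weight]
  have h1 := inner_fderiv_radialField_le hρ (gradient h x)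
  have h2 := divergence_weightGrad_nonpos hkn hq
  have h3 : (1 - sqDist (k + 1 + m) k x)⁻¹ ≤ (1 - T ^ 2)⁻¹ := by
    gcongr
    nlinarith
  have h4 := corrCoeff_nonneg k
  set v := gradient h x
  set dW := divergence (weightGrad (k + 1 + m) k (corrCoeff k)) x
  have h5 : 0 ≤ -(h x ^ 2 / 2 * dW) := by
    have := sq_nonneg (h x)
    nlinarith
  have h6 : 0 ≤ ‖v‖ ^ 2 * ((C - 1) + 2 * corrCoeff k *
      ((1 - T ^ 2)⁻¹ - (1 - sqDist (k + 1 + m) k x)⁻¹)) := by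
    refine mul_nonneg (sq_nonneg _) (add_nonneg (by linarith) (mul_nonneg (by linarith) ?_))
    linarith
  have e : (((k + 1 + m : ℕ) : ℝ)) - (k : ℝ) / axisDist (k + 1 + m) k x =
      k + 1 + m - k * (axisDist (k + 1 + m) k x)⁻¹ := by push_cast; ring
  rw [e]
  linarith

lemma flux_energyField_nonneg (hR : R ≤ 1)
    (hh : HarmonicOnNhd h (openTube (k + 1 + m) k R)) {C T : ℝ} (hC : 1 ≤ C) (hT0 : 0 < T)
    (hTR : T < R) : 0 ≤ flux (energyField k m h C T) T := by
  have hR0 : 0 < R := hT0.trans hTR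
  rw [flux_eq_integral_levelDivergence hR (contDiffOn_energyField hR0 hR hh C T) hT0 hTR,
    intervalIntegral.integral_of_le hT0.le]
  refine setIntegral_nonneg measurableSet_Ioc fun s hs => integral_nonneg fun σ => ?_
  have hs1 : s < 1 := by linarith [hs.2]
  refine mul_nonneg (jac_pos hs.1 hs1 σ).le (divergence_energyField_nonneg hR0 hR hh hC hT0 hTR ?_)
  rw [sqDist_tubePoint (by rwa [abs_of_pos hs.1])]
  exact pow_le_pow_left₀ hs.1.le hs.2 2

/-! ### Derivatives of the energy -/

/-- The function `f Δf` in tube coordinates. -/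
def curv (s : ℝ) (σ : Params k m) : ℝ := (k + m) - k / (1 + s * cosAngle σ)

/-- The radial derivative of `h`. -/
def radialDeriv (h : EuclideanSpace ℝ (Fin (k + 1 + m)) → ℝ) (s : ℝ) (σ : Params k m) : ℝ :=
  ⟪gradient h (tubePoint s σ), unitNormal σ⟫_ℝ

/-- The energy `H` in tube coordinates. -/
def energy (h : EuclideanSpace ℝ (Fin (k + 1 + m)) → ℝ) (s : ℝ) : ℝ :=
  ∫ σ : Params k m, jac s σ * h (tubePoint s σ) ^ 2 ∂paramMeasure k m

/-- The part of the derivative of `H` due to the change of the surface measure. -/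
def curvEnergy (h : EuclideanSpace ℝ (Fin (k + 1 + m)) → ℝ) (s : ℝ) : ℝ :=
  ∫ σ : Params k m, jac s σ * (curv s σ / s * h (tubePoint s σ) ^ 2) ∂paramMeasure k m

/-- The derivative of `curvEnergy`. -/
def curvEnergyDeriv (h : EuclideanSpace ℝ (Fin (k + 1 + m)) → ℝ) (s : ℝ) : ℝ :=
  ∫ σ : Params k m, jac s σ * ((curv s σ ^ 2 + s * (k * cosAngle σ / (1 + s * cosAngle σ) ^ 2)
    - curv s σ) / s ^ 2 * h (tubePoint s σ) ^ 2 +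
      2 * (curv s σ / s) * h (tubePoint s σ) * radialDeriv h s σ) ∂paramMeasure k m

/-- The flux of `h ∇h`. -/
def radialEnergy (h : EuclideanSpace ℝ (Fin (k + 1 + m)) → ℝ) (s : ℝ) : ℝ :=
  ∫ σ : Params k m, jac s σ * (h (tubePoint s σ) * radialDeriv h s σ) ∂paramMeasure k m

/-- The Dirichlet energy on a level. -/
def gradEnergy (h : EuclideanSpace ℝ (Fin (k + 1 + m)) → ℝ) (s : ℝ) : ℝ :=
  ∫ σ : Params k m, jac s σ * ‖gradient h (tubePoint s σ)‖ ^ 2 ∂paramMeasure k m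

/-- Differentiation under the integral sign; compactness of the parameter space makes a constant a
dominating function. -/
lemma hasDerivAt_param_integral {w w' : ℝ → Params k m → ℝ} {I : Set ℝ} (hI : IsOpen I)
    (hw : ContinuousOn (fun p : ℝ × Params k m => w p.1 p.2) (I ×ˢ univ))
    (hw' : ContinuousOn (fun p : ℝ × Params k m => w' p.1 p.2) (I ×ˢ univ))
    (hd : ∀ s ∈ I, ∀ σ, HasDerivAt (fun r => w r σ) (w' s σ) s) {t : ℝ} (ht : t ∈ I) :
    HasDerivAt (fun s => ∫ σ, w s σ ∂paramMeasure k m) (∫ σ, w' t σ ∂paramMeasure k m) t := by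
  obtain ⟨δ, hδ, hball⟩ := Metric.nhds_basis_closedBall.mem_iff.1 (hI.mem_nhds ht)
  have hK : IsCompact (Metric.closedBall t δ ×ˢ (univ : Set (Params k m))) :=
    (isCompact_closedBall t δ).prod isCompact_univ
  obtain ⟨M, hM⟩ := hK.exists_bound_of_continuousOn (hw'.mono (prod_mono hball subset_rfl))
  refine (hasDerivAt_integral_of_dominated_loc_of_deriv_le (bound := fun _ => M)
    (Metric.closedBall_mem_nhds t hδ) ?_ (integrable_param hw ht)
    (integrable_param hw' ht).aestronglyMeasurable ?_ (integrable_const M) ?_).2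
  · filter_upwards [hI.mem_nhds ht] with s hs using (integrable_param hw hs).aestronglyMeasurable
  · exact Eventually.of_forall fun σ s hs => hM (s, σ) ⟨hs, trivial⟩
  · exact Eventually.of_forall fun σ s hs => hd s (hball hs) σ

lemma hasDerivAt_tubePoint (s : ℝ) (σ : Params k m) :
    HasDerivAt (fun r => tubePoint r σ) (unitNormal σ) s := by
  have := ((hasDerivAt_id s).smul_const (unitNormal σ)).const_add (foot σ)
  simpa [tubePoint] using this

lemma hasDerivAt_one_add_mul_cosAngle (s : ℝ) (σ : Params k m) :
    HasDerivAt (fun r => 1 + r * cosAngle σ) (cosAngle σ) s := by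
  simpa using ((hasDerivAt_id s).mul_const (cosAngle σ)).const_add 1

lemma hasDerivAt_jac {s : ℝ} (hs0 : 0 < s) (hs1 : s < 1) (σ : Params k m) :
    HasDerivAt (fun r => jac r σ) (jac s σ * (curv s σ / s)) s := by
  have hp := one_add_mul_cosAngle_pos (by rwa [abs_of_pos hs0] : |s| < 1) σ
  have h := (hasDerivAt_pow m s).mul ((hasDerivAt_one_add_mul_cosAngle s σ).pow k)
  refine h.congr_deriv ?_
  simp only [jac, curv]
  -- The exponent `m - 1` is truncated, which is harmless because the factor `m` vanishes for `m =
  -- 0`.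
  have e1 : (m : ℝ) * s ^ (m - 1) = m * s ^ m / s := by
    rcases m with _ | m
    · simp
    · simp [pow_succ]; field_simp
  have e2 : (k : ℝ) * (1 + s * cosAngle σ) ^ (k - 1) =
      k * (1 + s * cosAngle σ) ^ k / (1 + s * cosAngle σ) := by
    rcases k with _ | k
    · simp
    · simp [pow_succ]; field_simp
  simp only [Pi.pow_apply]
  rw [e1, e2]
  field_simp
  ring

lemma hasDerivAt_curv {s : ℝ} (hs0 : 0 < s) (hs1 : s < 1) (σ : Params k m) :
    HasDerivAt (fun r => curv r σ) (k * cosAngle σ / (1 + s * cosAngle σ) ^ 2) s := by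
  have hp := one_add_mul_cosAngle_pos (by rwa [abs_of_pos hs0] : |s| < 1) σ
  have h := (((hasDerivAt_one_add_mul_cosAngle s σ).inv hp.ne').const_mul (k : ℝ)).const_sub
    ((k : ℝ) + m)
  refine h.congr_deriv ?_
  field_simp

lemma hasDerivAt_comp_tubePoint (hR : R ≤ 1) (hh : HarmonicOnNhd h (openTube (k + 1 + m) k R))
    {s : ℝ} (hs : s ∈ Ioo (-R) R) (σ : Params k m) :
    HasDerivAt (fun r => h (tubePoint r σ)) (radialDeriv h s σ) s := by
  have h1 := (hasFDerivAt_of_contDiffAt_two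
    (hh _ (tubePoint_mem_openTube hR hs σ)).1).comp_hasDerivAt s (hasDerivAt_tubePoint s σ)
  exact h1

end SphereTube
end

open Real Set MeasureTheory InnerProductSpace
noncomputable section

namespace SphereTube
open scoped NNReal ENNReal Topology ContDiff
open Filter

variable {k m : ℕ} {h : EuclideanSpace ℝ (Fin (k + 1 + m)) → ℝ} {R : ℝ}

/-! ### Continuity of the integrands on the tube -/

lemma continuousOn_harmonic_tubePoint (hR : R ≤ 1)
    (hh : HarmonicOnNhd h (openTube (k + 1 + m) k R)) :
    ContinuousOn (fun p : ℝ × Params k m => h (tubePoint p.1 p.2)) (Ioo (-R) R ×ˢ univ) :=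
  continuousOn_tube_integrand hR fun x hx => (hh x hx).1.continuousAt.continuousWithinAt

lemma continuousOn_gradient_tubePoint (hR : R ≤ 1)
    (hh : HarmonicOnNhd h (openTube (k + 1 + m) k R)) :
    ContinuousOn (fun p : ℝ × Params k m => gradient h (tubePoint p.1 p.2)) (Ioo (-R) R ×ˢ univ) :=
  ContinuousOn.comp (g := gradient h) (t := openTube (k + 1 + m) k R)
    (fun x hx => (contDiffAt_gradient (hh x hx).1).continuousAt.continuousWithinAt)
    continuous_tubePoint.continuousOn fun p hp => tubePoint_mem_openTube hR hp.1 p.2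

lemma continuousOn_radialDeriv (hR : R ≤ 1) (hh : HarmonicOnNhd h (openTube (k + 1 + m) k R)) :
    ContinuousOn (fun p : ℝ × Params k m => radialDeriv h p.1 p.2) (Ioo (-R) R ×ˢ univ) :=
  (continuousOn_gradient_tubePoint hR hh).inner
    (continuous_unitNormal.comp continuous_snd).continuousOn

lemma one_add_mul_cosAngle_pos_of_mem (hR : R ≤ 1) {s : ℝ} (hs : s ∈ Ioo (-R) R)
    (σ : Params k m) : 0 < 1 + s * cosAngle σ :=
  one_add_mul_cosAngle_pos ((abs_lt.2 hs).trans_le hR) σ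

lemma continuous_one_add_mul_cosAngle :
    Continuous fun p : ℝ × Params k m => 1 + p.1 * cosAngle p.2 := by
  have := continuous_cosAngle (k := k) (m := m)
  fun_prop

lemma continuousOn_curv (hR : R ≤ 1) :
    ContinuousOn (fun p : ℝ × Params k m => curv p.1 p.2) (Ioo (-R) R ×ˢ univ) :=
  continuousOn_const.sub (continuousOn_const.div continuous_one_add_mul_cosAngle.continuousOn
    fun p hp => (one_add_mul_cosAngle_pos_of_mem hR hp.1 p.2).ne')

lemma prod_Ioo_subset : Ioo 0 R ×ˢ (univ : Set (Params k m)) ⊆ Ioo (-R) R ×ˢ univ :=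
  prod_mono (fun s hs => ⟨by linarith [hs.1, hs.2], hs.2⟩) subset_rfl

lemma continuousOn_energy_integrand (hR : R ≤ 1)
    (hh : HarmonicOnNhd h (openTube (k + 1 + m) k R)) :
    ContinuousOn (fun p : ℝ × Params k m => jac p.1 p.2 * h (tubePoint p.1 p.2) ^ 2)
      (Ioo (-R) R ×ˢ univ) :=
  continuous_jac.continuousOn.mul ((continuousOn_harmonic_tubePoint hR hh).pow 2)

lemma continuousOn_curvEnergy_integrand (hR : R ≤ 1)
    (hh : HarmonicOnNhd h (openTube (k + 1 + m) k R)) :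
    ContinuousOn (fun p : ℝ × Params k m =>
      jac p.1 p.2 * (curv p.1 p.2 / p.1 * h (tubePoint p.1 p.2) ^ 2)) (Ioo 0 R ×ˢ univ) := by
  refine continuous_jac.continuousOn.mul ((((continuousOn_curv hR).mono prod_Ioo_subset).div
    continuous_fst.continuousOn fun p hp => hp.1.1.ne').mul ?_)
  exact ((continuousOn_harmonic_tubePoint hR hh).pow 2).mono prod_Ioo_subset

lemma continuousOn_radialEnergy_integrand (hR : R ≤ 1)
    (hh : HarmonicOnNhd h (openTube (k + 1 + m) k R)) :
    ContinuousOn (fun p : ℝ × Params k m =>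
      jac p.1 p.2 * (h (tubePoint p.1 p.2) * radialDeriv h p.1 p.2)) (Ioo (-R) R ×ˢ univ) :=
  continuous_jac.continuousOn.mul
    ((continuousOn_harmonic_tubePoint hR hh).mul (continuousOn_radialDeriv hR hh))

lemma continuousOn_gradEnergy_integrand (hR : R ≤ 1)
    (hh : HarmonicOnNhd h (openTube (k + 1 + m) k R)) :
    ContinuousOn (fun p : ℝ × Params k m =>
      jac p.1 p.2 * ‖gradient h (tubePoint p.1 p.2)‖ ^ 2) (Ioo (-R) R ×ˢ univ) :=
  continuous_jac.continuousOn.mul ((continuousOn_gradient_tubePoint hR hh).norm.pow 2)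

lemma continuousOn_curvEnergyDeriv_integrand (hR : R ≤ 1)
    (hh : HarmonicOnNhd h (openTube (k + 1 + m) k R)) :
    ContinuousOn (fun p : ℝ × Params k m => jac p.1 p.2 * ((curv p.1 p.2 ^ 2 +
      p.1 * (k * cosAngle p.2 / (1 + p.1 * cosAngle p.2) ^ 2) - curv p.1 p.2) / p.1 ^ 2 *
        h (tubePoint p.1 p.2) ^ 2 +
      2 * (curv p.1 p.2 / p.1) * h (tubePoint p.1 p.2) * radialDeriv h p.1 p.2))
      (Ioo 0 R ×ˢ univ) := by
  have hc := (continuousOn_curv (k := k) (m := m) hR).mono prod_Ioo_subset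
  have h1 := (continuousOn_harmonic_tubePoint hR hh).mono prod_Ioo_subset
  have h2 := (continuousOn_radialDeriv hR hh).mono prod_Ioo_subset
  have h3 : ContinuousOn (fun p : ℝ × Params k m =>
      k * cosAngle p.2 / (1 + p.1 * cosAngle p.2) ^ 2) (Ioo 0 R ×ˢ univ) :=
    ((continuous_cosAngle.comp continuous_snd).const_mul (k : ℝ)).continuousOn.div
      (continuous_one_add_mul_cosAngle.pow 2).continuousOn fun p hp =>
        pow_ne_zero 2 (one_add_mul_cosAngle_pos_of_mem hR (prod_Ioo_subset hp).1 p.2).ne'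
  have hf : ContinuousOn (fun p : ℝ × Params k m => p.1) (Ioo 0 R ×ˢ univ) :=
    continuous_fst.continuousOn
  refine continuous_jac.continuousOn.mul (ContinuousOn.add (ContinuousOn.mul ?_ (h1.pow 2)) ?_)
  · exact ((((hc.pow 2).add (hf.mul h3))).sub hc).div (hf.pow 2) fun p hp =>
      pow_ne_zero 2 hp.1.1.ne'
  · exact ((continuousOn_const.mul (hc.div hf fun p hp => hp.1.1.ne')).mul h1).mul h2

/-! ### First and second derivatives of the energy -/

theorem hasDerivAt_energy (hR : R ≤ 1) (hh : HarmonicOnNhd h (openTube (k + 1 + m) k R)) {t : ℝ}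
    (ht : t ∈ Ioo 0 R) : HasDerivAt (energy h) (curvEnergy h t + 2 * radialEnergy h t) t := by
  have c1 := continuousOn_curvEnergy_integrand hR hh
  have c2 := (continuousOn_radialEnergy_integrand hR hh).mono prod_Ioo_subset
  have key := hasDerivAt_param_integral (k := k) (m := m)
    (w := fun s σ => jac s σ * h (tubePoint s σ) ^ 2)
    (w' := fun s σ => jac s σ * (curv s σ / s * h (tubePoint s σ) ^ 2) +
      2 * (jac s σ * (h (tubePoint s σ) * radialDeriv h s σ))) isOpen_Ioo
    ((continuousOn_energy_integrand hR hh).mono prod_Ioo_subset)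
    (c1.add (continuousOn_const.mul c2)) (fun s hs σ => ?_) ht
  · refine key.congr_deriv ?_
    rw [integral_add (integrable_param (w := fun s σ => jac s σ * (curv s σ / s *
      h (tubePoint s σ) ^ 2)) c1 ht) ((integrable_param (w := fun s σ => jac s σ *
      (h (tubePoint s σ) * radialDeriv h s σ)) c2 ht).const_mul 2), integral_const_mul]
    rfl
  · have hs' : s ∈ Ioo (-R) R := ⟨by linarith [hs.1, hs.2], hs.2⟩
    refine ((hasDerivAt_jac hs.1 (hs.2.trans_le hR) σ).mul
      ((hasDerivAt_comp_tubePoint hR hh hs' σ).pow 2)).congr_deriv ?_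
    simp only [Pi.pow_apply]
    ring

theorem hasDerivAt_curvEnergy (hR : R ≤ 1) (hh : HarmonicOnNhd h (openTube (k + 1 + m) k R))
    {t : ℝ} (ht : t ∈ Ioo 0 R) : HasDerivAt (curvEnergy h) (curvEnergyDeriv h t) t := by
  refine hasDerivAt_param_integral (w := fun s σ => jac s σ * (curv s σ / s *
      h (tubePoint s σ) ^ 2)) (w' := fun s σ => jac s σ * ((curv s σ ^ 2 +
      s * (k * cosAngle σ / (1 + s * cosAngle σ) ^ 2) - curv s σ) / s ^ 2 * h (tubePoint s σ) ^ 2 +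
      2 * (curv s σ / s) * h (tubePoint s σ) * radialDeriv h s σ))
    isOpen_Ioo (continuousOn_curvEnergy_integrand hR hh)
    (continuousOn_curvEnergyDeriv_integrand hR hh) (fun s hs σ => ?_) ht
  have hs' : s ∈ Ioo (-R) R := ⟨by linarith [hs.1, hs.2], hs.2⟩
  have hs1 := hs.2.trans_le hR
  have hs0 := hs.1.ne'
  refine ((hasDerivAt_jac hs.1 hs1 σ).mul (((hasDerivAt_curv hs.1 hs1 σ).div (hasDerivAt_id s)
    hs.1.ne').mul ((hasDerivAt_comp_tubePoint hR hh hs' σ).pow 2))).congr_deriv ?_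
  simp only [Pi.pow_apply, Pi.mul_apply, Pi.div_apply, id]
  field_simp
  ring

lemma contDiffOn_smul_gradient (hh : HarmonicOnNhd h (openTube (k + 1 + m) k R)) :
    ContDiffOn ℝ 1 (fun x => h x • gradient h x) (openTube (k + 1 + m) k R) := fun x hx =>
  (((hh x hx).1.of_le one_le_two).smul (contDiffAt_gradient (hh x hx).1)).contDiffWithinAt

lemma flux_smul_gradient (s : ℝ) :
    flux (fun x => h x • gradient h x) s = radialEnergy h s := by
  simp [flux, radialEnergy, radialDeriv, inner_smul_left]

lemma levelDivergence_smul_gradient (hR : R ≤ 1)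
    (hh : HarmonicOnNhd h (openTube (k + 1 + m) k R)) {s : ℝ} (hs : s ∈ Ioo (-R) R) :
    levelDivergence (fun x => h x • gradient h x) s = gradEnergy h s := by
  refine integral_congr_ae (Eventually.of_forall fun σ => ?_)
  have hx := hh _ (tubePoint_mem_openTube hR hs σ)
  simp only
  rw [divergence_smul (hasFDerivAt_of_contDiffAt_two hx.1)
    ((contDiffAt_gradient hx.1).differentiableAt one_ne_zero), divergence_gradient hx,
    innerSL_apply_apply, real_inner_self_eq_norm_sq]
  ring

lemma continuousOn_gradEnergy (hR : R ≤ 1) (hh : HarmonicOnNhd h (openTube (k + 1 + m) k R)) :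
    ContinuousOn (gradEnergy h) (Ioo (-R) R) :=
  continuousOn_param_integral (continuousOn_gradEnergy_integrand hR hh)

/-- Green's identity for `h∇h`, whose divergence is `|∇h|²`. It lets `radialEnergy` be
differentiated without second derivatives of `h`, and it is used again for positivity. -/
theorem radialEnergy_eq_integral_gradEnergy (hR : R ≤ 1)
    (hh : HarmonicOnNhd h (openTube (k + 1 + m) k R)) {t : ℝ} (ht : t ∈ Ioo 0 R) :
    radialEnergy h t = ∫ s in (0 : ℝ)..t, gradEnergy h s := by
  rw [← flux_smul_gradient,
    flux_eq_integral_levelDivergence hR (contDiffOn_smul_gradient hh) ht.1 ht.2]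
  refine intervalIntegral.integral_congr fun s hs => ?_
  rw [uIcc_of_le ht.1.le] at hs
  exact levelDivergence_smul_gradient hR hh ⟨by linarith [hs.1, ht.1, ht.2], hs.2.trans_lt ht.2⟩

theorem hasDerivAt_radialEnergy (hR : R ≤ 1) (hh : HarmonicOnNhd h (openTube (k + 1 + m) k R))
    {t : ℝ} (ht : t ∈ Ioo 0 R) : HasDerivAt (radialEnergy h) (gradEnergy h t) t := by
  have hc := continuousOn_gradEnergy hR hh
  have ht' : t ∈ Ioo (-R) R := ⟨by linarith [ht.1, ht.2], ht.2⟩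
  have hsub : uIcc 0 t ⊆ Ioo (-R) R := by
    rw [uIcc_of_le ht.1.le]
    exact fun s hs => ⟨by linarith [hs.1, ht.1, ht.2], hs.2.trans_lt ht.2⟩
  have h1 := intervalIntegral.integral_hasDerivAt_right (hc.mono hsub).intervalIntegrable
      (hc.stronglyMeasurableAtFilter isOpen_Ioo t ht') (hc.continuousAt (isOpen_Ioo.mem_nhds ht'))
  refine h1.congr_of_eventuallyEq ?_
  filter_upwards [isOpen_Ioo.mem_nhds ht] with s hs
  exact radialEnergy_eq_integral_gradEnergy hR hh hs

/-- The first derivative of the energy. -/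
def energyDeriv (h : EuclideanSpace ℝ (Fin (k + 1 + m)) → ℝ) (s : ℝ) : ℝ :=
  curvEnergy h s + 2 * radialEnergy h s

/-- The second derivative of the energy. -/
def energyDeriv2 (h : EuclideanSpace ℝ (Fin (k + 1 + m)) → ℝ) (s : ℝ) : ℝ :=
  curvEnergyDeriv h s + 2 * gradEnergy h s

theorem hasDerivAt_energyDeriv (hR : R ≤ 1) (hh : HarmonicOnNhd h (openTube (k + 1 + m) k R))
    {t : ℝ} (ht : t ∈ Ioo 0 R) : HasDerivAt (energyDeriv h) (energyDeriv2 h t) t :=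
  (hasDerivAt_curvEnergy hR hh ht).add ((hasDerivAt_radialEnergy hR hh ht).const_mul 2)

end SphereTube
end

open Real Set MeasureTheory InnerProductSpace
noncomputable section

namespace SphereTube
open scoped NNReal ENNReal Topology ContDiff
open Filter

variable {k m : ℕ} {h : EuclideanSpace ℝ (Fin (k + 1 + m)) → ℝ} {R : ℝ}

/-! ### The differential inequality -/

lemma dampingConst_ge_one (k : ℕ) {ε : ℝ} (h0 : 0 < ε) (h1 : ε < 1) : 1 ≤ dampingConst k ε := by
  have : 1 / (2 - ε) ≤ 1 / ε := one_div_le_one_div_of_le h0 (by linarith)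
  have hk : (0 : ℝ) ≤ k := k.cast_nonneg
  unfold dampingConst
  nlinarith

lemma one_lt_dampingConst {k : ℕ} (hk : 1 ≤ k) {ε : ℝ} (h0 : 0 < ε) (h1 : ε < 1) :
    1 < dampingConst k ε := by
  have : 1 / (2 - ε) < 1 / ε := one_div_lt_one_div_of_lt h0 (by linarith)
  have hk : (1 : ℝ) ≤ k := by exact_mod_cast hk
  unfold dampingConst
  nlinarith

/-- The left side increases with `t`; at `t = 1 - ε` one has `1 - t² = ε(2 - ε)`, and the bound
exceeds it by `ε(8 - 3ε)(1 - ε)/(ε(2 - ε))²`. This is the slack in `B` that pays for the correction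
term of circles. -/
lemma four_mul_sq_div_le {ε t : ℝ} (h0 : 0 < ε) (h1 : ε < 1) (ht0 : 0 < t) (ht : t < 1 - ε) :
    4 * t ^ 2 / (1 - t ^ 2) ^ 2 ≤ 1 / ε - 2 / (2 - ε) + 1 / ε ^ 2 := by
  have hu : ε * (2 - ε) ≤ 1 - t ^ 2 := by nlinarith
  have hp : 0 < ε * (2 - ε) := mul_pos h0 (by linarith)
  have e1 : 4 * t ^ 2 / (1 - t ^ 2) ^ 2 ≤ 4 * (1 - ε) ^ 2 / (ε * (2 - ε)) ^ 2 := by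
    gcongr
  have h2 : 0 < 2 - ε := by linarith
  refine e1.trans ?_
  rw [show 1 / ε - 2 / (2 - ε) + 1 / ε ^ 2 =
    (4 * (1 - ε) ^ 2 + ε * (8 - 3 * ε) * (1 - ε)) / (ε * (2 - ε)) ^ 2 by field_simp; ring]
  gcongr
  have : 0 < ε * (8 - 3 * ε) * (1 - ε) :=
    mul_pos (mul_pos h0 (by linarith)) (by linarith)
  linarith

/-- The constant `B` splits as `(C - 1)(n - 1 - k/ε)` minus `k(1/ε - 2/(2 - ε) + 1/ε²)`. The first
part is at most `(C - 1)g` since `ρ ≥ 1 - t > ε`; the second dominates the boundary term of the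
correction. -/
lemma lowerConst_le_curv {ε t : ℝ} (h0 : 0 < ε) (h1 : ε < 1) (ht0 : 0 < t) (ht : t < 1 - ε)
    (σ : Params k m) : lowerConst (k + 1 + m) k ε + 4 * corrCoeff k * t ^ 2 / (1 - t ^ 2) ^ 2 ≤
      (dampingConst k ε - 1) * curv t σ := by
  have hr := (one_add_mul_cosAngle_mem ht0.le σ).1
  have hC := dampingConst_ge_one k h0 h1
  have hk0 : (0 : ℝ) ≤ k := k.cast_nonneg
  set C := dampingConst k ε
  have e1 : (k : ℝ) / (1 + t * cosAngle σ) ≤ k / ε :=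
    div_le_div_of_nonneg_left hk0 h0 (by linarith)
  have e2 : (C - 1) * ((k + m) - k / ε) ≤ (C - 1) * curv t σ :=
    mul_le_mul_of_nonneg_left (by unfold curv; linarith) (by linarith)
  have e3 : lowerConst (k + 1 + m) k ε =
      (C - 1) * ((k + m) - k / ε) - k * (1 / ε - 2 / (2 - ε) + 1 / ε ^ 2) := by
    simp only [lowerConst]
    push_cast
    ring
  have e4 : 4 * corrCoeff k * t ^ 2 / (1 - t ^ 2) ^ 2 ≤
      k * (1 / ε - 2 / (2 - ε) + 1 / ε ^ 2) := by
    have hq := four_mul_sq_div_le h0 h1 ht0 ht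
    have hq0 : 0 ≤ 4 * t ^ 2 / (1 - t ^ 2) ^ 2 := by positivity
    by_cases hk : k = 1
    · subst hk
      simpa [corrCoeff] using hq
    · simp only [corrCoeff, if_neg hk, mul_zero, zero_mul, zero_div]
      exact mul_nonneg hk0 (hq0.trans hq)
  linarith

lemma inner_corePart_unitNormal (s : ℝ) (σ : Params k m) :
    ⟪corePart (k + 1 + m) k (tubePoint s σ), unitNormal σ⟫_ℝ =
      (1 + s * cosAngle σ) * cosAngle σ := by
  rw [tubePoint_eq, corePart_append, unitNormal, inner_append]
  simp [inner_smul_left, inner_smul_right]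
  ring

/-- On the level `t` used in its normalisation the correction drops out of the weight, which becomes
`C - curv`. Only its normal derivative survives, as the last term. -/
lemma inner_energyField_unitNormal {C t : ℝ} (ht0 : 0 < t) (ht1 : t < 1) (σ : Params k m) :
    2 * t * ⟪energyField k m h C t (tubePoint t σ), unitNormal σ⟫_ℝ =
      2 * t ^ 2 * ‖gradient h (tubePoint t σ)‖ ^ 2 - 4 * t ^ 2 * radialDeriv h t σ ^ 2 +
      2 * t * (C - curv t σ) * h (tubePoint t σ) * radialDeriv h t σ +
      h (tubePoint t σ) ^ 2 * (t * (k * cosAngle σ / (1 + t * cosAngle σ) ^ 2) +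
        4 * corrCoeff k * t ^ 2 / (1 - t ^ 2) ^ 2) := by
  have hs : |t| < 1 := by rwa [abs_of_pos ht0]
  have hr := one_add_mul_cosAngle_pos hs σ
  have hu : 0 < 1 - t ^ 2 := by nlinarith
  simp only [energyField, rellichField, weight, weightGrad, inner_add_left, inner_sub_left,
    inner_smul_left, conj_trivial, radialField_tubePoint hs, axisDist_tubePoint hs,
    sqDist_tubePoint hs, inner_corePart_unitNormal, real_inner_self_eq_norm_sq,
    norm_unitNormal, real_inner_comm (gradient h (tubePoint t σ)) (unitNormal σ)]
  change _ = _ - 4 * t ^ 2 * ⟪gradient h (tubePoint t σ), unitNormal σ⟫_ℝ ^ 2 + 2 * t *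
    (C - ((k + m) - k / (1 + t * cosAngle σ))) * h (tubePoint t σ) *
      ⟪gradient h (tubePoint t σ), unitNormal σ⟫_ℝ + _
  field_simp
  ring

lemma integral_linear_combination {α : Type*} [MeasurableSpace α] {μ : Measure α}
    {f₁ f₂ f₃ f₄ f₅ f₆ : α → ℝ} (h₁ : Integrable f₁ μ) (h₂ : Integrable f₂ μ)
    (h₃ : Integrable f₃ μ) (h₄ : Integrable f₄ μ) (h₅ : Integrable f₅ μ) (h₆ : Integrable f₆ μ)
    (c₁ c₂ c₃ c₄ c₅ c₆ : ℝ) :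
    ∫ a, (c₁ * f₁ a + c₂ * f₂ a + c₃ * f₃ a + c₄ * f₄ a + c₅ * f₅ a - c₆ * f₆ a) ∂μ =
      c₁ * ∫ a, f₁ a ∂μ + c₂ * ∫ a, f₂ a ∂μ + c₃ * ∫ a, f₃ a ∂μ + c₄ * ∫ a, f₄ a ∂μ +
        c₅ * ∫ a, f₅ a ∂μ - c₆ * ∫ a, f₆ a ∂μ := by
  simp only [← integral_const_mul]
  rw [integral_sub (by fun_prop) (by fun_prop), integral_add (by fun_prop) (by fun_prop),
    integral_add (by fun_prop) (by fun_prop), integral_add (by fun_prop) (by fun_prop),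
    integral_add (by fun_prop) (by fun_prop)]

/-- A quadratic inequality in the free parameter `l`, equivalent to a discriminant bound but linear
under the integral sign. Subtracting the nonnegative quantity `2t` times the flux of `energyField`
still leaves a nonnegative integrand. -/
theorem energy_inequality {ε t : ℝ} (h0 : 0 < ε) (h1 : ε < 1)
    (hh : HarmonicOnNhd h (openTube (k + 1 + m) k (1 - ε))) (ht : t ∈ Ioo 0 (1 - ε)) (l : ℝ) :
    0 ≤ t ^ 2 * energyDeriv2 h t + dampingConst k ε * t * energyDeriv h t -
      lowerConst (k + 1 + m) k ε * energy h t - 2 * l * t * energyDeriv h t + l ^ 2 * energy h t := by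
  have hR : 1 - ε ≤ 1 := by linarith
  have ht' : t ∈ Ioo (-(1 - ε)) (1 - ε) := ⟨by linarith [ht.1, ht.2], ht.2⟩
  have ht1 : t < 1 := by linarith [ht.2]
  have hC := dampingConst_ge_one k h0 h1
  set C := dampingConst k ε with hCdef
  set B := lowerConst (k + 1 + m) k ε with hB
  have hF := flux_energyField_nonneg hR hh hC ht.1 ht.2
  have i1 := integrable_param (w := fun s σ => jac s σ * h (tubePoint s σ) ^ 2)
    (continuousOn_energy_integrand hR hh) ht'
  have i2 := integrable_param (w := fun s σ => jac s σ * (curv s σ / s * h (tubePoint s σ) ^ 2))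
    (continuousOn_curvEnergy_integrand hR hh) ht
  have i3 := integrable_param (w := fun s σ => jac s σ * ((curv s σ ^ 2 +
      s * (k * cosAngle σ / (1 + s * cosAngle σ) ^ 2) - curv s σ) / s ^ 2 * h (tubePoint s σ) ^ 2 +
      2 * (curv s σ / s) * h (tubePoint s σ) * radialDeriv h s σ))
    (continuousOn_curvEnergyDeriv_integrand hR hh) ht
  have i4 := integrable_param (w := fun s σ => jac s σ * (h (tubePoint s σ) * radialDeriv h s σ))
    (continuousOn_radialEnergy_integrand hR hh) ht'
  have i5 := integrable_param (w := fun s σ => jac s σ * ‖gradient h (tubePoint s σ)‖ ^ 2)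
    (continuousOn_gradEnergy_integrand hR hh) ht'
  have i6 := integrable_param (w := fun s σ => jac s σ *
      ⟪energyField k m h C t (tubePoint s σ), unitNormal σ⟫_ℝ)
    (continuousOn_flux_integrand hR
      (contDiffOn_energyField (by linarith) hR hh C t).continuousOn) ht'
  have key : 0 ≤ ∫ σ : Params k m,
      (t ^ 2 * (jac t σ * ((curv t σ ^ 2 +
        t * (k * cosAngle σ / (1 + t * cosAngle σ) ^ 2) - curv t σ) / t ^ 2 * h (tubePoint t σ) ^ 2 +
        2 * (curv t σ / t) * h (tubePoint t σ) * radialDeriv h t σ)) +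
      2 * t ^ 2 * (jac t σ * ‖gradient h (tubePoint t σ)‖ ^ 2) +
      (C - 2 * l) * t * (jac t σ * (curv t σ / t * h (tubePoint t σ) ^ 2)) +
      2 * (C - 2 * l) * t * (jac t σ * (h (tubePoint t σ) * radialDeriv h t σ)) +
      (l ^ 2 - B) * (jac t σ * h (tubePoint t σ) ^ 2) -
      2 * t * (jac t σ * ⟪energyField k m h C t (tubePoint t σ), unitNormal σ⟫_ℝ))
      ∂paramMeasure k m := by
    refine integral_nonneg fun σ => ?_
    have hj := jac_pos ht.1 ht1 σ
    have hb := lowerConst_le_curv h0 h1 ht.1 ht.2 σ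
    have hi := inner_energyField_unitNormal (h := h) (C := C) ht.1 ht1 σ
    have ht0 := ht.1.ne'
    set Y := ⟪energyField k m h C t (tubePoint t σ), unitNormal σ⟫_ℝ
    set g := curv t σ
    set d := radialDeriv h t σ
    set u := h (tubePoint t σ)
    set v := ‖gradient h (tubePoint t σ)‖
    set z := k * cosAngle σ / (1 + t * cosAngle σ) ^ 2
    set y := 4 * corrCoeff k * t ^ 2 / (1 - t ^ 2) ^ 2
    -- The flux trades `2t²|∇h|²` for `4t²d²`, which completes the square; the remaining multiple of
    -- `u²` is nonnegative by `lowerConst_le_curv`.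
    have e : 0 ≤ jac t σ * ((2 * t * d + g * u - l * u) ^ 2 + ((C - 1) * g - (B + y)) * u ^ 2) :=
      mul_nonneg hj.le (add_nonneg (sq_nonneg _) (mul_nonneg (by linarith) (sq_nonneg _)))
    refine e.trans_eq ?_
    rw [show 2 * t * (jac t σ * Y) = jac t σ * (2 * t * Y) by ring, hi]
    field_simp
    ring
  rw [integral_linear_combination i3 i5 i2 i4 i1 i6] at key
  have hF' : 0 ≤ 2 * t * flux (energyField k m h C t) t := mul_nonneg (by linarith [ht.1]) hF
  simp only [energyDeriv2, energyDeriv, energy, curvEnergy, radialEnergy, gradEnergy,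
    curvEnergyDeriv]
  simp only [flux] at hF'
  linarith

theorem energy_inequality_of_pos {ε t : ℝ} (h0 : 0 < ε) (h1 : ε < 1)
    (hh : HarmonicOnNhd h (openTube (k + 1 + m) k (1 - ε))) (ht : t ∈ Ioo 0 (1 - ε))
    (hpos : 0 < energy h t) : lowerConst (k + 1 + m) k ε * energy h t ^ 2 ≤
      t ^ 2 * (energyDeriv2 h t * energy h t - energyDeriv h t ^ 2) +
        dampingConst k ε * t * energy h t * energyDeriv h t := by
  -- The minimiser of the quadratic in `l`.
  have := energy_inequality h0 h1 hh ht (t * energyDeriv h t / energy h t)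
  have h2 := mul_nonneg hpos.le this
  have e : t * energyDeriv h t / energy h t * energy h t = t * energyDeriv h t :=
    div_mul_cancel₀ _ hpos.ne'
  set l := t * energyDeriv h t / energy h t
  have e2 : (l * energy h t) ^ 2 = (t * energyDeriv h t) ^ 2 := by rw [e]
  nlinarith

end SphereTube
end

open Real Set MeasureTheory InnerProductSpace
noncomputable section

namespace SphereTube
open scoped NNReal ENNReal Topology ContDiff
open Filter

/-! ### Consequences of the differential inequality -/

section Convexity

variable {H H₁ H₂ φ : ℝ → ℝ} {A B C a b R : ℝ}

lemma hasDerivAt_log_add (hH : ∀ t ∈ Ioo a b, HasDerivAt H (H₁ t) t)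
    (hpos : ∀ t ∈ Ioo a b, 0 < H t) (ha : 0 ≤ a) {t : ℝ} (ht : t ∈ Ioo a b) :
    HasDerivAt (fun s => log (H s) + A * log s) (H₁ t / H t + A / t) t := by
  have ht0 : 0 < t := ha.trans_lt ht.1
  exact ((hH t ht).log (hpos t ht).ne').add ((hasDerivAt_log ht0.ne').const_mul A)

/-- Adding `A log t` to `log H` contributes `A(C - 1)/t²` to the left side of the inequality, which
cancels `B/t²` exactly. What is left is the derivative of the given function up to a positive
factor. -/
theorem monotoneOn_frequency (ha : 0 ≤ a) (hH : ∀ t ∈ Ioo a b, HasDerivAt H (H₁ t) t)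
    (hH₁ : ∀ t ∈ Ioo a b, HasDerivAt H₁ (H₂ t) t) (hpos : ∀ t ∈ Ioo a b, 0 < H t)
    (ineq : ∀ t ∈ Ioo a b, B * H t ^ 2 ≤
      t ^ 2 * (H₂ t * H t - H₁ t ^ 2) + C * t * H t * H₁ t) (hA : A * (C - 1) = -B) :
    MonotoneOn (fun t => t ^ C * (H₁ t / H t + A / t)) (Ioo a b) := by
  have hd : ∀ t ∈ Ioo a b, HasDerivAt (fun t => t ^ C * (H₁ t / H t + A / t))
      (C * t ^ (C - 1) * (H₁ t / H t + A / t) +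
        t ^ C * ((H₂ t * H t - H₁ t * H₁ t) / H t ^ 2 - A / t ^ 2)) t := by
    intro t ht
    have ht0 : 0 < t := ha.trans_lt ht.1
    refine (hasDerivAt_rpow_const (p := C) (Or.inl ht0.ne')).mul
      ((((hH₁ t ht).div (hH t ht) (hpos t ht).ne').add
        ((hasDerivAt_inv ht0.ne').const_mul A)).congr_deriv ?_)
    ring
  refine monotoneOn_of_deriv_nonneg (convex_Ioo a b)
    (fun t ht => (hd t ht).continuousAt.continuousWithinAt) ?_ ?_
  · rw [interior_Ioo]
    exact fun t ht => (hd t ht).differentiableAt.differentiableWithinAt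
  · rw [interior_Ioo]
    intro t ht
    have ht0 : 0 < t := ha.trans_lt ht.1
    have hp := hpos t ht
    have hp' := hp.ne'
    rw [(hd t ht).deriv]
    have e : C * t ^ (C - 1) * (H₁ t / H t + A / t) +
        t ^ C * ((H₂ t * H t - H₁ t * H₁ t) / H t ^ 2 - A / t ^ 2) =
        t ^ C / (t ^ 2 * H t ^ 2) * (t ^ 2 * (H₂ t * H t - H₁ t ^ 2) + C * t * H t * H₁ t +
          A * (C - 1) * H t ^ 2) := by
      rw [rpow_sub_one ht0.ne']
      field_simp
      ring
    rw [e, hA]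
    refine mul_nonneg (by positivity) ?_
    linarith [ineq t ht]

/-- A function whose derivative is `t ^ (-C)` times a monotone function lies above its tangents,
in the variable `φ`. -/
theorem tangent_le_log_add (ha : 0 ≤ a) (hH : ∀ t ∈ Ioo a b, HasDerivAt H (H₁ t) t)
    (hH₁ : ∀ t ∈ Ioo a b, HasDerivAt H₁ (H₂ t) t) (hpos : ∀ t ∈ Ioo a b, 0 < H t)
    (ineq : ∀ t ∈ Ioo a b, B * H t ^ 2 ≤
      t ^ 2 * (H₂ t * H t - H₁ t ^ 2) + C * t * H t * H₁ t) (hA : A * (C - 1) = -B)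
    (hφ : ∀ t, 0 < t → HasDerivAt φ (t ^ (-C)) t) {r t : ℝ} (hr : r ∈ Ioo a b)
    (ht : t ∈ Ioo a b) : log (H r) + A * log r + r ^ C * (H₁ r / H r + A / r) * (φ t - φ r) ≤
      log (H t) + A * log t := by
  have mono := monotoneOn_frequency ha hH hH₁ hpos ineq hA
  set M : ℝ → ℝ := fun t => t ^ C * (H₁ t / H t + A / t) with hM
  have hd : ∀ s ∈ Ioo a b, HasDerivAt (fun s => log (H s) + A * log s - M r * φ s)
      (s ^ (-C) * (M s - M r)) s := by
    intro s hs
    have hs0 : 0 < s := ha.trans_lt hs.1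
    refine ((hasDerivAt_log_add hH hpos ha hs).sub ((hφ s hs0).const_mul (M r))).congr_deriv ?_
    have : s ^ (-C) * s ^ C = 1 := by rw [← rpow_add hs0]; simp
    rw [mul_sub, hM]
    simp only
    rw [← mul_assoc, this]
    ring
  have pos : ∀ s ∈ Ioo a b, 0 < s ^ (-C) := fun s hs => rpow_pos_of_pos (ha.trans_lt hs.1) _
  change _ + M r * (φ t - φ r) ≤ _
  rcases le_total r t with hrt | htr
  · have sub : Icc r t ⊆ Ioo a b := fun s hs => ⟨hr.1.trans_le hs.1, hs.2.trans_lt ht.2⟩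
    have := monotoneOn_of_deriv_nonneg (convex_Icc r t)
      (fun s hs => (hd s (sub hs)).continuousAt.continuousWithinAt)
      (fun s hs => (hd s (sub (interior_subset hs))).differentiableAt.differentiableWithinAt)
      (fun s hs => by
        have hs' := interior_subset hs
        rw [(hd s (sub hs')).deriv]
        exact mul_nonneg (pos s (sub hs')).le (sub_nonneg.2 (mono hr (sub hs') hs'.1)))
      (left_mem_Icc.2 hrt) (right_mem_Icc.2 hrt) hrt
    simp only at this
    linarith
  · have sub : Icc t r ⊆ Ioo a b := fun s hs => ⟨ht.1.trans_le hs.1, hs.2.trans_lt hr.2⟩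
    have := antitoneOn_of_deriv_nonpos (convex_Icc t r)
      (fun s hs => (hd s (sub hs)).continuousAt.continuousWithinAt)
      (fun s hs => (hd s (sub (interior_subset hs))).differentiableAt.differentiableWithinAt)
      (fun s hs => by
        have hs' := interior_subset hs
        rw [(hd s (sub hs')).deriv]
        exact mul_nonpos_of_nonneg_of_nonpos (pos s (sub hs')).le
          (sub_nonpos.2 (mono (sub hs') hr hs'.2)))
      (left_mem_Icc.2 htr) (right_mem_Icc.2 htr) htr
    simp only at this
    linarith

/-- Convexity in `φ`: the tangent inequalities at `t₁`, evaluated at `t₀` and `t₂`, are averaged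
with weights `α` and `1 - α`, and the slopes cancel. -/
theorem log_add_le_of_mem (hH : ∀ t ∈ Ioo 0 R, HasDerivAt H (H₁ t) t)
    (hH₁ : ∀ t ∈ Ioo 0 R, HasDerivAt H₁ (H₂ t) t) (hpos : ∀ t ∈ Ioo 0 R, 0 < H t)
    (ineq : ∀ t ∈ Ioo 0 R, B * H t ^ 2 ≤
      t ^ 2 * (H₂ t * H t - H₁ t ^ 2) + C * t * H t * H₁ t) (hA : A * (C - 1) = -B)
    (hφ : ∀ t, 0 < t → HasDerivAt φ (t ^ (-C)) t) {t₀ t₁ t₂ α : ℝ} (h0 : 0 < t₀) (h01 : t₀ ≤ t₁)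
    (h12 : t₁ ≤ t₂) (h2 : t₂ < R) (hα : α * φ t₀ + (1 - α) * φ t₂ = φ t₁) :
    log (H t₁) + A * log t₁ ≤
      α * (log (H t₀) + A * log t₀) + (1 - α) * (log (H t₂) + A * log t₂) := by
  have m0 : t₀ ∈ Ioo 0 R := ⟨h0, by linarith⟩
  have m1 : t₁ ∈ Ioo 0 R := ⟨by linarith, by linarith⟩
  have m2 : t₂ ∈ Ioo 0 R := ⟨by linarith, by linarith⟩
  have smono : StrictMonoOn φ (Ioi 0) := by
    refine strictMonoOn_of_deriv_pos (convex_Ioi 0)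
      (fun t ht => (hφ t ht).continuousAt.continuousWithinAt) fun t ht => ?_
    rw [interior_Ioi] at ht
    rw [(hφ t ht).deriv]
    exact rpow_pos_of_pos ht _
  rcases (h01.trans h12).eq_or_lt with h02 | h02
  -- When the three radii coincide `α` is arbitrary, but both sides agree.
  · have e1 : t₁ = t₀ := by linarith
    rw [e1, ← h02]
    linarith
  · have p02 := smono m0.1 m2.1 h02
    have p01 := smono.monotoneOn m0.1 m1.1 h01
    have p12 := smono.monotoneOn m1.1 m2.1 h12
    -- That `α` lies in `[0, 1]` is not assumed; it follows from `φ t₁` lying between `φ t₀` and `φ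
    -- t₂`.
    have a0 : 0 ≤ α := by
      by_contra hc
      push Not at hc
      nlinarith
    have a1 : 0 ≤ 1 - α := by
      by_contra hc
      push Not at hc
      nlinarith
    have q0 := mul_le_mul_of_nonneg_left
      (tangent_le_log_add le_rfl hH hH₁ hpos ineq hA hφ m1 m0) a0
    have q2 := mul_le_mul_of_nonneg_left
      (tangent_le_log_add le_rfl hH hH₁ hpos ineq hA hφ m1 m2) a1
    have e : α * (φ t₀ - φ t₁) + (1 - α) * (φ t₂ - φ t₁) = 0 := by linarith
    set M := t₁ ^ C * (H₁ t₁ / H t₁ + A / t₁)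
    have e' : M * (α * (φ t₀ - φ t₁) + (1 - α) * (φ t₂ - φ t₁)) = 0 := by rw [e, mul_zero]
    linarith

/-- Zeros of `H` cannot be followed by positive values. -/
theorem ne_zero_of_pos_right (hH : ∀ t ∈ Ioo 0 R, HasDerivAt H (H₁ t) t)
    (hH₁ : ∀ t ∈ Ioo 0 R, HasDerivAt H₁ (H₂ t) t) (h0 : ∀ t ∈ Ioo 0 R, 0 ≤ H t)
    (ineq : ∀ t ∈ Ioo 0 R, 0 < H t → B * H t ^ 2 ≤
      t ^ 2 * (H₂ t * H t - H₁ t ^ 2) + C * t * H t * H₁ t) (hA : A * (C - 1) = -B)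
    (hφ : ∀ t, 0 < t → HasDerivAt φ (t ^ (-C)) t) {r T : ℝ} (hr : 0 < r) (hrT : r < T)
    (hT : T < R) (hTpos : 0 < H T) : H r ≠ 0 := by
  intro hr0
  have sub : Icc r T ⊆ Ioo 0 R := fun s hs => ⟨hr.trans_le hs.1, hs.2.trans_lt hT⟩
  have hc : ContinuousOn H (Icc r T) :=
    fun s hs => (hH s (sub hs)).continuousAt.continuousWithinAt
  have hZ : IsCompact (Icc r T ∩ H ⁻¹' {0}) :=
    isCompact_Icc.of_isClosed_subset (hc.preimage_isClosed_of_isClosed isClosed_Icc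
      isClosed_singleton) inter_subset_left
  -- The last zero before `T`: to its right `H` is positive, so the tangent bound is available on
  -- `(a, T)`.
  obtain ⟨a, ⟨ha, ha0⟩, hmax⟩ := hZ.exists_isGreatest ⟨r, ⟨le_rfl, hrT.le⟩, hr0⟩
  have ha0' : H a = 0 := ha0
  have haT : a < T := lt_of_le_of_ne ha.2 fun e => by rw [← e, ha0'] at hTpos; exact lt_irrefl _ hTpos
  have ha_pos : 0 < a := (sub ha).1
  have sub' : Ioo a T ⊆ Ioo 0 R := fun s hs => ⟨ha_pos.trans hs.1, hs.2.trans hT⟩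
  have hpos : ∀ s ∈ Ioo a T, 0 < H s := fun s hs =>
    lt_of_le_of_ne (h0 s (sub' hs)) fun e =>
      absurd (hmax ⟨⟨ha.1.trans hs.1.le, hs.2.le⟩, e.symm⟩) (not_le.2 hs.1)
  obtain ⟨p, hp⟩ := exists_between haT
  have lower := fun s (hs : s ∈ Ioo a T) => tangent_le_log_add ha_pos.le
    (fun t ht => hH t (sub' ht)) (fun t ht => hH₁ t (sub' ht)) hpos
    (fun t ht => ineq t (sub' ht) (hpos t ht)) hA hφ hp hs
  set c := log (H p) + A * log p
  set M := p ^ C * (H₁ p / H p + A / p)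
  have hlim : ContinuousAt (fun s => exp (c + M * (φ s - φ p) - A * log s)) a := by
    have h1 := (hφ a ha_pos).continuousAt
    have h2 := continuousAt_log ha_pos.ne'
    fun_prop
  -- The tangent at `p` stays finite as `s` decreases to `a > 0`, so in the limit `H a` has a
  -- positive lower bound.
  have key : exp (c + M * (φ a - φ p) - A * log a) ≤ H a := by
    refine le_of_tendsto_of_tendsto (hlim.tendsto.mono_left (nhdsWithin_le_nhds (s := Ioi a)))
      ((hH a (sub ha)).continuousAt.tendsto.mono_left nhdsWithin_le_nhds) ?_
    filter_upwards [Ioo_mem_nhdsGT haT] with s hs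
    rw [← le_log_iff_exp_le (hpos s hs)]
    linarith [lower s hs]
  rw [ha0'] at key
  exact absurd key (not_le.2 (exp_pos _))

end Convexity

end SphereTube
end

open Real Set MeasureTheory InnerProductSpace
noncomputable section

namespace SphereTube
open scoped NNReal ENNReal Topology ContDiff
open Filter

variable {k m : ℕ} {h : EuclideanSpace ℝ (Fin (k + 1 + m)) → ℝ} {R : ℝ}

/-! ### Positivity of the energy -/

lemma eq_zero_of_integral_jac_mul {w : ℝ → Params k m → ℝ} {s : ℝ} (hs0 : 0 < s) (hs1 : s < 1)
    (hw : Continuous (w s)) (hw0 : ∀ σ, 0 ≤ w s σ)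
    (hI : ∫ σ, jac s σ * w s σ ∂paramMeasure k m = 0) (σ : Params k m) : w s σ = 0 := by
  have hj : Continuous fun σ : Params k m => jac s σ := continuous_jac_right s
  have hc : Continuous fun σ => jac s σ * w s σ := hj.mul hw
  have h1 := (integral_eq_zero_iff_of_nonneg (fun σ => mul_nonneg (jac_pos hs0 hs1 σ).le (hw0 σ))
    (hc.integrable_of_hasCompactSupport (HasCompactSupport.of_compactSpace _))).1 hI
  have h2 := (hc.ae_eq_iff_eq (paramMeasure k m) continuous_zero).1 h1
  exact (mul_eq_zero.1 (congrFun h2 σ)).resolve_left (jac_pos hs0 hs1 σ).ne'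

lemma continuous_of_continuousOn_prod {F : Type*} [TopologicalSpace F] {w : ℝ → Params k m → F}
    {I : Set ℝ} (hw : ContinuousOn (fun p : ℝ × Params k m => w p.1 p.2) (I ×ˢ univ)) {s : ℝ}
    (hs : s ∈ I) : Continuous (w s) := by
  rw [← continuousOn_univ]
  exact hw.comp (f := fun σ => (s, σ)) (by fun_prop) fun σ _ => ⟨hs, trivial⟩

lemma Ioo_zero_subset : Ioo 0 R ⊆ Ioo (-R) R := fun _ hs => ⟨by linarith [hs.1, hs.2], hs.2⟩

lemma continuous_harmonic_tubePoint (hR : R ≤ 1)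
    (hh : HarmonicOnNhd h (openTube (k + 1 + m) k R)) {s : ℝ} (hs : s ∈ Ioo (-R) R) :
    Continuous fun σ : Params k m => h (tubePoint s σ) :=
  continuous_of_continuousOn_prod (w := fun s σ => h (tubePoint s σ))
    (continuousOn_harmonic_tubePoint hR hh) hs

lemma eq_zero_of_energy_eq_zero (hR : R ≤ 1) (hh : HarmonicOnNhd h (openTube (k + 1 + m) k R))
    {t : ℝ} (ht : t ∈ Ioo 0 R) (h0 : energy h t = 0) (σ : Params k m) : h (tubePoint t σ) = 0 :=
  pow_eq_zero_iff two_ne_zero |>.1 <| eq_zero_of_integral_jac_mul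
    (w := fun s σ => h (tubePoint s σ) ^ 2) ht.1 (ht.2.trans_le hR)
    ((continuous_harmonic_tubePoint hR hh (Ioo_zero_subset ht)).pow 2) (fun _ => sq_nonneg _) h0 σ

lemma energy_nonneg {t : ℝ} (ht0 : 0 < t) (ht1 : t < 1) : 0 ≤ energy h t :=
  integral_nonneg fun σ => mul_nonneg (jac_pos ht0 ht1 σ).le (sq_nonneg _)

lemma gradEnergy_nonneg {t : ℝ} (ht0 : 0 < t) (ht1 : t < 1) : 0 ≤ gradEnergy h t :=
  integral_nonneg fun σ => mul_nonneg (jac_pos ht0 ht1 σ).le (sq_nonneg _)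

/-- If `h` vanishes on a level surface, it vanishes on all smaller ones. -/
theorem energy_eq_zero_of_lt (hR : R ≤ 1) (hh : HarmonicOnNhd h (openTube (k + 1 + m) k R))
    {T : ℝ} (hT : T ∈ Ioo 0 R) (h0 : energy h T = 0) {t : ℝ} (ht : t ∈ Ioo 0 T) :
    energy h t = 0 := by
  have hz := eq_zero_of_energy_eq_zero hR hh hT h0
  -- The flux of `h∇h` through the level is the Dirichlet energy inside, so `∇h = 0` there and `h`
  -- is constant along normals up to its zero value at `T`.
  have hD : radialEnergy h T = 0 := by simp [radialEnergy, hz]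
  rw [radialEnergy_eq_integral_gradEnergy hR hh hT] at hD
  have hT1 : T < 1 := hT.2.trans_le hR
  have sub : Icc 0 T ⊆ Ioo (-R) R := fun s hs =>
    ⟨by linarith [hs.1, hT.1, hT.2], hs.2.trans_lt hT.2⟩
  have hc := (continuousOn_gradEnergy hR hh).mono sub
  have hE : ∀ s ∈ Ioo 0 T, gradEnergy h s = 0 := by
    intro s hs
    by_contra hne
    have hpos : 0 < gradEnergy h s :=
      lt_of_le_of_ne (gradEnergy_nonneg hs.1 (hs.2.trans hT1)) (Ne.symm hne)
    exact absurd hD (intervalIntegral.integral_pos hT.1 hc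
      (fun r hr => gradEnergy_nonneg hr.1 (hr.2.trans_lt hT1)) ⟨s, Ioo_subset_Icc_self hs, hpos⟩).ne'
  have hV : ∀ s ∈ Ioo 0 T, ∀ σ : Params k m, gradient h (tubePoint s σ) = 0 := by
    intro s hs σ
    have hs' : s ∈ Ioo (-R) R := sub (Ioo_subset_Icc_self hs)
    have hcont : Continuous fun σ : Params k m => gradient h (tubePoint s σ) :=
      continuous_of_continuousOn_prod (w := fun s σ => gradient h (tubePoint s σ))
        (continuousOn_gradient_tubePoint hR hh) hs'
    exact norm_eq_zero.1 <| pow_eq_zero_iff two_ne_zero |>.1 <| eq_zero_of_integral_jac_mul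
      (w := fun s σ => ‖gradient h (tubePoint s σ)‖ ^ 2) hs.1 (hs.2.trans hT1)
      (hcont.norm.pow 2) (fun _ => sq_nonneg _) (hE s hs) σ
  have hconst : ∀ σ : Params k m, h (tubePoint t σ) = 0 := by
    intro σ
    have hd : ∀ s ∈ Icc t T, HasDerivAt (fun r => h (tubePoint r σ)) (radialDeriv h s σ) s :=
      fun s hs => hasDerivAt_comp_tubePoint hR hh (sub ⟨ht.1.le.trans hs.1, hs.2⟩) σ
    have := constant_of_has_deriv_right_zero (f := fun r => h (tubePoint r σ))
      (fun s hs => (hd s hs).continuousAt.continuousWithinAt)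
      (fun s hs => by
        have := (hd s (Ico_subset_Icc_self hs)).hasDerivWithinAt (s := Ici s)
        rwa [radialDeriv, hV s ⟨ht.1.trans_le hs.1, hs.2⟩ σ, inner_zero_left] at this)
      T (right_mem_Icc.2 ht.2.le)
    rw [← this, hz σ]
  simp [energy, hconst]

lemma exists_energy_ne_zero (hR0 : 0 < R) (hR : R ≤ 1)
    (hh : HarmonicOnNhd h (openTube (k + 1 + m) k R)) {x : EuclideanSpace ℝ (Fin (k + 1 + m))}
    (hx : x ∈ openTube (k + 1 + m) k R) (hx0 : h x ≠ 0) : ∃ t ∈ Ioo 0 R, energy h t ≠ 0 := by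
  by_contra hcon
  push Not at hcon
  have hz : ∀ t ∈ Ioo 0 R, ∀ σ : Params k m, h (tubePoint t σ) = 0 := fun t ht =>
    eq_zero_of_energy_eq_zero hR hh ht (hcon t ht)
  have hxs : sqDist (k + 1 + m) k x < R ^ 2 := hx
  have hz' : ∀ y, 0 < sqDist (k + 1 + m) k y → sqDist (k + 1 + m) k y < R ^ 2 → h y = 0 := by
    intro y hy0 hyR
    have hq0 : 0 < √(sqDist (k + 1 + m) k y) := Real.sqrt_pos.2 hy0
    have hq : √(sqDist (k + 1 + m) k y) < R := by rwa [Real.sqrt_lt' hR0]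
    obtain ⟨σ, hσ⟩ := exists_tubePoint hq0 (hq.trans_le hR) (Real.sq_sqrt hy0.le).symm
    exact hσ ▸ hz _ ⟨hq0, hq⟩ σ
  -- A point of `S^k` lies on no level with `t > 0`; it is reached as the limit of `(1 + r)x`, which
  -- has distance `r`.
  rcases (sqDist_nonneg (k := k) x).eq_or_lt with e | e
  · have hρ : axisDist (k + 1 + m) k x = 1 := by
      have := sub_one_sq_le_sqDist (k := k) x
      rw [← e] at this
      nlinarith
    have hn : ‖x‖ ^ 2 = 1 := by
      unfold sqDist at e
      linarith
    have hq : ∀ r : ℝ, 0 < r → sqDist (k + 1 + m) k ((1 + r) • x) = r ^ 2 := by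
      intro r hr
      have h1 : axisDist (k + 1 + m) k ((1 + r) • x) = 1 + r := by
        rw [axisDist, map_smul, norm_smul, Real.norm_eq_abs, abs_of_pos (by linarith)]
        change _ * axisDist (k + 1 + m) k x = _
        rw [hρ, mul_one]
      rw [sqDist, h1, norm_smul, mul_pow, hn, Real.norm_eq_abs, sq_abs]
      ring
    have hc : ContinuousAt (fun r : ℝ => h ((1 + r) • x)) 0 := by
      refine ContinuousAt.comp (g := h) ?_ (by fun_prop)
      simpa using (hh x hx).1.continuousAt
    have h1 : Tendsto (fun r : ℝ => h ((1 + r) • x)) (𝓝[>] 0) (𝓝 0) := by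
      refine tendsto_const_nhds.congr' ?_
      filter_upwards [Ioo_mem_nhdsGT hR0] with r hr
      refine (hz' _ ?_ ?_).symm
      · rw [hq r hr.1]; exact pow_pos hr.1 2
      · rw [hq r hr.1]; exact pow_lt_pow_left₀ hr.2 hr.1.le two_ne_zero
    have h2 := tendsto_nhds_unique (hc.tendsto.mono_left nhdsWithin_le_nhds) h1
    simp only [add_zero, one_smul] at h2
    exact hx0 h2
  · exact hx0 (hz' x e hx)

/-! ### Constants -/

lemma dampingConst_zero (ε : ℝ) : dampingConst 0 ε = 1 := by simp [dampingConst]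

lemma lowerConst_zero (n : ℕ) (ε : ℝ) : lowerConst n 0 ε = 0 := by
  simp [lowerConst, dampingConst_zero]

lemma hasDerivAt_log_rpow {t : ℝ} (ht : 0 < t) : HasDerivAt log (t ^ (-1 : ℝ)) t := by
  rw [rpow_neg_one]
  exact hasDerivAt_log ht.ne'

lemma hasDerivAt_neg_rpow_div {C : ℝ} (hC : 1 < C) {t : ℝ} (ht : 0 < t) :
    HasDerivAt (fun s : ℝ => -(s ^ (-(C - 1)) / (C - 1))) (t ^ (-C)) t := by
  have hC' : C - 1 ≠ 0 := by linarith
  refine (((hasDerivAt_rpow_const (p := -(C - 1)) (Or.inl ht.ne')).div_const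
    (C - 1)).neg).congr_deriv ?_
  rw [show -(C - 1) - 1 = -C by ring]
  field_simp

/-- Some level has positive energy. Zeros outside it are excluded by `energy_eq_zero_of_lt`, zeros
inside it by `ne_zero_of_pos_right`; no unique continuation theorem is needed. -/
theorem energy_pos {ε : ℝ} (hε0 : 0 < ε) (hε1 : ε < 1)
    (hh : HarmonicOnNhd h (openTube (k + 1 + m) k (1 - ε)))
    (hne : ∃ x ∈ openTube (k + 1 + m) k (1 - ε), h x ≠ 0) {t : ℝ} (ht : t ∈ Ioo 0 (1 - ε)) :
    0 < energy h t := by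
  have hR : 1 - ε ≤ 1 := by linarith
  obtain ⟨x, hx, hx0⟩ := hne
  obtain ⟨T, hT, hT0⟩ := exists_energy_ne_zero (by linarith) hR hh hx hx0
  have nonneg : ∀ s ∈ Ioo 0 (1 - ε), 0 ≤ energy h s := fun s hs =>
    energy_nonneg hs.1 (hs.2.trans_le hR)
  refine lt_of_le_of_ne (nonneg t ht) fun e => ?_
  have hTpos := lt_of_le_of_ne (nonneg T hT) (Ne.symm hT0)
  have htT : t < T := by
    by_contra hc
    rcases (not_lt.1 hc).eq_or_lt with h1 | h1
    · exact hT0 (h1 ▸ e.symm)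
    · exact hT0 (energy_eq_zero_of_lt hR hh ht e.symm ⟨hT.1, h1⟩)
  have d1 := fun s (hs : s ∈ Ioo 0 (1 - ε)) => hasDerivAt_energy hR hh hs
  have d2 := fun s (hs : s ∈ Ioo 0 (1 - ε)) => hasDerivAt_energyDeriv hR hh hs
  have ineq := fun s (hs : s ∈ Ioo 0 (1 - ε)) => energy_inequality_of_pos hε0 hε1 hh hs
  rcases Nat.eq_zero_or_pos k with rfl | hk
  · exact ne_zero_of_pos_right (A := 0) d1 d2 nonneg ineq (by simp [lowerConst_zero])
      (fun s hs => by rw [dampingConst_zero]; exact hasDerivAt_log_rpow hs) ht.1 htT hT.2 hTpos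
      e.symm
  · have hC := one_lt_dampingConst hk hε0 hε1
    exact ne_zero_of_pos_right (A := -lowerConst (k + 1 + m) k ε / (dampingConst k ε - 1))
      d1 d2 nonneg ineq (div_mul_cancel₀ _ (by linarith))
      (fun s hs => hasDerivAt_neg_rpow_div hC hs) ht.1 htT hT.2 hTpos e.symm

end SphereTube
end

open Real Set MeasureTheory InnerProductSpace
noncomputable section

namespace SphereTube
open scoped NNReal ENNReal Topology ContDiff
open Filter

variable {k m : ℕ} {h : EuclideanSpace ℝ (Fin (k + 1 + m)) → ℝ} {ε : ℝ}

/-! ### Return to the surface integral and the three-surface inequalities -/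

lemma sphereTube_eq_openTube {n k : ℕ} (hkn : k < n) {R : ℝ} (hR : 0 < R) :
    sphereTube n k R = openTube n k R := Set.ext fun x => mem_sphereTube hkn hR x

lemma surfaceEnergy_eq_energy {t : ℝ} (ht0 : 0 < t) (ht1 : t < 1) :
    surfaceEnergy (k + 1 + m) k h t = energy h t := by
  rw [surfaceEnergy, show k + 1 + m - 1 = k + m by omega, setIntegral_levelSurface ht0 ht1]
  rfl

lemma integrableOn_sq_levelSurface (hR : 1 - ε ≤ 1)
    (hh : HarmonicOnNhd h (openTube (k + 1 + m) k (1 - ε))) {t : ℝ} (ht : t ∈ Ioo 0 (1 - ε)) :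
    IntegrableOn (fun x => h x ^ 2) (levelSurface (k + 1 + m) k t) μHE[k + 1 + m - 1] := by
  rw [show k + 1 + m - 1 = k + m by omega]
  exact integrableOn_levelSurface ht.1 (ht.2.trans_le hR)
    ((continuous_harmonic_tubePoint hR hh (Ioo_zero_subset ht)).pow 2)

lemma eventuallyEq_of_Ioo {f g : ℝ → ℝ} {a b : ℝ} (hfg : ∀ t ∈ Ioo a b, f t = g t) {t : ℝ}
    (ht : t ∈ Ioo a b) : f =ᶠ[𝓝 t] g := by
  filter_upwards [isOpen_Ioo.mem_nhds ht] with s hs using hfg s hs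

lemma three_surfaces {A t₀ t₁ t₂ α a₀ a₁ a₂ : ℝ} (h0 : 0 < t₀) (h1 : 0 < t₁) (h2 : 0 < t₂)
    (ha0 : 0 < a₀) (ha1 : 0 < a₁) (ha2 : 0 < a₂)
    (hle : log a₁ + A * log t₁ ≤ α * (log a₀ + A * log t₀) + (1 - α) * (log a₂ + A * log t₂)) :
    a₁ ≤ (t₀ / t₁) ^ (α * A) * (t₂ / t₁) ^ ((1 - α) * A) * a₀ ^ α * a₂ ^ (1 - α) := by
  rw [← log_le_log_iff ha1 (by positivity), log_mul (by positivity) (by positivity),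
    log_mul (by positivity) (by positivity), log_mul (by positivity) (by positivity),
    log_rpow (by positivity), log_rpow (by positivity), log_rpow ha0, log_rpow ha2,
    log_div h0.ne' h1.ne', log_div h2.ne' h1.ne']
  linarith

/-- The hypothesis on `α` is the interpolation condition for `φ = -t^(-c)/c`, divided by the value
of `φ` at `t₁`. -/
lemma combination_of_rpow {c t₀ t₁ t₂ α : ℝ} (h0 : 0 < t₀) (h1 : 0 < t₁) (h2 : 0 < t₂)
    (hα : (1 - α) * (t₁ / t₂) ^ c + α * (t₁ / t₀) ^ c = 1) :
    α * -(t₀ ^ (-c) / c) + (1 - α) * -(t₂ ^ (-c) / c) = -(t₁ ^ (-c) / c) := by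
  rw [div_rpow h1.le h2.le, div_rpow h1.le h0.le] at hα
  rw [rpow_neg h0.le, rpow_neg h1.le, rpow_neg h2.le]
  have p0 : t₀ ^ c ≠ 0 := (rpow_pos_of_pos h0 c).ne'
  have p1 : t₁ ^ c ≠ 0 := (rpow_pos_of_pos h1 c).ne'
  have p2 : t₂ ^ c ≠ 0 := (rpow_pos_of_pos h2 c).ne'
  have e : (t₁ ^ c)⁻¹ = (t₁ ^ c)⁻¹ * ((1 - α) * (t₁ ^ c / t₂ ^ c) + α * (t₁ ^ c / t₀ ^ c)) := by
    rw [hα, mul_one]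
  rw [e]
  field_simp
  ring

theorem energy_spec (hε0 : 0 < ε) (hε1 : ε < 1)
    (hh : HarmonicOnNhd h (openTube (k + 1 + m) k (1 - ε)))
    (hne : ∃ x ∈ openTube (k + 1 + m) k (1 - ε), h x ≠ 0) :
    ∃ H₁ H₂ : ℝ → ℝ, ∀ t ∈ Ioo 0 (1 - ε), 0 < surfaceEnergy (k + 1 + m) k h t ∧
      HasDerivAt (surfaceEnergy (k + 1 + m) k h) (H₁ t) t ∧ HasDerivAt H₁ (H₂ t) t ∧
      lowerConst (k + 1 + m) k ε * surfaceEnergy (k + 1 + m) k h t ^ 2 ≤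
        t ^ 2 * (H₂ t * surfaceEnergy (k + 1 + m) k h t - H₁ t ^ 2) +
          dampingConst k ε * t * surfaceEnergy (k + 1 + m) k h t * H₁ t := by
  have hR : 1 - ε ≤ 1 := by linarith
  have e : ∀ t ∈ Ioo 0 (1 - ε), surfaceEnergy (k + 1 + m) k h t = energy h t := fun t ht =>
    surfaceEnergy_eq_energy ht.1 (ht.2.trans_le hR)
  refine ⟨energyDeriv h, energyDeriv2 h, fun t ht => ?_⟩
  have hpos := energy_pos hε0 hε1 hh hne ht
  rw [e t ht]
  exact ⟨hpos, (hasDerivAt_energy hR hh ht).congr_of_eventuallyEq (eventuallyEq_of_Ioo e ht),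
    hasDerivAt_energyDeriv hR hh ht, energy_inequality_of_pos hε0 hε1 hh ht hpos⟩

end SphereTube
end

open SphereTube in
theorem mainTheorem8 (n k : ℕ) (hkn : k < n) :
    -- for `n = 3`, `k = 1` the level surfaces are tori
    (n = 3 → k = 1 → ∀ t ∈ Ioo (0 : ℝ) 1, Nonempty (levelSurface n k t ≃ₜ Circle × Circle)) ∧
    ∀ ε : ℝ, 0 < ε → ε < 1 →
    ∀ h : EuclideanSpace ℝ (Fin n) → ℝ,
      HarmonicOnNhd h (sphereTube n k (1 - ε)) →
      (∃ x ∈ sphereTube n k (1 - ε), h x ≠ 0) →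
      -- `H` is well defined, positive and twice differentiable, and satisfies the inequality
      (∀ t ∈ Ioo 0 (1 - ε),
        IntegrableOn (fun x => h x ^ 2) (levelSurface n k t) μHE[n - 1] ∧
        0 < surfaceEnergy n k h t ∧
        DifferentiableAt ℝ (surfaceEnergy n k h) t ∧
        DifferentiableAt ℝ (deriv (surfaceEnergy n k h)) t ∧
        (deriv (deriv (surfaceEnergy n k h)) t * surfaceEnergy n k h t
            - deriv (surfaceEnergy n k h) t ^ 2
            + dampingConst k ε / t * surfaceEnergy n k h t * deriv (surfaceEnergy n k h) t)
          / surfaceEnergy n k h t ^ 2 ≥ lowerConst n k ε / t ^ 2 ∧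
        deriv (deriv (fun s => log (surfaceEnergy n k h s))) t
            + dampingConst k ε / t * deriv (fun s => log (surfaceEnergy n k h s)) t
          ≥ lowerConst n k ε / t ^ 2) ∧
      -- the case `C > 1`, which is `k ≥ 1`
      (1 ≤ k → 1 < dampingConst k ε ∧
        (∀ t₀ t₁ t₂ α : ℝ, 0 < t₀ → t₀ ≤ t₁ → t₁ ≤ t₂ → t₂ < 1 - ε →
          (1 - α) * (t₁ / t₂) ^ (dampingConst k ε - 1)
            + α * (t₁ / t₀) ^ (dampingConst k ε - 1) = 1 →
          surfaceEnergy n k h t₁ ≤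
            (t₀ / t₁) ^ (α * (-lowerConst n k ε / (dampingConst k ε - 1)))
              * (t₂ / t₁) ^ ((1 - α) * (-lowerConst n k ε / (dampingConst k ε - 1)))
              * surfaceEnergy n k h t₀ ^ α * surfaceEnergy n k h t₂ ^ (1 - α)) ∧
        MonotoneOn
          (fun t : ℝ => t ^ (dampingConst k ε - 1)
            * (t * deriv (surfaceEnergy n k h) t / surfaceEnergy n k h t
              + -lowerConst n k ε / (dampingConst k ε - 1)))
          (Ioo 0 (1 - ε))) ∧
      -- the case `C = 1`, which is `k = 0`
      (k = 0 → dampingConst k ε = 1 ∧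
        (∀ t₀ t₁ t₂ α : ℝ, 0 < t₀ → t₀ ≤ t₁ → t₁ ≤ t₂ → t₂ < 1 - ε →
          (1 - α) * log (t₁ / t₂) + α * log (t₁ / t₀) = 0 →
          surfaceEnergy n k h t₁ ≤
            exp (-(-lowerConst n k ε) / 2 * log (t₀ / t₁) * log (t₂ / t₁))
              * surfaceEnergy n k h t₀ ^ α * surfaceEnergy n k h t₂ ^ (1 - α)) ∧
        MonotoneOn
          (fun t : ℝ => t * deriv (surfaceEnergy n k h) t / surfaceEnergy n k h t
            + -lowerConst n k ε * log t)
          (Ioo 0 (1 - ε))) := by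

  -- The normal directions to `S^k` then form a sphere `S^m`.
  obtain ⟨m, rfl⟩ : ∃ m, n = k + 1 + m := ⟨n - (k + 1), by omega⟩
  refine ⟨fun hn hk t ht => ?_, fun ε hε0 hε1 h hh hne => ?_⟩
  · subst hk
    obtain rfl : m = 1 := by omega
    exact nonempty_homeomorph_torus ht
  have hR : 1 - ε ≤ 1 := by linarith
  rw [sphereTube_eq_openTube hkn (by linarith)] at hh hne
  obtain ⟨H₁, H₂, spec⟩ := energy_spec hε0 hε1 hh hne
  set H := surfaceEnergy (k + 1 + m) k h
  set B := lowerConst (k + 1 + m) k ε with hB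
  set C := dampingConst k ε with hC
  have hpos : ∀ t ∈ Ioo 0 (1 - ε), 0 < H t := fun t ht => (spec t ht).1
  have d1 : ∀ t ∈ Ioo 0 (1 - ε), HasDerivAt H (H₁ t) t := fun t ht => (spec t ht).2.1
  have d2 : ∀ t ∈ Ioo 0 (1 - ε), HasDerivAt H₁ (H₂ t) t := fun t ht => (spec t ht).2.2.1
  have ineq := fun t ht => (spec t ht).2.2.2
  have e1 : ∀ t ∈ Ioo 0 (1 - ε), deriv H t = H₁ t := fun t ht => (d1 t ht).deriv
  refine ⟨fun t ht => ?_, fun hk => ?_, fun hk => ?_⟩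
  · have hp := hpos t ht
    have ht0 : 0 < t := ht.1
    have d1' : HasDerivAt (deriv H) (H₂ t) t :=
      (d2 t ht).congr_of_eventuallyEq (eventuallyEq_of_Ioo e1 ht)
    have key : B / t ^ 2 ≤ (H₂ t * H t - H₁ t ^ 2 + C / t * H t * H₁ t) / H t ^ 2 := by
      rw [div_le_div_iff₀ (by positivity) (by positivity)]
      refine (ineq t ht).trans_eq ?_
      field_simp
    have l1 : ∀ s ∈ Ioo 0 (1 - ε), deriv (fun s => log (H s)) s = H₁ s / H s := fun s hs =>
      ((d1 s hs).log (hpos s hs).ne').deriv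
    have l2 : deriv (deriv fun s => log (H s)) t = (H₂ t * H t - H₁ t * H₁ t) / H t ^ 2 :=
      (((d2 t ht).div (d1 t ht) hp.ne').congr_of_eventuallyEq (eventuallyEq_of_Ioo l1 ht)).deriv
    refine ⟨integrableOn_sq_levelSurface hR hh ht, hp, (d1 t ht).differentiableAt,
      d1'.differentiableAt, ?_, ?_⟩
    · rw [d1'.deriv, e1 t ht]
      exact key
    · rw [l2, l1 t ht]
      refine key.trans_eq ?_
      field_simp
  · have hC1 : 1 < C := one_lt_dampingConst hk hε0 hε1
    have hA : -B / (C - 1) * (C - 1) = -B := div_mul_cancel₀ _ (by linarith)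
    refine ⟨hC1, fun t₀ t₁ t₂ α h0 h01 h12 h2 hα => ?_, ?_⟩
    · have p1 := h0.trans_le h01
      have p2 := p1.trans_le h12
      exact three_surfaces h0 p1 p2 (hpos _ ⟨h0, by linarith⟩) (hpos _ ⟨p1, by linarith⟩)
        (hpos _ ⟨p2, h2⟩) (log_add_le_of_mem d1 d2 hpos ineq hA
          (fun t ht => hasDerivAt_neg_rpow_div hC1 ht) h0 h01 h12 h2
          (combination_of_rpow h0 p1 p2 hα))
    · refine (monotoneOn_frequency le_rfl d1 d2 hpos ineq hA).congr fun t ht => ?_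
      have ht0 : t ≠ 0 := ht.1.ne'
      have hp := (hpos t ht).ne'
      simp only
      rw [e1 t ht, rpow_sub_one ht0]
      field_simp
  · subst hk
    have hC1 : C = 1 := dampingConst_zero ε
    have hB0 : B = 0 := lowerConst_zero _ ε
    -- For `k = 0` one has `B = 0`, so `A = 0` is admissible and the exponential factor is `1`.
    have hA : 0 * (C - 1) = -B := by rw [hB0]; ring
    refine ⟨hC1, fun t₀ t₁ t₂ α h0 h01 h12 h2 hα => ?_, ?_⟩
    · have p1 := h0.trans_le h01
      have p2 := p1.trans_le h12
      rw [log_div p1.ne' p2.ne', log_div p1.ne' h0.ne'] at hα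
      have hφ : α * log t₀ + (1 - α) * log t₂ = log t₁ := by linarith
      have := three_surfaces (α := α) h0 p1 p2 (hpos _ ⟨h0, by linarith⟩) (hpos _ ⟨p1, by linarith⟩)
        (hpos _ ⟨p2, h2⟩) (log_add_le_of_mem d1 d2 hpos ineq hA
          (fun t ht => by rw [hC1]; exact hasDerivAt_log_rpow ht) h0 h01 h12 h2 hφ)
      simpa [hB0] using this
    · refine (monotoneOn_frequency le_rfl d1 d2 hpos ineq hA).congr fun t ht => ?_
      have ht0 : t ≠ 0 := ht.1.ne'
      have hp := (hpos t ht).ne'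
      simp only
      rw [e1 t ht, hC1, hB0, rpow_one]
      field_simp
      ring
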